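/- **Setting.** Let $P$ be a compact metric space with a continuous flow $\{\tau_t\}_{t\in\mathbb R}$ that is minimal (every orbit is dense) and has a unique invariant Borel probability measure $\mu$. Let $I\subset\mathbb R$ be a compact interval with $0$ in its interior, let $d$ and $r\ge 1$ be integers, and let $f:P\times\mathbb R^d\times I\to\mathbb R^d$ satisfy $f(p,0,\varepsilon)=0$, be of class $C^r$ in $x$, and have derivatives $\partial_x^kf$, $0\le k\le r$, that are continuous on $P\times\mathbb R^d\times I$. Put $l_\varepsilon(p)=\partial_xf(p,0,\varepsilon)$, $\bar f(x,\varepsilon)=\int_Pf(p,x,\varepsilon)\,d\mu(p)$ and $\bar l_0=\partial_x\bar f(0,0)$. Assume that the set of complex eigenvalues of $\bar l_0$ is the union of two nonempty sets, $\Sigma^{(0)}$, consisting of the eigenvalues with $\mathrm{Re}\,\lambda=0$, and $\Sigma^{(-)}$, consisting of the eigenvalues with $\mathrm{Re}\,\lambda<0$. Let $0<\alpha<\beta$ be such that $\mathrm{Re}\,\lambda<-\beta$ for all $\lambda\in\Sigma^{(-)}$. Let $e$ be the dimension of the intersection of $\mathbb R^d$ with the sum of the generalized eigenspaces of $\bar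 l_0$ belonging to $\Sigma^{(0)}$. Matrices carry the operator norm $|\cdot|$ of the Euclidean norm, $|\varphi|_0=\sup_q|\varphi(q)|$, and fundamental matrix solutions are normalized to be the identity at $s=0$. **Statement.** There are constants $\varepsilon_3>0$, $\theta\ge0$ and $k_1>0$ such that for every $\varepsilon\in I$ with $0<|\varepsilon|\le\varepsilon_3$ there exist a compact metric space $Q$ with a minimal flow $\{T_s\}$, a continuous surjection $\pi:Q\to P$ with $\pi(T_sq)=\tau_{s/|\varepsilon|}(\pi(q))$ for all $s\in\mathbb R$ and $q\in Q$, and a continuous map $\sigma$ from $Q$ to the real $d\times d$ matrices, such that, with $l(q)=l_\varepsilon(\pi(q))$: * $\sigma(q)$ is invertible for every $q$, $q\mapsto\sigma(q)^{-1}$ is continuous, and $\sigma'(q)=\frac{d}{ds}\sigma(T_sq)\big|_{s=0}$ exists and is continuous in $q$; * for each $q\in Q$ the change of variables $x=\sigma(T_sq)y$ transforms $\frac{dx}{ds}=l(T_sq)x$ into $\frac{dy}{ds}=\begin{pmatrix}a(T_sq)&0\\0&b(T_sq)\end{pmatrix}y$, where $a$ and $b$ are continuous functions on $Q$ with values in the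 real $e\times e$ and $(d-e)\times(d-e)$ matrices, and $|a|_0\le|l|_0$, $|b|_0\le|l|_0$; * (i) $|\sigma(q)|\le\theta$ and $|\sigma(q)^{-1}|\le\theta$ for all $q\in Q$; * (ii) for every $q\in Q$ the fundamental matrix solutions $\Phi^{(a)}_q(s)$ of $\frac{du}{ds}=a(T_sq)u$ and $\Phi^{(b)}_q(s)$ of $\frac{dv}{ds}=b(T_sq)v$ satisfy $$|\Phi^{(a)}_q(s)|\le k_1e^{\alpha|s|}\quad(s\in\mathbb R),\qquad|\Phi^{(b)}_q(s)|\le k_1e^{-\beta s}\quad(s\ge0).$$ In particular $\theta$ and $k_1$ depend neither on $q$ nor on $\varepsilon$. -/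

import Mathlib

open MeasureTheory Set Topology
open scoped Matrix Matrix.Norms.L2Operator

universe u

/-! Matrices carry the operator norm coming from the Euclidean norms (`Matrix.Norms.L2Operator`). -/

noncomputable section

/-! ### Flows -/

/-- A flow is minimal if every orbit is dense. -/
def IsMinimalFlow {X : Type*} [TopologicalSpace X] (T : Flow ℝ X) : Prop :=
  ∀ x : X, Dense (range fun t : ℝ => T t x)

/-- The measure `μ` is invariant under the flow `T`. -/
def IsInvariantMeasure {X : Type*} [TopologicalSpace X] [MeasurableSpace X]
    (T : Flow ℝ X) (μ : Measure X) : Prop :=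
  ∀ (t : ℝ) (B : Set X), MeasurableSet B → μ (T t '' B) = μ B

/-- `μ` is the one and only invariant Borel probability measure of the flow `T`. -/
def IsUniqueInvariantProbability {X : Type*} [TopologicalSpace X] [MeasurableSpace X]
    (T : Flow ℝ X) (μ : Measure X) : Prop :=
  (IsProbabilityMeasure μ ∧ IsInvariantMeasure T μ) ∧
    ∀ ν : Measure X, IsProbabilityMeasure ν → IsInvariantMeasure T ν → ν = μ

/-- The fast flow `s ↦ τ_{s/|ε|}` (used only for `ε ≠ 0`). -/
def fastFlow {X : Type*} [TopologicalSpace X] (τ : Flow ℝ X) (ε : ℝ) : Flow ℝ X where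
  toFun s x := τ (s / |ε|) x
  cont' := by
    have h : Continuous fun z : ℝ × X => τ (z.1 / |ε|) z.2 := by fun_prop
    exact h
  map_add' s t x := by
    rw [add_div, Flow.map_add]
  map_zero' x := by
    rw [zero_div, Flow.map_zero_apply]

/-! ### Linearizations and averages -/

/-- The matrix of the derivative at the origin of a map `g : ℝᵈ → ℝᵈ`. -/
def linearPart {d : ℕ} (g : EuclideanSpace ℝ (Fin d) → EuclideanSpace ℝ (Fin d)) :
    Matrix (Fin d) (Fin d) ℝ :=
  (Matrix.toEuclideanCLM (n := Fin d) (𝕜 := ℝ)).symm (fderiv ℝ g 0)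

/-- The average `x ↦ ∫ f(p, x, ε) dμ(p)`. -/
def averagedField {P : Type*} [MeasurableSpace P] {d : ℕ} (μ : Measure P)
    (f : P → EuclideanSpace ℝ (Fin d) → ℝ → EuclideanSpace ℝ (Fin d)) (ε : ℝ) :
    EuclideanSpace ℝ (Fin d) → EuclideanSpace ℝ (Fin d) :=
  fun x => ∫ p, f p x ε ∂μ

/-- The set of complex eigenvalues of a real matrix. -/
def complexEigenvalues {d : ℕ} (A : Matrix (Fin d) (Fin d) ℝ) : Set ℂ :=
  {z | Module.End.HasEigenvalue (Matrix.toLin' (A.map Complex.ofReal)) z}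

/-- The complex eigenvalues with zero real part. -/
def centerEigenvalues {d : ℕ} (A : Matrix (Fin d) (Fin d) ℝ) : Set ℂ :=
  {z | z ∈ complexEigenvalues A ∧ z.re = 0}

/-- The complex eigenvalues with negative real part. -/
def stableEigenvalues {d : ℕ} (A : Matrix (Fin d) (Fin d) ℝ) : Set ℂ :=
  {z | z ∈ complexEigenvalues A ∧ z.re < 0}

/-- The center subspace: the real vectors in the sum of the complex generalized eigenspaces
that belong to the eigenvalues with zero real part. -/
def centerSubspace {d : ℕ} (A : Matrix (Fin d) (Fin d) ℝ) : Submodule ℝ (Fin d → ℝ) :=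
  ((⨆ z ∈ centerEigenvalues A,
      Module.End.maxGenEigenspace (Matrix.toLin' (A.map Complex.ofReal)) z).restrictScalars ℝ).comap
    (Complex.ofRealCLM.toLinearMap.compLeft (Fin d))

/-- The dimension `e` of the center subspace. -/
def centerDim {d : ℕ} (A : Matrix (Fin d) (Fin d) ℝ) : ℕ :=
  Module.finrank ℝ (centerSubspace A)

theorem centerDim_le {d : ℕ} (A : Matrix (Fin d) (Fin d) ℝ) : centerDim A ≤ d := by
  have h := Submodule.finrank_le (centerSubspace A)
  rwa [Module.finrank_fin_fun] at h

/-! ### Linear systems -/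

/-- `x` is a solution on `ℝ` of the linear system `x' = A(s) x`. -/
def IsLinearSolution {ι : Type*} [Fintype ι] (A : ℝ → Matrix ι ι ℝ) (x : ℝ → ι → ℝ) : Prop :=
  ∀ s : ℝ, HasDerivAt x (A s *ᵥ x s) s

/-- `Φ` is the fundamental matrix solution of `x' = A(s) x`, normalized by `Φ(0) = I`. -/
def IsFundamentalMatrix {ι : Type*} [Fintype ι] [DecidableEq ι]
    (A Φ : ℝ → Matrix ι ι ℝ) : Prop :=
  Φ 0 = 1 ∧ ∀ s : ℝ, HasDerivAt Φ (A s * Φ s) s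

/-- The `d × d` block-diagonal matrix with an upper left `e × e` block `a` and a lower right
`(d - e) × (d - e)` block `b`. -/
def blockDiag {d e : ℕ} (he : e ≤ d) (a : Matrix (Fin e) (Fin e) ℝ)
    (b : Matrix (Fin (d - e)) (Fin (d - e)) ℝ) : Matrix (Fin d) (Fin d) ℝ :=
  Matrix.reindex (finSumFinEquiv.trans (finCongr (Nat.add_sub_of_le he)))
    (finSumFinEquiv.trans (finCongr (Nat.add_sub_of_le he)))
    (Matrix.fromBlocks a 0 0 b)

/-- The function `σ`, together with the continuous blocks `a` and `b`, block-diagonalizes the family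
of linear systems `x' = l(T_s(q)) x`, `q ∈ Q`. -/
structure IsBlockDiagonalization {Q : Type*} [TopologicalSpace Q] {d e : ℕ} (he : e ≤ d)
    (T : Flow ℝ Q) (l σ : Q → Matrix (Fin d) (Fin d) ℝ) (a : Q → Matrix (Fin e) (Fin e) ℝ)
    (b : Q → Matrix (Fin (d - e)) (Fin (d - e)) ℝ) : Prop where
  continuous_sigma : Continuous σ
  /-- `σ(q)` is invertible. -/
  isUnit_sigma : ∀ q, IsUnit (σ q)
  continuous_sigma_inv : Continuous fun q => (σ q)⁻¹
  /-- The derivative of `σ` along the flow exists and is continuous. -/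
  deriv_sigma : ∃ σ' : Q → Matrix (Fin d) (Fin d) ℝ, Continuous σ' ∧
    ∀ q, HasDerivAt (fun s : ℝ => σ (T s q)) (σ' q) 0
  continuous_a : Continuous a
  continuous_b : Continuous b
  /-- The change of variables `x = σ(T_s(q)) y` transforms `x' = l(T_s(q)) x` into the
  block-diagonal system. -/
  transforms : ∀ (q : Q) (y : ℝ → Fin d → ℝ),
    IsLinearSolution (fun s => l (T s q)) (fun s => σ (T s q) *ᵥ y s) ↔
      IsLinearSolution (fun s => blockDiag he (a (T s q)) (b (T s q))) y
  /-- `|a|₀ ≤ |l|₀` -/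
  norm_a_le : (⨆ q, ‖a q‖) ≤ ⨆ q, ‖l q‖
  /-- `|b|₀ ≤ |l|₀` -/
  norm_b_le : (⨆ q, ‖b q‖) ≤ ⨆ q, ‖l q‖

end

/-! On the fast time scale the coefficient l_ε oscillates rapidly along the orbits of S = `fastFlow
τ ε`, so the system should behave like y' = A y, where A is the linear part of the averaged field at
ε = 0. Unique ergodicity makes this uniform in the base point: the Abel means c(p) = ∫₀^∞ e^{-u}
(l_ε(S_u p) - A) du tend to 0 uniformly in p as ε → 0. For a fixed function this is
`IsUniqueInvariantProbability.expMean_close`, a compactness argument for occupation measures;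
passing from l_0 to l_ε costs only sup |l_ε - l_0|. Along the flow c' = c - (l_ε - A), so the change
of variables 1 - c is close to the identity and turns the system into y' = (A + B) y with B small
(`exists_nearIdentity_averaging`).

Let S₀ be the spectral projection of A onto the center subspace. Since center and stable rates
differ, the commutator with A is hyperbolic on matrices that are off-diagonal for S₀. Hence there is
a bounded small H such that 1 + H conjugates A + B to A + D with D small and commuting with S₀; it
is the fixed point of an integral operator (`IsExponentialSplitting.exists_decoupling`). Grönwall's
inequality on the two blocks gives the growth rates, and the loss in the exponents is covered by the
slack between the true rates of A and α, β. The constants depend on A, its splitting, the rates and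
a bound for l, never on ε or the flow.

All of this lives on P. The extension Q is there for the bounds |a|₀ ≤ |l|₀ and |b|₀ ≤ |l|₀. For an
orthonormal frame U of an invariant subbundle the coefficient in that frame is Uᵀ l U - Uᵀ U'; its
norm is at most that of l if Uᵀ U' = 0, that is, if U is moved by parallel transport. Such a U need
not close up to a function on P, but it is a coordinate function on the bundle of orthonormal
frames, where the transport acts as a flow (`IsInvariantFrame.exists_parallelTransport`). Pairs of
frames of the two subbundles form a compact invariant set, and Q is a minimal subset of it
(`exists_orthonormal_extension`).

Orthonormal frames have norm at most 1, which bounds σ; its inverse is controlled by the oblique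
projections of the splitting, and the growth estimates pass to a and b because the change between
the two kinds of frames is bounded (`IsInvariantFrame.exists_isFundamentalMatrix`). -/

noncomputable section

/-! ### Elementary estimates for linear differential equations -/

section LinearODE

variable {F : Type*} [NormedAddCommGroup F] [NormedSpace ℝ F]

theorem norm_sub_le_of_deriv_le_exp {f f' : ℝ → F} {C k : ℝ} (hk : 0 < k)
    (hf : ∀ u, HasDerivAt f (f' u) u) (hb : ∀ u, ‖f' u‖ ≤ C * Real.exp (k * |u|)) (s : ℝ) :
    ‖f s - f 0‖ ≤ C / k * Real.exp (k * |s|) := by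
  have hC : 0 ≤ C := by
    have := (norm_nonneg _).trans (hb 0)
    simpa using this
  have key : ∀ (g g' : ℝ → F), (∀ u, HasDerivAt g (g' u) u) →
      (∀ u, ‖g' u‖ ≤ C * Real.exp (k * |u|)) → ∀ s, 0 ≤ s →
      ‖g s - g 0‖ ≤ C / k * Real.exp (k * s) := by
    intro g g' hg hgb s hs
    have hB : ∀ x : ℝ, HasDerivAt (fun x => C / k * Real.exp (k * x)) (C * Real.exp (k * x)) x := by
      intro x
      refine ((((hasDerivAt_id' x).const_mul k).exp).const_mul (C / k)).congr_deriv ?_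
      field_simp
    refine image_norm_le_of_norm_deriv_right_le_deriv_boundary (f := fun x => g x - g 0)
      (f' := g') (a := 0) (b := s) ?_ ?_ ?_ hB ?_ ⟨hs, le_rfl⟩
    · exact fun x _ => ((hg x).sub_const _).continuousAt.continuousWithinAt
    · exact fun x _ => ((hg x).sub_const _).hasDerivWithinAt
    · simp only [sub_self, norm_zero]
      positivity
    · intro x hx
      have := hgb x
      rwa [abs_of_nonneg hx.1] at this
  rcases le_total 0 s with hs | hs
  · rw [abs_of_nonneg hs]
    exact key f f' hf hb s hs
  · have h := key (fun u => f (-u)) (fun u => -f' (-u))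
      (fun u => by simpa [Function.comp_def] using (hf (-u)).scomp u (hasDerivAt_neg u))
      (fun u => by simpa using hb (-u)) (-s) (by linarith)
    rw [abs_of_nonpos hs]
    simpa using h

theorem linearODE_unique {L : ℝ → F →L[ℝ] F} {m : ℝ} (hL : ∀ s, ‖L s‖ ≤ m) {x y : ℝ → F}
    (hx : ∀ s, HasDerivAt x (L s (x s)) s) (hy : ∀ s, HasDerivAt y (L s (y s)) s)
    (h0 : x 0 = y 0) : x = y := by
  refine ODE_solution_unique_univ (v := fun t z => L t z) (s := fun _ => univ) (K := m.toNNReal)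
    (t₀ := 0) (fun t => ?_) (fun t => ⟨hx t, mem_univ _⟩) (fun t => ⟨hy t, mem_univ _⟩) h0
  refine ((L t).lipschitz.weaken ?_).lipschitzOnWith
  rw [← norm_toNNReal]
  exact Real.toNNReal_le_toNNReal (hL t)

end LinearODE

/-! ### The fundamental solution over a flow, as a Picard series -/

section Cocycle

variable {X : Type*} [TopologicalSpace X] {R : Type*} [NormedRing R] [NormedAlgebra ℝ R]

/-- The terms of the Picard series of `Ψ' = M(S_s x) Ψ`, `Ψ(0) = 1`. -/
def picardTerm (S : Flow ℝ X) (M : X → R) : ℕ → X → ℝ → R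
  | 0, _, _ => 1
  | n + 1, x, s => ∫ u in (0 : ℝ)..s, M (S u x) * picardTerm S M n x u

/-- The fundamental solution of `Ψ' = M(S_s x) Ψ`. -/
def fundamentalCocycle (S : Flow ℝ X) (M : X → R) (x : X) (s : ℝ) : R :=
  ∑' n, picardTerm S M n x s

variable (S : Flow ℝ X) {M : X → R} (hM : Continuous M)

include hM in
theorem continuous_picardTerm (n : ℕ) :
    Continuous fun z : X × ℝ => picardTerm S M n z.1 z.2 := by
  induction n with
  | zero => exact continuous_const
  | succ n ih =>
    simp only [picardTerm]
    have h : Continuous (Function.uncurry fun (z : X × ℝ) (u : ℝ) =>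
        M (S u z.1) * picardTerm S M n z.1 u) := by
      refine (hM.comp (by fun_prop)).mul
        (ih.comp (f := fun w : (X × ℝ) × ℝ => (w.1.1, w.2)) (by fun_prop))
    exact intervalIntegral.continuous_parametric_intervalIntegral_of_continuous h continuous_snd

variable [CompleteSpace R]

include hM in
theorem hasDerivAt_picardTerm_succ (n : ℕ) (x : X) (s : ℝ) :
    HasDerivAt (picardTerm S M (n + 1) x) (M (S s x) * picardTerm S M n x s) s := by
  have hc : Continuous fun u => M (S u x) * picardTerm S M n x u :=
    (hM.comp (by fun_prop)).mul ((continuous_picardTerm S hM n).comp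
      (f := fun u : ℝ => (x, u)) (by fun_prop))
  exact intervalIntegral.integral_hasDerivAt_right (hc.intervalIntegrable _ _)
    hc.stronglyMeasurable.stronglyMeasurableAtFilter hc.continuousAt

variable {m : ℝ} (hm : 0 < m) (hMm : ∀ x, ‖M x‖ ≤ m)

include hM hm hMm

/-- In the norm weighted by exp(2m|s|) each Picard iteration contracts by m / (2m) = 1/2. The series
therefore converges geometrically, uniformly in the base point and locally uniformly in time, which
gives joint continuity and termwise differentiation. -/
theorem norm_picardTerm_le (n : ℕ) (x : X) (s : ℝ) :
    ‖picardTerm S M n x s‖ ≤ ‖(1 : R)‖ * (1 / 2) ^ n * Real.exp (2 * m * |s|) := by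
  induction n generalizing s with
  | zero =>
    simp only [picardTerm, pow_zero, mul_one]
    refine le_mul_of_one_le_right (norm_nonneg _) (Real.one_le_exp (by positivity))
  | succ n ih =>
    have h := norm_sub_le_of_deriv_le_exp (C := m * (‖(1 : R)‖ * (1 / 2) ^ n)) (k := 2 * m)
      (by positivity)
      (hasDerivAt_picardTerm_succ S hM n x) (fun u => ?_) s
    · have h0 : picardTerm S M (n + 1) x 0 = 0 := by simp [picardTerm]
      rw [h0, sub_zero] at h
      refine h.trans (le_of_eq ?_)
      field_simp
      ring
    · refine (norm_mul_le _ _).trans ?_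
      rw [mul_assoc]
      exact mul_le_mul (hMm _) (ih u) (norm_nonneg _) hm.le

theorem summable_picardTerm (x : X) (s : ℝ) : Summable fun n => picardTerm S M n x s := by
  refine Summable.of_norm_bounded (g := fun n => ‖(1 : R)‖ * (1 / 2) ^ n * Real.exp (2 * m * |s|))
    ?_ (fun n => norm_picardTerm_le S hM hm hMm n x s)
  exact (summable_geometric_two.mul_left _).mul_right _

theorem fundamentalCocycle_zero (x : X) : fundamentalCocycle S M x 0 = 1 := by
  rw [fundamentalCocycle, (summable_picardTerm S hM hm hMm x 0).tsum_eq_zero_add]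
  simp [picardTerm]

theorem continuous_fundamentalCocycle :
    Continuous fun z : X × ℝ => fundamentalCocycle S M z.1 z.2 := by
  rw [continuous_iff_continuousAt]
  rintro ⟨x, s⟩
  have hU : {z : X × ℝ | |z.2| < |s| + 1} ∈ 𝓝 (x, s) :=
    (isOpen_lt (by fun_prop) continuous_const).mem_nhds (by simp)
  refine ContinuousOn.continuousAt (s := {z : X × ℝ | |z.2| < |s| + 1}) ?_ hU
  refine continuousOn_tsum
    (u := fun n => ‖(1 : R)‖ * (1 / 2) ^ n * Real.exp (2 * m * (|s| + 1)))
    (fun n => (continuous_picardTerm S hM n).continuousOn)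
    ((summable_geometric_two.mul_left _).mul_right _) (fun n z hz => ?_)
  refine (norm_picardTerm_le S hM hm hMm n z.1 z.2).trans ?_
  have : |z.2| ≤ |s| + 1 := le_of_lt hz
  gcongr

theorem hasDerivAt_fundamentalCocycle (x : X) (s : ℝ) :
    HasDerivAt (fundamentalCocycle S M x) (M (S s x) * fundamentalCocycle S M x s) s := by
  have hs := summable_picardTerm S hM hm hMm x
  have h1 : fundamentalCocycle S M x = fun t => 1 + ∑' n, picardTerm S M (n + 1) x t := by
    funext t
    rw [fundamentalCocycle, (hs t).tsum_eq_zero_add]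
    rfl
  have h2 : M (S s x) * fundamentalCocycle S M x s =
      ∑' n, M (S s x) * picardTerm S M n x s := by
    rw [fundamentalCocycle, (hs s).tsum_mul_left]
  rw [h2, h1]
  refine HasDerivAt.const_add (1 : R) ?_
  refine hasDerivAt_tsum_of_isPreconnected (t := Ioo (-(|s| + 1)) (|s| + 1)) (y₀ := s)
    (u := fun n => m * (‖(1 : R)‖ * (1 / 2) ^ n * Real.exp (2 * m * (|s| + 1))))
    (((summable_geometric_two.mul_left _).mul_right _).mul_left _) isOpen_Ioo isPreconnected_Ioo
    (fun n y _ => hasDerivAt_picardTerm_succ S hM n x y) (fun n y hy => ?_) ?_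
    ((summable_nat_add_iff 1).2 (hs s)) ?_
  · refine (norm_mul_le _ _).trans ?_
    refine mul_le_mul (hMm _) ((norm_picardTerm_le S hM hm hMm n x y).trans ?_) (norm_nonneg _)
      hm.le
    have : |y| ≤ |s| + 1 := (abs_lt.2 hy).le
    gcongr
  all_goals exact ⟨by linarith [neg_abs_le s], by linarith [le_abs_self s]⟩

theorem fundamentalCocycle_unique (x : X) {y : ℝ → R}
    (hy : ∀ s, HasDerivAt y (M (S s x) * y s) s) (s : ℝ) :
    y s = fundamentalCocycle S M x s * y 0 := by
  have h := linearODE_unique (L := fun s => ContinuousLinearMap.mul ℝ R (M (S s x))) (m := m)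
    (fun s => (ContinuousLinearMap.opNorm_mul_apply_le ℝ R _).trans (hMm _))
    (x := y) (y := fun s => fundamentalCocycle S M x s * y 0) hy
    (fun s => by
      have := (hasDerivAt_fundamentalCocycle S hM hm hMm x s).mul_const (y 0)
      simpa [mul_assoc] using this)
    (by simp [fundamentalCocycle_zero S hM hm hMm])
  exact congrFun h s

theorem fundamentalCocycle_add (x : X) (s t : ℝ) :
    fundamentalCocycle S M x (t + s) =
      fundamentalCocycle S M (S s x) t * fundamentalCocycle S M x s := by
  have h := fundamentalCocycle_unique S hM hm hMm (S s x)
    (y := fun t => fundamentalCocycle S M x (t + s)) (fun t => ?_) t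
  · simpa using h
  · have := (hasDerivAt_fundamentalCocycle S hM hm hMm x (t + s)).comp_add_const t s
    rwa [Flow.map_add] at this

end Cocycle

/-! ### Bounded solutions of inhomogeneous linear equations by half-line convolution -/

section HalfLineConvolution

variable {F : Type*} [NormedAddCommGroup F] [NormedSpace ℝ F]

/-- An exponentially decaying one-parameter family of operators `V` with `V' = L V`; the operator
`V 0` is allowed to be a projection. -/
structure IsDecayingGroup (V : ℝ → F →L[ℝ] F) (L : F →L[ℝ] F) (C γ : ℝ) : Prop where
  deriv : ∀ s, HasDerivAt V (L.comp (V s)) s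
  add : ∀ s t, V (s + t) = (V s).comp (V t)
  rate_pos : 0 < γ
  bound : ∀ u, 0 ≤ u → ‖V u‖ ≤ C * Real.exp (-γ * u)

namespace IsDecayingGroup

variable {V : ℝ → F →L[ℝ] F} {L : F →L[ℝ] F} {C γ : ℝ} (hV : IsDecayingGroup V L C γ)

include hV

theorem continuous : Continuous V :=
  continuous_iff_continuousAt.2 fun s => (hV.deriv s).continuousAt

theorem const_nonneg : 0 ≤ C := by
  simpa using (norm_nonneg _).trans (hV.bound 0 le_rfl)

theorem norm_apply_le {G : ℝ} {x : F} (hx : ‖x‖ ≤ G) {u : ℝ} (hu : 0 ≤ u) :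
    ‖V u x‖ ≤ C * G * Real.exp (-γ * u) := by
  refine ((V u).le_opNorm x).trans ?_
  have := mul_le_mul (hV.bound u hu) hx (norm_nonneg _)
    (mul_nonneg hV.const_nonneg (Real.exp_nonneg _))
  linarith

theorem integrableOn_bound (G : ℝ) :
    IntegrableOn (fun u => C * G * Real.exp (-γ * u)) (Ioi 0) :=
  (exp_neg_integrableOn_Ioi 0 hV.rate_pos).const_mul _

theorem integrableOn {g : ℝ → F} (hg : Continuous g) {G : ℝ} (hG : ∀ u, ‖g u‖ ≤ G) :
    IntegrableOn (fun u => V u (g u)) (Ioi 0) := by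
  refine Integrable.mono' (hV.integrableOn_bound G)
    (hV.continuous.clm_apply hg).aestronglyMeasurable ?_
  refine (ae_restrict_iff' measurableSet_Ioi).2 (Filter.Eventually.of_forall fun u hu => ?_)
  exact hV.norm_apply_le (hG u) (le_of_lt hu)

theorem norm_integral_le {g : ℝ → F} {G : ℝ} (hG : ∀ u, ‖g u‖ ≤ G) :
    ‖∫ u in Ioi (0 : ℝ), V u (g u)‖ ≤ C / γ * G := by
  have h := norm_integral_le_of_norm_le (hV.integrableOn_bound G)
    ((ae_restrict_iff' measurableSet_Ioi).2 (Filter.Eventually.of_forall fun u hu =>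
      hV.norm_apply_le (hG u) (le_of_lt hu)))
  refine h.trans (le_of_eq ?_)
  have hγ := hV.rate_pos
  rw [integral_const_mul, integral_exp_mul_Ioi (by linarith)]
  field_simp
  simp

/-- The substitution v = s - u and the group law turn the convolution into V(s) applied to ∫_{-∞}^s
V(-v) g(v) dv, where the product rule applies. The boundary term is V(0) g(s), not g(s), since V(0)
may be a proper projection. -/
theorem hasDerivAt_integral [CompleteSpace F] {g : ℝ → F} (hg : Continuous g) {G : ℝ}
    (hG : ∀ u, ‖g u‖ ≤ G) (s : ℝ) :
    HasDerivAt (fun s => ∫ u in Ioi (0 : ℝ), V u (g (s - u)))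
      (L (∫ u in Ioi (0 : ℝ), V u (g (s - u))) + V 0 (g s)) s := by
  set W : ℝ → F := fun v => V (-v) (g v) with hW
  have hWc : Continuous W := (hV.continuous.comp continuous_neg).clm_apply hg
  have hsub : ∀ (f : ℝ → F) (s : ℝ), ∫ u in Ioi (0 : ℝ), f u = ∫ v in Iic s, f (s - v) := by
    intro f s
    rw [integral_Iic_eq_integral_Iio, ← integral_indicator measurableSet_Ioi,
      ← integral_indicator measurableSet_Iio, ← integral_sub_left_eq_self _ volume s]
    congr 1
    funext v
    simp [indicator]
  have hVW : ∀ s v, V (s - v) (g v) = V s (W v) := by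
    intro s v
    rw [sub_eq_add_neg, hV.add]
    rfl
  have hVint : ∀ s, IntegrableOn (fun v => V (s - v) (g v)) (Iic s) := by
    intro s
    have h := (hV.integrableOn (g := fun u => g (s - u)) (by fun_prop) fun u => hG _)
    rw [integrableOn_Iic_iff_integrableOn_Iio]
    rw [← integrable_indicator_iff measurableSet_Ioi] at h
    rw [← integrable_indicator_iff measurableSet_Iio]
    refine (h.comp_sub_left s).congr (Filter.Eventually.of_forall fun v => ?_)
    simp [indicator]
  have hWint : ∀ s, IntegrableOn W (Iic s) := by
    intro s
    have h := (V (-s)).integrable_comp (hVint s)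
    refine h.congr (Filter.Eventually.of_forall fun v => ?_)
    simp only [hW]
    rw [show -v = -s + (s - v) by ring, hV.add]
    rfl
  have hJ : (fun s => ∫ u in Ioi (0 : ℝ), V u (g (s - u))) =
      fun s => V s ((∫ v in Iic (0 : ℝ), W v) + ∫ v in (0 : ℝ)..s, W v) := by
    funext s
    rw [← intervalIntegral.integral_Iic_sub_Iic (hWint 0) (hWint s), add_sub_cancel,
      ← (V s).integral_comp_comm (hWint s), hsub _ s]
    simp only [sub_sub_cancel, hVW]
  have hd : HasDerivAt (fun s => (∫ v in Iic (0 : ℝ), W v) + ∫ v in (0 : ℝ)..s, W v) (W s) s :=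
    (intervalIntegral.integral_hasDerivAt_right (hWc.intervalIntegrable _ _)
      hWc.stronglyMeasurable.stronglyMeasurableAtFilter hWc.continuousAt).const_add _
  have h := (hV.deriv s).clm_apply hd
  rw [hJ, congrFun hJ s]
  refine h.congr_deriv ?_
  rw [← hVW s s, sub_self]
  rfl

end IsDecayingGroup

variable {X : Type*} [TopologicalSpace X]

/-- The convolution `∫₀^∞ V(u) g(S_{-u} p) du` along the orbits of a flow. -/
def orbitConvolution (S : Flow ℝ X) (V : ℝ → F →L[ℝ] F) (g : X → F) (p : X) : F :=
  ∫ u in Ioi (0 : ℝ), V u (g (S (-u) p))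

namespace IsDecayingGroup

variable {V : ℝ → F →L[ℝ] F} {L : F →L[ℝ] F} {C γ : ℝ} (hV : IsDecayingGroup V L C γ)
  (S : Flow ℝ X) {g : X → F} {G : ℝ}

include hV

theorem norm_orbitConvolution_le (hG : ∀ p, ‖g p‖ ≤ G) (p : X) :
    ‖orbitConvolution S V g p‖ ≤ C / γ * G :=
  hV.norm_integral_le fun _ => hG _

theorem continuous_orbitConvolution [FirstCountableTopology X] (hg : Continuous g)
    (hG : ∀ p, ‖g p‖ ≤ G) : Continuous (orbitConvolution S V g) := by
  refine continuous_of_dominated (bound := fun u => C * G * Real.exp (-γ * u)) (fun p => ?_)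
    (fun p => ?_) (hV.integrableOn_bound G) (Filter.Eventually.of_forall fun u => ?_)
  · have : Continuous fun u => V u (g (S (-u) p)) :=
      hV.continuous.clm_apply (hg.comp (by fun_prop))
    exact this.aestronglyMeasurable
  · exact (ae_restrict_iff' measurableSet_Ioi).2 (Filter.Eventually.of_forall fun u hu =>
      hV.norm_apply_le (hG _) (le_of_lt hu))
  · exact (V u).continuous.comp (hg.comp (by fun_prop))

theorem orbitConvolution_sub (hg : Continuous g) (hG : ∀ p, ‖g p‖ ≤ G) {g' : X → F}
    (hg' : Continuous g') {G' : ℝ} (hG' : ∀ p, ‖g' p‖ ≤ G') (p : X) :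
    orbitConvolution S V (fun q => g q - g' q) p =
      orbitConvolution S V g p - orbitConvolution S V g' p := by
  simp only [orbitConvolution, map_sub]
  refine integral_sub (hV.integrableOn (g := fun u => g (S (-u) p)) (hg.comp (by fun_prop))
    fun u => hG _) (hV.integrableOn (g := fun u => g' (S (-u) p)) (hg'.comp (by fun_prop))
    fun u => hG' _)

theorem hasDerivAt_orbitConvolution [CompleteSpace F] (hg : Continuous g) (hG : ∀ p, ‖g p‖ ≤ G)
    (p : X) (s : ℝ) :
    HasDerivAt (fun s => orbitConvolution S V g (S s p))
      (L (orbitConvolution S V g (S s p)) + V 0 (g (S s p))) s := by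
  have h := hV.hasDerivAt_integral (g := fun u => g (S u p)) (hg.comp (by fun_prop))
    (fun u => hG _) s
  have e : ∀ s, (∫ u in Ioi (0 : ℝ), V u (g (S (s - u) p))) = orbitConvolution S V g (S s p) := by
    intro s
    simp only [orbitConvolution, ← Flow.map_add, sub_eq_neg_add]
  simpa only [e] using h

/-- Convolving along the reversed flow integrates over the future of the orbit; time reversal
changes the sign of the whole right-hand side. -/
theorem hasDerivAt_orbitConvolution_reverse [CompleteSpace F] (hg : Continuous g)
    (hG : ∀ p, ‖g p‖ ≤ G) (p : X) (s : ℝ) :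
    HasDerivAt (fun s => orbitConvolution S.reverse V g (S s p))
      (-(L (orbitConvolution S.reverse V g (S s p)) + V 0 (g (S s p)))) s := by
  have h := (hV.hasDerivAt_orbitConvolution S.reverse hg hG p (-s)).scomp s (hasDerivAt_neg s)
  simpa [Function.comp_def, add_comm] using h

end IsDecayingGroup

end HalfLineConvolution

/-! ### Growth of perturbed exponentials on an invariant subspace -/

section Gronwall

variable {R : Type*} [NormedRing R] [NormedAlgebra ℝ R] [CompleteSpace R]

/-- Variation of constants and Grönwall's inequality for `Y' = (A + D(s)) Y` on an invariant
subspace: `E` is the group generated by `A`, and `S₀` a projection with `S₀ Y = Y`. -/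
theorem norm_le_of_perturbed_exponential {A S₀ : R} {E : ℝ → R}
    (hE : ∀ s, HasDerivAt E (E s * A) s) (hE0 : E 0 = 1) {K c δ : ℝ}
    (hb : ∀ s, 0 ≤ s → ‖E s * S₀‖ ≤ K * Real.exp (c * s)) {D Y : ℝ → R}
    (hD : Continuous D) (hDδ : ∀ s, ‖D s‖ ≤ δ) (hDS : ∀ s, D s * S₀ = S₀ * D s)
    (hYS : ∀ s, S₀ * Y s = Y s) (hY : ∀ s, HasDerivAt Y ((A + D s) * Y s) s)
    {s : ℝ} (hs : 0 ≤ s) :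
    ‖Y s‖ ≤ K * ‖Y 0‖ * Real.exp ((c + K * δ) * s) := by
  have hK : 0 ≤ K := by simpa using (norm_nonneg _).trans (hb 0 le_rfl)
  have hδ : 0 ≤ δ := (norm_nonneg _).trans (hDδ 0)
  have hYc : Continuous Y := continuous_iff_continuousAt.2 fun s => (hY s).continuousAt
  have hEc : Continuous E := continuous_iff_continuousAt.2 fun s => (hE s).continuousAt
  -- The perturbation preserves the range of S₀, so only the growth of E on that range enters the
  -- variation-of-constants formula.
  have hDY : ∀ u, D u * Y u = S₀ * (D u * Y u) := by
    intro u
    rw [← mul_assoc, ← hDS, mul_assoc, hYS]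
  have hvar : ∀ s, Y s = E s * Y 0 + ∫ u in (0 : ℝ)..s, E (s - u) * (D u * Y u) := by
    intro s
    have hder : ∀ u, HasDerivAt (fun u => E (s - u) * Y u) (E (s - u) * (D u * Y u)) u := by
      intro u
      have h1 : HasDerivAt (fun u => E (s - u)) (-(E (s - u) * A)) u := by
        simpa [Function.comp_def] using
          (hE (s - u)).scomp u ((hasDerivAt_id u).const_sub s)
      refine (h1.mul (hY u)).congr_deriv ?_
      noncomm_ring
    have h := intervalIntegral.integral_eq_sub_of_hasDerivAt (a := 0) (b := s)
      (fun u _ => hder u) (Continuous.intervalIntegrable (by fun_prop) _ _)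
    rw [h]
    simp [hE0]
  set y : ℝ → ℝ := fun u => Real.exp (-c * u) * ‖Y u‖ with hy
  have hyc : Continuous y := by fun_prop
  -- Z dominates y and satisfies Z' = K δ y ≤ K δ Z, which is the differential form of Grönwall's
  -- inequality.
  set Z : ℝ → ℝ := fun s => K * ‖Y 0‖ + K * δ * ∫ u in (0 : ℝ)..s, y u with hZ
  have hyZ : ∀ s, 0 ≤ s → y s ≤ Z s := by
    intro s hs
    have h1 : ‖∫ u in (0 : ℝ)..s, E (s - u) * (D u * Y u)‖ ≤
        ∫ u in (0 : ℝ)..s, K * δ * Real.exp (c * s) * y u := by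
      refine intervalIntegral.norm_integral_le_of_norm_le hs
        (Filter.Eventually.of_forall fun u hu => ?_)
        (Continuous.intervalIntegrable (by fun_prop) _ _)
      rw [hDY, ← mul_assoc]
      refine (norm_mul_le _ _).trans ?_
      have h2 := hb (s - u) (by linarith [hu.2])
      have h3 : ‖D u * Y u‖ ≤ δ * ‖Y u‖ :=
        (norm_mul_le _ _).trans (mul_le_mul_of_nonneg_right (hDδ u) (norm_nonneg _))
      refine (mul_le_mul h2 h3 (norm_nonneg _) (by positivity)).trans (le_of_eq ?_)
      rw [hy]
      have : Real.exp (c * (s - u)) = Real.exp (c * s) * Real.exp (-c * u) := by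
        rw [← Real.exp_add]
        ring_nf
      simp only [this]
      ring
    rw [intervalIntegral.integral_const_mul] at h1
    have h4 : ‖E s * Y 0‖ ≤ K * Real.exp (c * s) * ‖Y 0‖ := by
      rw [← hYS 0, ← mul_assoc]
      refine (norm_mul_le _ _).trans ?_
      rw [hYS 0]
      exact mul_le_mul_of_nonneg_right (hb s hs) (norm_nonneg _)
    have h5 : ‖Y s‖ ≤ Real.exp (c * s) * Z s := by
      rw [hvar s]
      refine (norm_add_le _ _).trans ((add_le_add h4 h1).trans (le_of_eq ?_))
      rw [hZ]
      ring
    have h6 : y s ≤ Real.exp (-c * s) * (Real.exp (c * s) * Z s) :=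
      mul_le_mul_of_nonneg_left h5 (Real.exp_nonneg _)
    rwa [← mul_assoc, ← Real.exp_add, show -c * s + c * s = 0 by ring, Real.exp_zero,
      one_mul] at h6
  have hZd : ∀ s, HasDerivAt Z (K * δ * y s) s := fun s =>
    ((intervalIntegral.integral_hasDerivAt_right (hyc.intervalIntegrable _ _)
      hyc.stronglyMeasurable.stronglyMeasurableAtFilter hyc.continuousAt).const_mul
        (K * δ)).const_add _
  have hgr := norm_le_gronwallBound_of_norm_deriv_right_le (f := Z) (f' := fun s => K * δ * y s)
    (δ := K * ‖Y 0‖) (K := K * δ) (ε := 0) (a := 0) (b := s)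
    (fun u _ => (hZd u).continuousAt.continuousWithinAt) (fun u _ => (hZd u).hasDerivWithinAt)
    (by simp only [hZ, intervalIntegral.integral_same, mul_zero, add_zero]
        rw [Real.norm_of_nonneg (by positivity)])
    (fun u hu => by
      have h0 : 0 ≤ y u := by positivity
      rw [Real.norm_of_nonneg (by positivity), add_zero]
      exact mul_le_mul_of_nonneg_left ((hyZ u hu.1).trans (Real.le_norm_self _)) (by positivity))
    s ⟨hs, le_rfl⟩
  rw [gronwallBound_ε0, sub_zero] at hgr
  have h7 : y s ≤ K * ‖Y 0‖ * Real.exp (K * δ * s) :=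
    (hyZ s hs).trans ((Real.le_norm_self _).trans hgr)
  have h8 := mul_le_mul_of_nonneg_left h7 (Real.exp_nonneg (c * s))
  rw [hy, ← mul_assoc, ← Real.exp_add, show c * s + -c * s = 0 by ring, Real.exp_zero,
    one_mul] at h8
  refine h8.trans (le_of_eq ?_)
  rw [add_mul, Real.exp_add]
  ring

end Gronwall

/-! ### Exponential splittings and the commutator on off-diagonal blocks -/

section Splitting

open ContinuousLinearMap in
theorem hasDerivAt_mulLeftRight {R : Type*} [NormedRing R] [NormedAlgebra ℝ R] {x y : ℝ → R}
    {x' y' : R} {s : ℝ} (hx : HasDerivAt x x' s) (hy : HasDerivAt y y' s) :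
    HasDerivAt (fun u => mulLeftRight ℝ R (x u) (y u))
      (mulLeftRight ℝ R x' (y s) + mulLeftRight ℝ R (x s) y') s :=
  ((mulLeftRight ℝ R).hasDerivAt_of_bilinear (fun _ => hx) fun _ => hy).congr_deriv (add_comm _ _)

/-- The commutator with `A`. -/
def commutatorCLM {R : Type*} [NormedRing R] [NormedAlgebra ℝ R] (A : R) : R →L[ℝ] R :=
  ContinuousLinearMap.mul ℝ R A - (ContinuousLinearMap.mul ℝ R).flip A

@[simp]
theorem commutatorCLM_apply {R : Type*} [NormedRing R] [NormedAlgebra ℝ R] (A x : R) :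
    commutatorCLM A x = A * x - x * A := rfl

variable {R : Type*} [NormedRing R] [NormedAlgebra ℝ R]

/-- `E` is the group generated by `A`; it commutes with the projection `S₀`, grows at rate at most
`a` on the range of `S₀` and decays at rate `b` on its kernel. -/
structure IsExponentialSplitting (A S₀ : R) (E : ℝ → R) (K a b : ℝ) : Prop where
  deriv : ∀ s, HasDerivAt E (A * E s) s
  comm : ∀ s, E s * A = A * E s
  comm_gen : S₀ * A = A * S₀
  zero : E 0 = 1
  add : ∀ s t, E (s + t) = E s * E t
  idem : S₀ * S₀ = S₀
  comm_proj : ∀ s, S₀ * E s = E s * S₀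
  rate_lt : a < b
  bound_center : ∀ s, ‖E s * S₀‖ ≤ K * Real.exp (a * |s|)
  bound_stable : ∀ s, 0 ≤ s → ‖E s * (1 - S₀)‖ ≤ K * Real.exp (-b * s)

namespace IsExponentialSplitting

variable {A S₀ : R} {E : ℝ → R} {K a b : ℝ} (hE : IsExponentialSplitting A S₀ E K a b)

include hE

theorem const_nonneg : 0 ≤ K := by
  simpa using (norm_nonneg _).trans (hE.bound_center 0)

theorem norm_proj_le : ‖S₀‖ ≤ K := by
  simpa [hE.zero] using hE.bound_center 0

theorem norm_compl_le : ‖1 - S₀‖ ≤ K := by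
  simpa [hE.zero] using hE.bound_stable 0 le_rfl

theorem compl_idem : (1 - S₀) * (1 - S₀) = 1 - S₀ := by
  simp [sub_mul, mul_sub, hE.idem]

theorem proj_compl : S₀ * (1 - S₀) = 0 := by
  simp [mul_sub, hE.idem]

theorem compl_proj : (1 - S₀) * S₀ = 0 := by
  simp [sub_mul, hE.idem]

theorem comm_compl (s : ℝ) : (1 - S₀) * E s = E s * (1 - S₀) := by
  simp [sub_mul, mul_sub, hE.comm_proj]

theorem deriv_neg (s : ℝ) : HasDerivAt (fun s => E (-s)) (-(E (-s) * A)) s := by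
  have := (hE.deriv (-s)).scomp s (hasDerivAt_neg s)
  rw [hE.comm]
  simpa [Function.comp_def] using this

/-- Conjugation by E on the block from center to stable: the left factor decays like e^{-bu} while
the right factor grows at most like e^{au}, so the product decays at rate b - a. -/
theorem isDecayingGroup_left :
    IsDecayingGroup
      (fun u => ContinuousLinearMap.mulLeftRight ℝ R (E u * (1 - S₀)) (S₀ * E (-u)))
      (commutatorCLM A) (K * K) (b - a) where
  deriv s := by
    have h1 : HasDerivAt (fun u => E u * (1 - S₀)) (A * E s * (1 - S₀)) s :=
      (hE.deriv s).mul_const _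
    have h2 : HasDerivAt (fun u => S₀ * E (-u)) (S₀ * -(E (-s) * A)) s :=
      (hE.deriv_neg s).const_mul _
    refine (hasDerivAt_mulLeftRight h1 h2).congr_deriv (ContinuousLinearMap.ext fun x => ?_)
    simp only [add_apply, ContinuousLinearMap.comp_apply,
      ContinuousLinearMap.mulLeftRight_apply, commutatorCLM_apply]
    noncomm_ring
  add s t := by
    ext x
    simp only [ContinuousLinearMap.mulLeftRight_apply, ContinuousLinearMap.comp_apply]
    rw [neg_add_rev, hE.add, hE.add]
    have h1 : E s * E t * (1 - S₀) = E s * (1 - S₀) * (E t * (1 - S₀)) := by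
      rw [mul_assoc (E s) (1 - S₀), ← mul_assoc (1 - S₀), hE.comm_compl, mul_assoc (E t),
        hE.compl_idem, mul_assoc]
    have h2 : S₀ * (E (-t) * E (-s)) = S₀ * E (-t) * (S₀ * E (-s)) := by
      rw [mul_assoc, ← mul_assoc (E (-t)), ← hE.comm_proj, ← mul_assoc S₀, ← mul_assoc S₀,
        ← mul_assoc S₀, hE.idem, mul_assoc]
    rw [h1, h2]
    noncomm_ring
  rate_pos := sub_pos.2 hE.rate_lt
  bound u hu := by
    refine (ContinuousLinearMap.opNorm_mulLeftRight_apply_apply_le ℝ R _ _).trans ?_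
    have h1 := hE.bound_stable u hu
    have h2 := hE.bound_center (-u)
    rw [abs_neg, abs_of_nonneg hu, ← hE.comm_proj] at h2
    refine (mul_le_mul h1 h2 (norm_nonneg _) ((norm_nonneg _).trans h1)).trans (le_of_eq ?_)
    rw [show -(b - a) * u = -b * u + a * u by ring, Real.exp_add]
    ring

/-- On the block from stable to center the same decay occurs in backward time, hence the generator
is minus the commutator. -/
theorem isDecayingGroup_right :
    IsDecayingGroup
      (fun u => ContinuousLinearMap.mulLeftRight ℝ R (S₀ * E (-u)) (E u * (1 - S₀)))
      (-(commutatorCLM A))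
      (K * K) (b - a) where
  deriv s := by
    have h1 : HasDerivAt (fun u => E u * (1 - S₀)) (A * E s * (1 - S₀)) s :=
      (hE.deriv s).mul_const _
    have h2 : HasDerivAt (fun u => S₀ * E (-u)) (S₀ * -(E (-s) * A)) s :=
      (hE.deriv_neg s).const_mul _
    have h3 : S₀ * (E (-s) * A) = A * (S₀ * E (-s)) := by
      rw [hE.comm, ← mul_assoc, ← mul_assoc, hE.comm_gen]
    have h4 : A * E s * (1 - S₀) = E s * (1 - S₀) * A := by
      rw [← hE.comm, mul_assoc, mul_assoc]
      simp [mul_sub, sub_mul, hE.comm_gen]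
    rw [h4] at h1
    rw [mul_neg, h3] at h2
    refine (hasDerivAt_mulLeftRight h2 h1).congr_deriv (ContinuousLinearMap.ext fun x => ?_)
    simp only [add_apply, ContinuousLinearMap.comp_apply,
      ContinuousLinearMap.mulLeftRight_apply, commutatorCLM_apply, neg_apply]
    noncomm_ring
  add s t := by
    ext x
    simp only [ContinuousLinearMap.mulLeftRight_apply, ContinuousLinearMap.comp_apply]
    rw [neg_add_rev, add_comm s t, hE.add, hE.add]
    have h1 : E t * E s * (1 - S₀) = E t * (1 - S₀) * (E s * (1 - S₀)) := by
      rw [mul_assoc (E t) (1 - S₀), ← mul_assoc (1 - S₀), hE.comm_compl, mul_assoc (E s),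
        hE.compl_idem, mul_assoc]
    have h2 : S₀ * (E (-t) * E (-s)) = S₀ * E (-s) * (S₀ * E (-t)) := by
      rw [← hE.add, add_comm, hE.add, mul_assoc, ← mul_assoc (E (-s)), ← hE.comm_proj,
        ← mul_assoc S₀, ← mul_assoc S₀, ← mul_assoc S₀, hE.idem, mul_assoc]
    rw [h1, h2]
    noncomm_ring
  rate_pos := sub_pos.2 hE.rate_lt
  bound u hu := by
    refine (ContinuousLinearMap.opNorm_mulLeftRight_apply_apply_le ℝ R _ _).trans ?_
    have h1 := hE.bound_stable u hu
    have h2 := hE.bound_center (-u)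
    rw [abs_neg, abs_of_nonneg hu, ← hE.comm_proj] at h2
    refine (mul_le_mul h2 h1 (norm_nonneg _) ((norm_nonneg _).trans h2)).trans (le_of_eq ?_)
    rw [show -(b - a) * u = -b * u + a * u by ring, Real.exp_add]
    ring

end IsExponentialSplitting

end Splitting

/-! ### Decoupling a small perturbation into its center and stable blocks -/

section Decoupling

/-- Used with compressions to the diagonal blocks, to see that the fixed point H is off-diagonal. -/
theorem IsDecayingGroup.map_orbitConvolution_eq_zero {F : Type*} [NormedAddCommGroup F]
    [NormedSpace ℝ F] [CompleteSpace F] {V : ℝ → F →L[ℝ] F} {L : F →L[ℝ] F} {C γ : ℝ}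
    (hV : IsDecayingGroup V L C γ) {X : Type*} [TopologicalSpace X] (S : Flow ℝ X) {g : X → F}
    {G : ℝ} (hg : Continuous g) (hG : ∀ p, ‖g p‖ ≤ G) {T : F →L[ℝ] F}
    (hT : ∀ u x, T (V u x) = 0) (p : X) : T (orbitConvolution S V g p) = 0 := by
  rw [orbitConvolution, ← T.integral_comp_comm (hV.integrableOn (g := fun u => g (S (-u) p))
    (hg.comp (by fun_prop)) fun u => hG _)]
  simp [hT]

variable {R : Type*} [NormedRing R] [NormedAlgebra ℝ R] [CompleteSpace R]

/-- The block-diagonal part of `x` with respect to the projection `S₀`. -/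
def diagPart (S₀ x : R) : R := S₀ * x * S₀ + (1 - S₀) * x * (1 - S₀)

omit [NormedAlgebra ℝ R] [CompleteSpace R] in
theorem norm_diagPart_le {S₀ : R} {K : ℝ} (h1 : ‖S₀‖ ≤ K) (h2 : ‖1 - S₀‖ ≤ K) (x : R) :
    ‖diagPart S₀ x‖ ≤ 2 * (K * K) * ‖x‖ := by
  have hK : 0 ≤ K := (norm_nonneg _).trans h1
  have key : ∀ q : R, ‖q‖ ≤ K → ‖q * x * q‖ ≤ K * K * ‖x‖ := by
    intro q hq
    calc ‖q * x * q‖ ≤ ‖q‖ * ‖x‖ * ‖q‖ :=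
          (norm_mul_le _ _).trans (mul_le_mul_of_nonneg_right (norm_mul_le _ _) (norm_nonneg _))
      _ ≤ K * ‖x‖ * K := by gcongr
      _ = _ := by ring
  have := (norm_add_le _ _).trans (add_le_add (key _ h1) (key _ h2))
  rw [diagPart]
  linarith

omit [NormedAlgebra ℝ R] [CompleteSpace R] in
theorem diagPart_comm {S₀ : R} (h : S₀ * S₀ = S₀) (x : R) :
    diagPart S₀ x * S₀ = S₀ * diagPart S₀ x := by
  have h1 : (1 - S₀) * S₀ = 0 := by rw [sub_mul, h, one_mul, sub_self]
  have h2 : S₀ * (1 - S₀) = 0 := by rw [mul_sub, h, mul_one, sub_self]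
  rw [diagPart]
  generalize 1 - S₀ = Q at *
  calc _ = S₀ * x * (S₀ * S₀) + Q * x * (Q * S₀) := by noncomm_ring
    _ = S₀ * S₀ * x * S₀ + S₀ * Q * x * Q := by simp [h, h1, h2]
    _ = _ := by noncomm_ring

omit [NormedAlgebra ℝ R] [CompleteSpace R] in
theorem diagPart_sub (S₀ x y : R) : diagPart S₀ (x - y) = diagPart S₀ x - diagPart S₀ y := by
  simp only [diagPart]
  noncomm_ring

omit [NormedAlgebra ℝ R] [CompleteSpace R] in
-- If H is off-diagonal, then so is H times a diagonal matrix. Removing the diagonal blocks of Y - H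
-- diag(Y) therefore only removes diag(Y). This identifies the forcing seen by the two convolutions
-- with the one in the conjugacy equation.
theorem offDiag_identity {S₀ H Y : R} (h : S₀ * S₀ = S₀) (h1 : S₀ * H * S₀ = 0)
    (h2 : (1 - S₀) * H * (1 - S₀) = 0) :
    (1 - S₀) * (Y - H * diagPart S₀ Y) * S₀ + S₀ * (Y - H * diagPart S₀ Y) * (1 - S₀) =
      Y - diagPart S₀ Y - H * diagPart S₀ Y := by
  have hc := diagPart_comm h Y
  have hHS : S₀ * H + H * S₀ = H := by
    have e : (1 - S₀) * H * (1 - S₀) = H - S₀ * H - H * S₀ + S₀ * H * S₀ := by noncomm_ring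
    rw [h2, h1, add_zero] at e
    rw [eq_comm, ← sub_eq_zero, e]
    abel
  have hY : (1 - S₀) * Y * S₀ + S₀ * Y * (1 - S₀) = Y - diagPart S₀ Y := by
    rw [diagPart]
    noncomm_ring
  set D := diagPart S₀ Y
  have hHD : (1 - S₀) * (H * D) * S₀ + S₀ * (H * D) * (1 - S₀) = H * D := by
    have e1 : (1 - S₀) * (H * D) * S₀ = H * S₀ * D := by
      rw [mul_assoc, mul_assoc H, hc, ← mul_assoc H, ← mul_assoc, sub_mul, one_mul, ← mul_assoc, h1,
        sub_zero]
    have e2 : S₀ * (H * D) * (1 - S₀) = S₀ * H * D := by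
      calc _ = S₀ * H * D - S₀ * H * (D * S₀) := by noncomm_ring
        _ = S₀ * H * D - S₀ * H * S₀ * D := by rw [hc, mul_assoc (S₀ * H)]
        _ = _ := by rw [h1, zero_mul, sub_zero]
    rw [e1, e2, ← add_mul, add_comm, hHS]
  calc _ = ((1 - S₀) * Y * S₀ + S₀ * Y * (1 - S₀)) -
        ((1 - S₀) * (H * D) * S₀ + S₀ * (H * D) * (1 - S₀)) := by noncomm_ring
    _ = _ := by rw [hY, hHD]

/-- With Y = B + B H the conjugacy equation reads H' = [A, H] + Y - D - H D. For off-diagonal H the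
diagonal blocks force D = `diagPart S₀ Y`, and what remains is a quadratic equation for H whose
linear part is hyperbolic on off-diagonal matrices. Its bounded solution is found by the contraction
principle in the ball of radius 1/2 of C(X, R). -/
theorem IsExponentialSplitting.exists_decoupling {A S₀ : R} {E : ℝ → R} {K a b : ℝ}
    (hE : IsExponentialSplitting A S₀ E K a b) {δ : ℝ} (hδ : 0 < δ) :
    ∃ η > 0, ∀ {X : Type u} [MetricSpace X] [CompactSpace X] (S : Flow ℝ X) (B : X → R),
      Continuous B → (∀ p, ‖B p‖ ≤ η) →
      ∃ H D : X → R, Continuous H ∧ Continuous D ∧ (∀ p, ‖H p‖ ≤ 1 / 2) ∧ (∀ p, ‖D p‖ ≤ δ) ∧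
        (∀ p, D p * S₀ = S₀ * D p) ∧
        ∀ p s, HasDerivAt (fun s => H (S s p))
          ((A + B (S s p)) * (1 + H (S s p)) - (1 + H (S s p)) * (A + D (S s p))) s := by
  set c := 2 * (K * K) with hc
  set C₁ := K * K / (b - a) with hC₁
  have hba : 0 < b - a := sub_pos.2 hE.rate_lt
  have hK := hE.const_nonneg
  have hc0 : 0 ≤ c := by positivity
  have hC0 : 0 ≤ C₁ := by positivity
  -- The first bound makes D at most δ. The second gives 2 C₁ η (1 + 2c) ≤ 1/4: the integral
  -- operator has norm at most 2 C₁ and the nonlinearity is bounded by 2 η (1 + 2c) with Lipschitz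
  -- constant η (1 + 2c), so the ball of radius 1/2 is preserved and the map contracts.
  refine ⟨min (δ / (2 * (1 + 2 * c))) (1 / (8 * (C₁ + 1) * (1 + 2 * c))), by positivity, ?_⟩
  intro X _ _ S B hB hBη
  set η := min (δ / (2 * (1 + 2 * c))) (1 / (8 * (C₁ + 1) * (1 + 2 * c))) with hη
  have hη0 : 0 < η := by positivity
  have hη1 : η * (2 * (1 + 2 * c)) ≤ δ := by
    rw [← le_div_iff₀ (by positivity)]
    exact min_le_left _ _
  have hη2 : 2 * C₁ * (η * (1 + 2 * c)) ≤ 1 / 4 := by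
    have h : η * (8 * (C₁ + 1) * (1 + 2 * c)) ≤ 1 := by
      rw [← le_div_iff₀ (by positivity)]
      exact min_le_right _ _
    nlinarith [mul_pos hη0 (show 0 < 1 + 2 * c by positivity)]
  have hdiag : ∀ x, ‖diagPart S₀ x‖ ≤ c * ‖x‖ :=
    norm_diagPart_le hE.norm_proj_le hE.norm_compl_le
  have hdc : Continuous (diagPart S₀) := by
    unfold diagPart
    fun_prop
  -- the nonlinearity
  set N : R → R → R := fun B H => (B + B * H) - H * diagPart S₀ (B + B * H) with hN
  have hNY : ∀ B H : R, ‖B‖ ≤ η → ‖H‖ ≤ 1 / 2 → ‖B + B * H‖ ≤ 3 / 2 * η := by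
    intro B H hB hH
    have h1 : ‖B * H‖ ≤ η * (1 / 2) :=
      (norm_mul_le _ _).trans (mul_le_mul hB hH (norm_nonneg _) hη0.le)
    linarith [norm_add_le B (B * H)]
  have hN1 : ∀ B H : R, ‖B‖ ≤ η → ‖H‖ ≤ 1 / 2 → ‖N B H‖ ≤ 2 * (η * (1 + 2 * c)) := by
    intro B H hB hH
    have h1 := hNY B H hB hH
    have h2 : ‖H * diagPart S₀ (B + B * H)‖ ≤ 1 / 2 * (c * (3 / 2 * η)) :=
      (norm_mul_le _ _).trans (mul_le_mul hH ((hdiag _).trans (by gcongr)) (norm_nonneg _)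
        (by norm_num))
    have h3 := norm_sub_le (B + B * H) (H * diagPart S₀ (B + B * H))
    simp only [hN]
    nlinarith
  have hN2 : ∀ B H H' : R, ‖B‖ ≤ η → ‖H‖ ≤ 1 / 2 → ‖H'‖ ≤ 1 / 2 →
      ‖N B H - N B H'‖ ≤ η * (1 + 2 * c) * ‖H - H'‖ := by
    intro B H H' hB hH hH'
    have e : N B H - N B H' = B * (H - H') - (H - H') * diagPart S₀ (B + B * H) -
        H' * diagPart S₀ (B * (H - H')) := by
      have : B * (H - H') = (B + B * H) - (B + B * H') := by noncomm_ring
      rw [this, diagPart_sub]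
      simp only [hN]
      noncomm_ring
    have h0 := norm_nonneg (H - H')
    have h1 : ‖B * (H - H')‖ ≤ η * ‖H - H'‖ :=
      (norm_mul_le _ _).trans (mul_le_mul_of_nonneg_right hB h0)
    have h2 : ‖(H - H') * diagPart S₀ (B + B * H)‖ ≤ ‖H - H'‖ * (c * (3 / 2 * η)) :=
      (norm_mul_le _ _).trans (mul_le_mul_of_nonneg_left
        ((hdiag _).trans (mul_le_mul_of_nonneg_left (hNY B H hB hH) hc0)) h0)
    have h3 : ‖H' * diagPart S₀ (B * (H - H'))‖ ≤ 1 / 2 * (c * (η * ‖H - H'‖)) :=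
      (norm_mul_le _ _).trans (mul_le_mul hH' ((hdiag _).trans
        (mul_le_mul_of_nonneg_left h1 hc0)) (norm_nonneg _) (by norm_num))
    rw [e]
    refine ((norm_sub_le _ _).trans (add_le_add (norm_sub_le _ _) le_rfl)).trans ?_
    nlinarith
  have hNc : ∀ H : X → R, Continuous H → Continuous fun p => N (B p) (H p) := by
    intro H hH
    simp only [hN]
    fun_prop
  -- the integral operator
  set V₁ := fun u => ContinuousLinearMap.mulLeftRight ℝ R (E u * (1 - S₀)) (S₀ * E (-u)) with hV₁
  set V₂ := fun u => ContinuousLinearMap.mulLeftRight ℝ R (S₀ * E (-u)) (E u * (1 - S₀)) with hV₂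
  have h₁ : IsDecayingGroup V₁ _ _ _ := hE.isDecayingGroup_left
  have h₂ : IsDecayingGroup V₂ _ _ _ := hE.isDecayingGroup_right
  -- The Green operator of H' = [A, H] + g on off-diagonal matrices: the block that decays forward
  -- integrates over the past, the other one over the future with a minus sign.
  set J : (X → R) → X → R := fun g p =>
    orbitConvolution S V₁ g p - orbitConvolution S.reverse V₂ g p with hJ
  have hJc : ∀ g : X → R, ∀ G, Continuous g → (∀ p, ‖g p‖ ≤ G) → Continuous (J g) :=
    fun g G hg hG => (h₁.continuous_orbitConvolution S hg hG).sub
      (h₂.continuous_orbitConvolution S.reverse hg hG)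
  have hJb : ∀ g : X → R, ∀ G, (∀ p, ‖g p‖ ≤ G) → ∀ p, ‖J g p‖ ≤ 2 * C₁ * G := by
    intro g G hG p
    have := norm_sub_le (orbitConvolution S V₁ g p) (orbitConvolution S.reverse V₂ g p)
    have e1 := h₁.norm_orbitConvolution_le S hG p
    have e2 := h₂.norm_orbitConvolution_le S.reverse hG p
    simp only [hJ]
    linarith
  have hJs : ∀ (g g' : X → R) (G G' : ℝ), Continuous g → Continuous g' → (∀ p, ‖g p‖ ≤ G) →
      (∀ p, ‖g' p‖ ≤ G') → ∀ p, J g p - J g' p = J (fun q => g q - g' q) p := by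
    intro g g' G G' hg hg' hG hG' p
    simp only [hJ]
    rw [h₁.orbitConvolution_sub S hg hG hg' hG', h₂.orbitConvolution_sub S.reverse hg hG hg' hG']
    abel
  -- the fixed point
  let α := Metric.closedBall (0 : C(X, R)) (1 / 2)
  have hα : ∀ H : α, ∀ p, ‖H.1 p‖ ≤ 1 / 2 := by
    intro H p
    have := H.2
    rw [mem_closedBall_zero_iff] at this
    exact (H.1.norm_coe_le_norm p).trans this
  have hNb : ∀ H : α, ∀ p, ‖N (B p) (H.1 p)‖ ≤ 2 * (η * (1 + 2 * c)) :=
    fun H p => hN1 _ _ (hBη p) (hα H p)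
  let T : α → α := fun H =>
    ⟨⟨J fun p => N (B p) (H.1 p), hJc _ _ (hNc _ H.1.continuous) (hNb H)⟩, by
      rw [mem_closedBall_zero_iff, ContinuousMap.norm_le _ (by norm_num)]
      intro p
      refine (hJb _ _ (hNb H) p).trans ?_
      linarith⟩
  have : Nonempty α := ⟨⟨0, Metric.mem_closedBall_self (by norm_num)⟩⟩
  have : CompleteSpace α := Metric.isClosed_closedBall.completeSpace_coe
  have hT : ContractingWith (1 / 2) T := by
    refine ⟨by rw [div_lt_one] <;> norm_num, LipschitzWith.of_dist_le_mul fun H H' => ?_⟩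
    rw [Subtype.dist_eq, ContinuousMap.dist_le (by positivity)]
    intro p
    rw [dist_eq_norm]
    change ‖J _ p - J _ p‖ ≤ _
    rw [hJs _ _ _ _ (hNc _ H.1.continuous) (hNc _ H'.1.continuous) (hNb H) (hNb H')]
    refine (hJb _ (η * (1 + 2 * c) * dist H H') (fun q => ?_) p).trans ?_
    · refine (hN2 _ _ _ (hBη q) (hα H q) (hα H' q)).trans ?_
      refine mul_le_mul_of_nonneg_left ?_ (by positivity)
      rw [← dist_eq_norm]
      exact ContinuousMap.dist_apply_le_dist q
    · have := mul_le_mul_of_nonneg_right hη2 (dist_nonneg (x := H) (y := H'))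
      have h0 := dist_nonneg (x := H) (y := H')
      push_cast
      linarith
  set H := ContractingWith.fixedPoint T hT with hH
  have hfix : ∀ p, H.1 p = J (fun p => N (B p) (H.1 p)) p := by
    intro p
    exact (congrArg (fun H : α => H.1 p) hT.fixedPoint_isFixedPt.eq).symm
  set g : X → R := fun p => N (B p) (H.1 p) with hg
  have hgc : Continuous g := hNc _ H.1.continuous
  have hgb := hNb H
  have hS := hE.idem
  have hSQ := hE.proj_compl
  have hQS := hE.compl_proj
  have hoff1 : ∀ p, S₀ * H.1 p * S₀ = 0 := by
    intro p
    have e1 := h₁.map_orbitConvolution_eq_zero S hgc hgb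
      (T := ContinuousLinearMap.mulLeftRight ℝ R S₀ S₀) (fun u x => by
        simp only [hV₁, ContinuousLinearMap.mulLeftRight_apply, ← hE.comm_compl, ← mul_assoc]
        simp [hSQ]) p
    have e2 := h₂.map_orbitConvolution_eq_zero S.reverse hgc hgb
      (T := ContinuousLinearMap.mulLeftRight ℝ R S₀ S₀) (fun u x => by
        simp only [hV₂, ContinuousLinearMap.mulLeftRight_apply, mul_assoc]
        simp [hQS]) p
    rw [ContinuousLinearMap.mulLeftRight_apply] at e1 e2
    have hp : H.1 p = orbitConvolution S V₁ g p - orbitConvolution S.reverse V₂ g p := hfix p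
    generalize 1 - S₀ = Q at *
    rw [hp, mul_sub, sub_mul, e1, e2, sub_zero]
  have hoff2 : ∀ p, (1 - S₀) * H.1 p * (1 - S₀) = 0 := by
    intro p
    have e1 := h₁.map_orbitConvolution_eq_zero S hgc hgb
      (T := ContinuousLinearMap.mulLeftRight ℝ R (1 - S₀) (1 - S₀)) (fun u x => by
        simp only [hV₁, ContinuousLinearMap.mulLeftRight_apply, hE.comm_proj]
        simp only [mul_assoc, hSQ, mul_zero]) p
    have e2 := h₂.map_orbitConvolution_eq_zero S.reverse hgc hgb
      (T := ContinuousLinearMap.mulLeftRight ℝ R (1 - S₀) (1 - S₀)) (fun u x => by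
        simp only [hV₂, ContinuousLinearMap.mulLeftRight_apply, ← mul_assoc, hQS, zero_mul]) p
    rw [ContinuousLinearMap.mulLeftRight_apply] at e1 e2
    have hp : H.1 p = orbitConvolution S V₁ g p - orbitConvolution S.reverse V₂ g p := hfix p
    generalize 1 - S₀ = Q at *
    rw [hp, mul_sub, sub_mul, e1, e2, sub_zero]
  refine ⟨H.1, fun p => diagPart S₀ (B p + B p * H.1 p), H.1.continuous, ?_, hα H, fun p => ?_,
    fun p => diagPart_comm hS _, fun p s => ?_⟩
  · have := H.1.continuous
    fun_prop
  · have h4 := (hdiag (B p + B p * H.1 p)).trans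
      (mul_le_mul_of_nonneg_left (hNY _ _ (hBη p) (hα H p)) hc0)
    nlinarith
  · have d1 := h₁.hasDerivAt_orbitConvolution S hgc hgb p s
    have d2 := h₂.hasDerivAt_orbitConvolution_reverse S hgc hgb p s
    have d := d1.sub d2
    have e : (fun s => H.1 (S s p)) = fun s => orbitConvolution S V₁ g (S s p) -
        orbitConvolution S.reverse V₂ g (S s p) := funext fun s => hfix _
    rw [e]
    refine d.congr_deriv ?_
    set x := S s p
    have hx : H.1 x = orbitConvolution S V₁ g x - orbitConvolution S.reverse V₂ g x := hfix x
    -- The operators V₁(0) and V₂(0) are the projections onto the two off-diagonal blocks, so only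
    -- this part of g appears in the derivative of H.
    have hgx : (1 - S₀) * g x * S₀ + S₀ * g x * (1 - S₀) =
      (B x + B x * H.1 x) - diagPart S₀ (B x + B x * H.1 x) -
        H.1 x * diagPart S₀ (B x + B x * H.1 x) := offDiag_identity hS (hoff1 x) (hoff2 x)
    simp only [hV₁, hV₂, ContinuousLinearMap.mulLeftRight_apply, neg_zero, hE.zero, one_mul,
      mul_one, neg_apply, commutatorCLM_apply]
    generalize orbitConvolution S V₁ g x = j₁ at *
    generalize orbitConvolution S.reverse V₂ g x = j₂ at *
    calc _ = A * (j₁ - j₂) - (j₁ - j₂) * A + ((1 - S₀) * g x * S₀ + S₀ * g x * (1 - S₀)) := by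
          noncomm_ring
      _ = _ := by
          rw [hgx, ← hx]
          noncomm_ring

end Decoupling

/-! ### Near-identity averaging and block-diagonalization with uniform constants -/

section NearIdentity

variable {R : Type*} [NormedRing R] [NormedAlgebra ℝ R] [CompleteSpace R]

omit [NormedAlgebra ℝ R] in
-- Neumann series; the bound follows from ρ = 1 - w ρ. The factor ‖1‖ stays because the norm of the
-- unit is not assumed to be 1.
theorem exists_continuous_inverse_one_add {X : Type*} [TopologicalSpace X] {w : X → R}
    (hw : Continuous w) (hw2 : ∀ p, ‖w p‖ ≤ 1 / 2) :
    ∃ ρ : X → R, Continuous ρ ∧ (∀ p, ρ p * (1 + w p) = 1) ∧ (∀ p, (1 + w p) * ρ p = 1) ∧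
      ∀ p, ‖ρ p‖ ≤ 2 * ‖(1 : R)‖ := by
  have hu : ∀ p, IsUnit (1 + w p) := by
    intro p
    have := isUnit_one_sub_of_norm_lt_one (x := -w p) (by rw [norm_neg]; linarith [hw2 p])
    rwa [sub_neg_eq_add] at this
  refine ⟨fun p => Ring.inverse (1 + w p), ?_, fun p => Ring.inverse_mul_cancel _ (hu p),
    fun p => Ring.mul_inverse_cancel _ (hu p), fun p => ?_⟩
  · refine continuous_iff_continuousAt.2 fun p => ?_
    obtain ⟨v, hv⟩ := hu p
    have h := NormedRing.inverse_continuousAt v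
    rw [hv] at h
    exact h.comp (f := fun p => 1 + w p) (by fun_prop)
  · have h := Ring.mul_inverse_cancel _ (hu p)
    set ρ := Ring.inverse (1 + w p)
    have e : ρ = 1 - w p * ρ := by
      rw [add_mul, one_mul] at h
      exact eq_sub_of_add_eq h
    have h1 := norm_sub_le 1 (w p * ρ)
    rw [← e] at h1
    have h2 : ‖w p * ρ‖ ≤ 1 / 2 * ‖ρ‖ :=
      (norm_mul_le _ _).trans (mul_le_mul_of_nonneg_right (hw2 p) (norm_nonneg _))
    linarith

omit [CompleteSpace R] in
-- Makes Abel means with weight e^{-u} a special case of half-line convolutions, with the equation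
-- φ' = φ - g along forward orbits.
theorem isDecayingGroup_exp_neg :
    IsDecayingGroup (fun u => Real.exp (-u) • ContinuousLinearMap.id ℝ R)
      (-ContinuousLinearMap.id ℝ R) 1 1 where
  deriv s := by
    have := ((Real.hasDerivAt_exp (-s)).comp s (hasDerivAt_neg s)).smul_const
      (ContinuousLinearMap.id ℝ R)
    refine this.congr_deriv ?_
    ext x
    simp
  add s t := by
    ext x
    simp [neg_add_rev, Real.exp_add, smul_smul, mul_comm]
  rate_pos := one_pos
  bound u _ := by
    rw [norm_smul, Real.norm_of_nonneg (Real.exp_nonneg _), mul_comm, neg_one_mul]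
    exact mul_le_mul_of_nonneg_right ContinuousLinearMap.norm_id_le (Real.exp_nonneg _)

/-- If the exponentially weighted averages of `l - A` along the orbits are small, then a
near-identity change of variables turns `x' = l x` into a small perturbation of `y' = A y`. -/
theorem exists_nearIdentity_averaging (A : R) (m : ℝ) (hm : 0 ≤ m) {η : ℝ} (hη : 0 < η) :
    ∃ ω > 0, ∀ {X : Type u} [MetricSpace X] [CompactSpace X] (S : Flow ℝ X) (l : X → R),
      Continuous l → (∀ p, ‖l p‖ ≤ m) →
      (∀ p, ‖∫ u in Ioi (0 : ℝ), Real.exp (-u) • (l (S u p) - A)‖ ≤ ω) →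
      ∃ w B : X → R, Continuous w ∧ Continuous B ∧ (∀ p, ‖w p‖ ≤ 1 / 2) ∧ (∀ p, ‖B p‖ ≤ η) ∧
        ∀ p s, HasDerivAt (fun s => w (S s p))
          (l (S s p) * (1 + w (S s p)) - (1 + w (S s p)) * (A + B (S s p))) s := by
  set M := 2 * ‖(1 : R)‖ * (m + ‖A‖ + 1) with hM
  have hM0 : 0 ≤ M := by positivity
  refine ⟨min (1 / 2) (η / (M + 1)), by positivity, ?_⟩
  intro X _ _ S l hl hlm hω
  have hV := isDecayingGroup_exp_neg (R := R)
  have hg : Continuous fun p => l p - A := by fun_prop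
  have hG : ∀ p, ‖l p - A‖ ≤ m + ‖A‖ := fun p =>
    (norm_sub_le _ _).trans (add_le_add (hlm p) le_rfl)
  -- On the reversed flow this is the Abel mean of l - A over the future orbit, so c' = c - (l - A).
  set c := orbitConvolution S.reverse
    (fun u => Real.exp (-u) • ContinuousLinearMap.id ℝ R) (fun p => l p - A) with hc
  have hcc : Continuous c := hV.continuous_orbitConvolution S.reverse hg hG
  have hcω : ∀ p, ‖c p‖ ≤ min (1 / 2) (η / (M + 1)) := by
    intro p
    simpa [hc, orbitConvolution] using hω p
  have hc2 : ∀ p, ‖-c p‖ ≤ 1 / 2 := fun p => by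
    rw [norm_neg]
    exact (hcω p).trans (min_le_left _ _)
  obtain ⟨ρ, hρc, -, hρr, hρb⟩ := exists_continuous_inverse_one_add hcc.neg hc2
  -- With w = -c one has w' = l - A + w. In (1 + w) B = l (1 + w) - (1 + w) A - w' the large term l
  -- - A cancels and l w - w A - w remains, which is of the order of c.
  refine ⟨fun p => -c p, fun p => ρ p * (l p * -c p - -c p * A - -c p), hcc.neg, by fun_prop, hc2,
    fun p => ?_, fun p s => ?_⟩
  · have h0 := norm_nonneg (c p)
    have h1 : ‖l p * -c p - -c p * A - -c p‖ ≤ (m + ‖A‖ + 1) * ‖c p‖ := by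
      have e1 : ‖l p * -c p‖ ≤ m * ‖c p‖ := (norm_mul_le _ _).trans (by
        rw [norm_neg]
        exact mul_le_mul_of_nonneg_right (hlm p) h0)
      have e2 : ‖-c p * A‖ ≤ ‖c p‖ * ‖A‖ := (norm_mul_le _ _).trans (by rw [norm_neg])
      have e3 := norm_sub_le (l p * -c p - -c p * A) (-c p)
      have e4 := norm_sub_le (l p * -c p) (-c p * A)
      rw [norm_neg] at e3
      linarith
    have h2 : ‖ρ p * (l p * -c p - -c p * A - -c p)‖ ≤ M * ‖c p‖ := by
      refine (norm_mul_le _ _).trans ((mul_le_mul (hρb p) h1 (norm_nonneg _)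
        (by positivity)).trans (le_of_eq ?_))
      rw [hM]
      ring
    have h3 : ‖c p‖ * (M + 1) ≤ η := by
      rw [← le_div_iff₀ (by positivity)]
      exact (hcω p).trans (min_le_right _ _)
    nlinarith
  · have d := (hV.hasDerivAt_orbitConvolution_reverse S hg hG p s).neg
    refine d.congr_deriv ?_
    set x := S s p
    change _ = l x * (1 + -c x) - (1 + -c x) * (A + ρ x * (l x * -c x - -c x * A - -c x))
    have hρx : (1 + -c x) * ρ x = 1 := hρr x
    rw [mul_add (1 + -c x) A, ← mul_assoc (1 + -c x) (ρ x), hρx, one_mul, ← hc]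
    simp
    noncomm_ring

/-- Block-diagonalization near the average, with uniform constants: the coefficient `C` of the
transformed system commutes with the projection `S₀` and its solutions grow at rate `a'` on the
range and decay at rate `b'` on the kernel of `S₀`. -/
theorem IsExponentialSplitting.exists_blockDiagonalization {A S₀ : R} {E : ℝ → R} {K a b : ℝ}
    (hE : IsExponentialSplitting A S₀ E K a b) {a' b' : ℝ} (ha : a < a') (hb : b' < b) {m : ℝ}
    (hm : 0 ≤ m) :
    ∃ ω > 0, ∃ k > 0, ∀ {X : Type u} [MetricSpace X] [CompactSpace X] (S : Flow ℝ X) (l : X → R),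
      Continuous l → (∀ p, ‖l p‖ ≤ m) →
      (∀ p, ‖∫ u in Ioi (0 : ℝ), Real.exp (-u) • (l (S u p) - A)‖ ≤ ω) →
      ∃ σ ρ C : X → R, Continuous σ ∧ Continuous ρ ∧ Continuous C ∧
        (∀ p, ρ p * σ p = 1) ∧ (∀ p, ‖σ p‖ ≤ k) ∧ (∀ p, ‖ρ p‖ ≤ k) ∧
        (∀ p, C p * S₀ = S₀ * C p) ∧
        (∀ p s, HasDerivAt (fun s => σ (S s p))
          (l (S s p) * σ (S s p) - σ (S s p) * C (S s p)) s) ∧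
        ∀ p, ∃ Ψ : ℝ → R, Ψ 0 = 1 ∧ (∀ s, HasDerivAt Ψ (C (S s p) * Ψ s) s) ∧
          (∀ s, ‖S₀ * Ψ s‖ ≤ k * Real.exp (a' * |s|)) ∧
          ∀ s, 0 ≤ s → ‖(1 - S₀) * Ψ s‖ ≤ k * Real.exp (-b' * s) := by
  have hK := hE.const_nonneg
  -- Grönwall worsens each exponent by K δ, which must fit into both gaps a' - a and b - b'.
  set δ := min (a' - a) (b - b') / (K + 1) with hδ
  have hδ0 : 0 < δ := div_pos (lt_min (sub_pos.2 ha) (sub_pos.2 hb)) (by linarith)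
  have hKδ : K * δ ≤ min (a' - a) (b - b') := by
    have : δ * (K + 1) = min (a' - a) (b - b') := div_mul_cancel₀ _ (by positivity)
    nlinarith
  have hKa : a + K * δ ≤ a' := by linarith [hKδ.trans (min_le_left _ _)]
  have hKb : -b + K * δ ≤ -b' := by linarith [hKδ.trans (min_le_right _ _)]
  obtain ⟨η, hη, hdec⟩ := hE.exists_decoupling (a := a) hδ0
  obtain ⟨ω, hω, havg⟩ := exists_nearIdentity_averaging A m hm hη
  set c := ‖(1 : R)‖ + 1 / 2 with hc
  -- The three summands bound σ = (1 + w)(1 + H), its inverse ρ, and the coefficients in the two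
  -- growth estimates.
  refine ⟨ω, hω, c * c + 2 * ‖(1 : R)‖ * (2 * ‖(1 : R)‖) + K * K, by positivity, ?_⟩
  intro X _ _ S l hl hlm hlω
  obtain ⟨w, B, hw, hB, hw2, hBη, hwd⟩ := havg S l hl hlm hlω
  obtain ⟨H, D, hH, hD, hH2, hDδ, hDS, hHd⟩ := hdec S B hB hBη
  obtain ⟨ρw, hρw, hρwl, -, hρwb⟩ := exists_continuous_inverse_one_add hw hw2
  obtain ⟨ρH, hρH, hρHl, -, hρHb⟩ := exists_continuous_inverse_one_add hH hH2
  have hb2 : ∀ x : R, ‖x‖ ≤ 1 / 2 → ‖1 + x‖ ≤ c := fun x hx =>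
    (norm_add_le _ _).trans (add_le_add le_rfl hx)
  have hASD : ∀ p, (A + D p) * S₀ = S₀ * (A + D p) := by
    intro p
    rw [add_mul, mul_add, hDS, hE.comm_gen]
  refine ⟨fun p => (1 + w p) * (1 + H p), fun p => ρH p * ρw p, fun p => A + D p, by fun_prop,
    by fun_prop, by fun_prop, fun p => ?_, fun p => ?_, fun p => ?_, hASD, fun p s => ?_,
    fun p => ?_⟩
  · rw [mul_assoc, ← mul_assoc (ρw p), hρwl, one_mul, hρHl]
  · have := (norm_mul_le _ _).trans (mul_le_mul (hb2 _ (hw2 p)) (hb2 _ (hH2 p)) (norm_nonneg _)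
      (by positivity))
    refine this.trans ?_
    have : 0 ≤ 2 * ‖(1 : R)‖ * (2 * ‖(1 : R)‖) + K * K := by positivity
    linarith
  · have := (norm_mul_le _ _).trans (mul_le_mul (hρHb p) (hρwb p) (norm_nonneg _)
      (by positivity))
    refine this.trans ?_
    have : 0 ≤ c * c + K * K := by positivity
    linarith
  · refine (((hwd p s).const_add 1).mul ((hHd p s).const_add 1)).congr_deriv ?_
    noncomm_ring
  · have hCc : Continuous fun p => A + D p := by fun_prop
    have hCm : ∀ p, ‖A + D p‖ ≤ ‖A‖ + δ := fun p =>
      (norm_add_le _ _).trans (add_le_add le_rfl (hDδ p))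
    have hm0 : 0 < ‖A‖ + δ := by positivity
    have hd := hasDerivAt_fundamentalCocycle S hCc hm0 hCm p
    have h0 := fundamentalCocycle_zero S hCc hm0 hCm p
    set Ψ := fundamentalCocycle S (fun p => A + D p) p with hΨ
    have hDc : Continuous fun s => D (S s p) := hD.comp (by fun_prop)
    have hkK : ∀ x : ℝ, 0 ≤ x → K * K * x ≤
        (c * c + 2 * ‖(1 : R)‖ * (2 * ‖(1 : R)‖) + K * K) * x := by
      intro x hx
      refine mul_le_mul_of_nonneg_right ?_ hx
      have : 0 ≤ c * c + 2 * ‖(1 : R)‖ * (2 * ‖(1 : R)‖) := by positivity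
      linarith
    have hq : ∀ q : R, (∀ p, (A + D p) * q = q * (A + D p)) → ∀ s,
        HasDerivAt (fun s => q * Ψ s) ((A + D (S s p)) * (q * Ψ s)) s := by
      intro q hq s
      refine ((hd s).const_mul q).congr_deriv ?_
      rw [← mul_assoc, ← mul_assoc, hq]
    have hDQ : ∀ x, D x * (1 - S₀) = (1 - S₀) * D x := by
      intro x
      rw [mul_sub, sub_mul, hDS, mul_one, one_mul]
    have hQd := hq (1 - S₀) (fun p => by rw [mul_sub, sub_mul, hASD, mul_one, one_mul])
    have hSd := hq S₀ hASD
    have hEd : ∀ s, HasDerivAt E (E s * A) s := fun s => by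
      rw [hE.comm]
      exact hE.deriv s
    have hSpos : ∀ s, 0 ≤ s → ‖S₀ * Ψ s‖ ≤ K * K * Real.exp (a' * |s|) := by
      intro s hs
      have h := norm_le_of_perturbed_exponential hEd hE.zero (S₀ := S₀) (K := K) (c := a)
        (fun s hs => by simpa [abs_of_nonneg hs] using hE.bound_center s) hDc
        (fun s => hDδ _) (fun s => hDS _) (Y := fun s => S₀ * Ψ s)
        (fun s => by rw [← mul_assoc, hE.idem]) hSd hs
      rw [h0, mul_one] at h
      refine h.trans ?_
      rw [abs_of_nonneg hs]
      gcongr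
      exact hE.norm_proj_le
    -- Time reversal: s ↦ Ψ(-s) solves the system with -A and -D, and E on the center range has the
    -- same growth bound in both time directions.
    have hSneg : ∀ s, s ≤ 0 → ‖S₀ * Ψ s‖ ≤ K * K * Real.exp (a' * |s|) := by
      intro s hs
      have h := norm_le_of_perturbed_exponential (A := -A) (E := fun s => E (-s)) (S₀ := S₀)
        (K := K) (c := a) (δ := δ) (D := fun s => -D (S (-s) p)) (Y := fun s => S₀ * Ψ (-s))
        (fun s => by simpa using hE.deriv_neg s) (by simp [hE.zero])
        (fun s hs => by simpa [abs_of_nonneg hs] using hE.bound_center (-s))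
        (hDc.comp continuous_neg).neg (fun s => by simpa using hDδ _)
        (fun s => by simp [hDS]) (fun s => by rw [← mul_assoc, hE.idem])
        (fun s => by
          have := (hSd (-s)).scomp s (hasDerivAt_neg s)
          refine (this.congr_deriv ?_)
          simp
          noncomm_ring) (s := -s) (by linarith)
      simp only [neg_neg, neg_zero, h0, mul_one] at h
      refine h.trans ?_
      rw [abs_of_nonpos hs]
      have : 0 ≤ -s := by linarith
      gcongr
      exact hE.norm_proj_le
    refine ⟨Ψ, h0, hd, fun s => ?_, fun s hs => ?_⟩
    · refine le_trans ?_ (hkK _ (Real.exp_nonneg _))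
      rcases le_total 0 s with hs | hs
      exacts [hSpos s hs, hSneg s hs]
    · refine le_trans ?_ (hkK _ (Real.exp_nonneg _))
      have h := norm_le_of_perturbed_exponential hEd hE.zero (S₀ := 1 - S₀) (K := K) (c := -b)
        hE.bound_stable hDc (fun s => hDδ _) (fun s => hDQ _) (Y := fun s => (1 - S₀) * Ψ s)
        (fun s => by rw [← mul_assoc, hE.compl_idem]) hQd hs
      rw [h0, mul_one] at h
      refine h.trans ?_
      gcongr
      exact hE.norm_compl_le

end NearIdentity

/-! ### Uniform convergence of Abel means from unique ergodicity -/

section UniqueErgodicity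

/-- The exponential distribution on the half-line. -/
def halfLineExp : Measure ℝ :=
  (volume.restrict (Ioi (0 : ℝ))).withDensity fun u => ENNReal.ofReal (Real.exp (-u))

theorem integral_halfLineExp (g : ℝ → ℝ) :
    ∫ u, g u ∂halfLineExp = ∫ u in Ioi (0 : ℝ), Real.exp (-u) * g u := by
  rw [halfLineExp, integral_withDensity_eq_integral_toReal_smul (by fun_prop) (by simp)]
  refine integral_congr_ae (Filter.Eventually.of_forall fun u => ?_)
  simp [ENNReal.toReal_ofReal (Real.exp_nonneg _)]

instance : IsProbabilityMeasure halfLineExp where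
  measure_univ := by
    have h := exp_neg_integrableOn_Ioi 0 one_pos
    simp only [neg_mul, one_mul] at h
    rw [halfLineExp, withDensity_apply _ MeasurableSet.univ, Measure.restrict_univ,
      ← ofReal_integral_eq_lintegral_ofReal h
        (Filter.Eventually.of_forall fun u => Real.exp_nonneg _), integral_exp_neg_Ioi]
    simp

variable {P : Type*} [MetricSpace P] [CompactSpace P] [MeasurableSpace P] [BorelSpace P]

omit [CompactSpace P] [MeasurableSpace P] [BorelSpace P] in
-- Shifting by t on the original time scale is a shift by t|ε| on the fast one, and the Abel mean φ
-- has derivative φ - g, bounded by 2G, along the fast flow. So the Abel means are asymptotically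
-- invariant as ε → 0.
theorem abs_expMean_sub_le (τ : Flow ℝ P) {g : P → ℝ} (hg : Continuous g) {G : ℝ}
    (hG : ∀ p, ‖g p‖ ≤ G) {ε : ℝ} (hε : ε ≠ 0) (t : ℝ) (p : P) :
    |(∫ u in Ioi (0 : ℝ), Real.exp (-u) * g (τ t (τ (u / |ε|) p))) -
      ∫ u in Ioi (0 : ℝ), Real.exp (-u) * g (τ (u / |ε|) p)| ≤ 2 * G * (|t| * |ε|) := by
  have hV := isDecayingGroup_exp_neg (R := ℝ)
  set S := fastFlow τ ε
  set φ : P → ℝ := orbitConvolution S.reverse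
    (fun u => Real.exp (-u) • ContinuousLinearMap.id ℝ ℝ) g with hφ
  have hφb : ∀ q, ‖φ q‖ ≤ G := fun q => by
    simpa using hV.norm_orbitConvolution_le S.reverse hG q
  have hd := hV.hasDerivAt_orbitConvolution_reverse S hg hG p
  have hmv := Convex.norm_image_sub_le_of_norm_hasDerivWithin_le (s := univ)
    (f := fun s => φ (S s p)) (C := 2 * G) (x := 0) (y := t * |ε|)
    (fun s _ => (hd s).hasDerivWithinAt) (fun s _ => ?_) convex_univ (mem_univ _) (mem_univ _)
  · have hε' : |ε| ≠ 0 := abs_ne_zero.2 hε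
    have e1 : φ (S (t * |ε|) p) = ∫ u in Ioi (0 : ℝ), Real.exp (-u) * g (τ t (τ (u / |ε|) p)) := by
      simp only [hφ, orbitConvolution]
      refine integral_congr_ae (Filter.Eventually.of_forall fun u => ?_)
      change Real.exp (-u) * g (τ (- -u / |ε|) (τ (t * |ε| / |ε|) p)) =
        Real.exp (-u) * g (τ t (τ (u / |ε|) p))
      rw [neg_neg, ← Flow.map_add, ← Flow.map_add, mul_div_cancel_right₀ _ hε', add_comm]
    have e2 : φ (S 0 p) = ∫ u in Ioi (0 : ℝ), Real.exp (-u) * g (τ (u / |ε|) p) := by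
      rw [Flow.map_zero_apply]
      simp only [hφ, orbitConvolution]
      refine integral_congr_ae (Filter.Eventually.of_forall fun u => ?_)
      change Real.exp (-u) * g (τ (- -u / |ε|) p) = _
      rw [neg_neg]
    rw [e1, e2] at hmv
    simpa [abs_mul] using hmv
  · have h1 := hφb (S s p)
    have h2 := hG (S s p)
    have : -((-ContinuousLinearMap.id ℝ ℝ) (φ (S s p)) +
      (Real.exp (-0) • ContinuousLinearMap.id ℝ ℝ) (g (S s p))) = φ (S s p) - g (S s p) := by
      simp
      ring
    rw [← hφ, this]
    exact (norm_sub_le _ _).trans (by linarith)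

/-- Otherwise there are bad parameters ε_n → 0 with bad base points p_n. A limit of the
exponentially weighted occupation measures of their orbits is invariant, hence equals μ, which
contradicts the badness. The p_n are arbitrary, and this is where the uniformity in p comes from. -/
theorem IsUniqueInvariantProbability.expMean_close {τ : Flow ℝ P} {μ : Measure P}
    (hμ : IsUniqueInvariantProbability τ μ) {g : P → ℝ} (hg : Continuous g) {δ : ℝ} (hδ : 0 < δ) :
    ∃ ε₀ > 0, ∀ ε : ℝ, ε ≠ 0 → |ε| ≤ ε₀ → ∀ p,
      |(∫ u in Ioi (0 : ℝ), Real.exp (-u) * g (τ (u / |ε|) p)) - ∫ p, g p ∂μ| ≤ δ := by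
  by_contra! hcon
  have hcon' : ∀ n : ℕ, ∃ ε : ℝ, ε ≠ 0 ∧ |ε| ≤ 1 / ((n : ℝ) + 1) ∧ ∃ p,
      δ < |(∫ u in Ioi (0 : ℝ), Real.exp (-u) * g (τ (u / |ε|) p)) - ∫ p, g p ∂μ| :=
    fun n => hcon _ Nat.one_div_pos_of_nat
  choose ε hε0 hε p hp using hcon'
  have hmeas : ∀ n, Measurable fun u => τ (u / |ε n|) (p n) := fun n =>
    (show Continuous fun u => τ (u / |ε n|) (p n) by fun_prop).measurable
  let ν : ℕ → ProbabilityMeasure P := fun n =>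
    ⟨halfLineExp.map fun u => τ (u / |ε n|) (p n), Measure.isProbabilityMeasure_map
      (hmeas n).aemeasurable⟩
  have hν : ∀ n (h : P → ℝ), Continuous h → ∫ x, h x ∂(ν n : Measure P) =
      ∫ u in Ioi (0 : ℝ), Real.exp (-u) * h (τ (u / |ε n|) (p n)) := by
    intro n h hh
    change ∫ x, h x ∂(halfLineExp.map fun u => τ (u / |ε n|) (p n)) = _
    rw [integral_map (hmeas n).aemeasurable hh.aestronglyMeasurable, integral_halfLineExp]
  -- An ultrafilter replaces the extraction of a subsequence: by compactness the measures converge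
  -- along it.
  let 𝒰 := Filter.hyperfilter ℕ
  obtain ⟨ν₀, hν₀⟩ : ∃ ν₀, Filter.Tendsto ν 𝒰 (𝓝 ν₀) := by
    obtain ⟨x, -, hx⟩ := isCompact_univ.ultrafilter_le_nhds (𝒰.map ν) (by simp)
    exact ⟨x, hx⟩
  rw [ProbabilityMeasure.tendsto_iff_forall_integral_tendsto] at hν₀
  have hlim : ∀ h : P → ℝ, Continuous h → Filter.Tendsto (fun n => ∫ x, h x ∂(ν n : Measure P)) 𝒰
      (𝓝 (∫ x, h x ∂(ν₀ : Measure P))) := fun h hh =>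
    hν₀ (BoundedContinuousFunction.mkOfCompact ⟨h, hh⟩)
  have hε_lim : Filter.Tendsto (fun n => |ε n|) 𝒰 (𝓝 0) := by
    have : Filter.Tendsto (fun n : ℕ => 1 / ((n : ℝ) + 1)) 𝒰 (𝓝 0) :=
      tendsto_one_div_add_atTop_nhds_zero_nat.mono_left Nat.hyperfilter_le_atTop
    exact squeeze_zero (fun n => abs_nonneg _) hε this
  have hinv : ∀ t, (ν₀ : Measure P).map (τ t) = ν₀ := by
    intro t
    have hτ : Continuous (τ t) := by fun_prop
    have := Measure.isProbabilityMeasure_map (μ := (ν₀ : Measure P)) hτ.measurable.aemeasurable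
    refine ext_of_forall_integral_eq_of_IsFiniteMeasure fun h => ?_
    rw [integral_map hτ.measurable.aemeasurable h.continuous.aestronglyMeasurable]
    have h1 := (hlim (fun x => h (τ t x)) (by fun_prop)).sub (hlim h h.continuous)
    have h2 : Filter.Tendsto (fun n => (∫ x, h (τ t x) ∂(ν n : Measure P)) -
        ∫ x, h x ∂(ν n : Measure P)) 𝒰 (𝓝 0) := by
      have h3 : Filter.Tendsto (fun n => 2 * ‖h‖ * (|t| * |ε n|)) 𝒰 (𝓝 0) := by
        simpa using (hε_lim.const_mul |t|).const_mul (2 * ‖h‖)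
      refine squeeze_zero_norm (fun n => ?_) h3
      rw [hν n _ (by fun_prop), hν n _ h.continuous]
      exact abs_expMean_sub_le τ h.continuous h.norm_coe_le_norm (hε0 n) t (p n)
    exact sub_eq_zero.1 (tendsto_nhds_unique h1 h2)
  have hν₀μ : (ν₀ : Measure P) = μ := by
    refine hμ.2 _ inferInstance fun t B hB => ?_
    conv_rhs => rw [← hinv (-t)]
    -- Invariance in the hypothesis is about images; the image under τ_t is the preimage under
    -- τ_{-t}.
    rw [Measure.map_apply (by fun_prop) hB, Flow.image_eq_preimage_symm]
  have hlast := ((hlim g hg).sub_const (∫ p, g p ∂μ)).abs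
  rw [hν₀μ, sub_self, abs_zero] at hlast
  obtain ⟨n, hn⟩ := (hlast.eventually (gt_mem_nhds hδ)).exists
  rw [hν n g hg] at hn
  exact lt_asymm hn (hp n)

end UniqueErgodicity

/-! ### Abel means of matrix functions, entry by entry -/

section MatrixAverages

variable {m n : Type*} [Fintype m] [Fintype n] [DecidableEq m] [DecidableEq n]

theorem exists_norm_le_of_entries_le :
    ∃ c > 0, ∀ (M : Matrix m n ℝ) (t : ℝ), (∀ i j, |M i j| ≤ t) → 0 ≤ t → ‖M‖ ≤ c * t := by
  refine ⟨(∑ i : m, ∑ j : n, ‖(Matrix.single i j 1 : Matrix m n ℝ)‖) + 1, by positivity,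
    fun M t h ht => ?_⟩
  have e : M = ∑ i, ∑ j, M i j • Matrix.single i j (1 : ℝ) := by
    conv_lhs => rw [Matrix.matrix_eq_sum_single M]
    simp [Matrix.smul_single]
  have h1 : ‖M‖ ≤ ∑ i : m, ∑ j : n, ‖(Matrix.single i j 1 : Matrix m n ℝ)‖ * t := by
    conv_lhs => rw [e]
    refine (norm_sum_le _ _).trans (Finset.sum_le_sum fun i _ =>
      (norm_sum_le _ _).trans (Finset.sum_le_sum fun j _ => ?_))
    rw [norm_smul, mul_comm]
    exact mul_le_mul_of_nonneg_left (h i j) (norm_nonneg _)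
  simp only [← Finset.sum_mul] at h1
  linarith

omit [DecidableEq m] [DecidableEq n] in
/-- The evaluation of a matrix at an entry, as a continuous linear map. -/
def matrixEntryCLM (i : m) (j : n) : Matrix m n ℝ →L[ℝ] ℝ :=
  LinearMap.toContinuousLinearMap (Matrix.entryLinearMap ℝ ℝ i j)

omit [DecidableEq m] [DecidableEq n] in
@[simp]
theorem matrixEntryCLM_apply (i : m) (j : n) (M : Matrix m n ℝ) : matrixEntryCLM i j M = M i j :=
  rfl

variable {P : Type*} [MetricSpace P] [CompactSpace P] [MeasurableSpace P] [BorelSpace P]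

theorem IsUniqueInvariantProbability.matrix_expMean_close {τ : Flow ℝ P} {μ : Measure P}
    (hμ : IsUniqueInvariantProbability τ μ) {g : P → Matrix n n ℝ} (hg : Continuous g)
    {A : Matrix n n ℝ} (hA : ∀ i j, A i j = ∫ p, g p i j ∂μ) {δ : ℝ} (hδ : 0 < δ) :
    ∃ ε₀ > 0, ∀ ε : ℝ, ε ≠ 0 → |ε| ≤ ε₀ → ∀ p,
      ‖∫ u in Ioi (0 : ℝ), Real.exp (-u) • (g (fastFlow τ ε u p) - A)‖ ≤ δ := by
  obtain ⟨c, hc, hcM⟩ := exists_norm_le_of_entries_le (m := n) (n := n)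
  have hgij : ∀ i j, Continuous fun p => g p i j := fun i j =>
    (matrixEntryCLM i j).continuous.comp hg
  choose e he h using fun i j => hμ.expMean_close (hgij i j) (δ := δ / c) (by positivity)
  obtain ⟨ε₀, hε₀, hε₀e⟩ : ∃ ε₀ > 0, ∀ i j, ε₀ ≤ e i j := by
    by_cases hn : Nonempty n
    · refine ⟨Finset.univ.inf' Finset.univ_nonempty fun i =>
        Finset.univ.inf' Finset.univ_nonempty fun j => e i j, ?_, fun i j => ?_⟩
      · simp [Finset.lt_inf'_iff, he]
      · exact (Finset.inf'_le _ (Finset.mem_univ i)).trans (Finset.inf'_le _ (Finset.mem_univ j))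
    · exact ⟨1, one_pos, fun i => (hn ⟨i⟩).elim⟩
  refine ⟨ε₀, hε₀, fun ε hε hεε p => ?_⟩
  have hV := isDecayingGroup_exp_neg (R := Matrix n n ℝ)
  have hgA : Continuous fun p => g p - A := by fun_prop
  obtain ⟨G, hG⟩ := isCompact_univ.exists_bound_of_continuousOn hgA.continuousOn
  have hint := hV.integrableOn (g := fun u => g (fastFlow τ ε u p) - A)
    (hgA.comp (f := fun u => fastFlow τ ε u p) (by fun_prop)) (fun u => hG _ (mem_univ _))
  have hint' : IntegrableOn (fun u => Real.exp (-u) • (g (fastFlow τ ε u p) - A)) (Ioi 0) := hint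
  have := hcM (∫ u in Ioi (0 : ℝ), Real.exp (-u) • (g (fastFlow τ ε u p) - A)) (δ / c)
    (fun i j => ?_) (by positivity)
  · rwa [mul_div_cancel₀ _ hc.ne'] at this
  · have e1 : (∫ u in Ioi (0 : ℝ), Real.exp (-u) • (g (fastFlow τ ε u p) - A)) i j =
        (∫ u in Ioi (0 : ℝ), Real.exp (-u) * g (τ (u / |ε|) p) i j) - ∫ p, g p i j ∂μ := by
      rw [← matrixEntryCLM_apply i j (∫ u in Ioi (0 : ℝ), _),
        ← ContinuousLinearMap.integral_comp_comm _ hint', ← hA]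
      have hV' := isDecayingGroup_exp_neg (R := ℝ)
      obtain ⟨G', hG'⟩ := isCompact_univ.exists_bound_of_continuousOn (hgij i j).continuousOn
      have i1 : IntegrableOn (fun u => Real.exp (-u) * g (τ (u / |ε|) p) i j) (Ioi 0) :=
        hV'.integrableOn (g := fun u => g (τ (u / |ε|) p) i j)
          ((hgij i j).comp (f := fun u => τ (u / |ε|) p) (by fun_prop)) fun u => hG' _ (mem_univ _)
      have i2 : IntegrableOn (fun u => Real.exp (-u) * A i j) (Ioi 0) :=
        hV'.integrableOn (g := fun _ => A i j) continuous_const fun _ => le_rfl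
      have i3 : ∫ u in Ioi (0 : ℝ), Real.exp (-u) * A i j = A i j := by
        rw [integral_mul_const, integral_exp_neg_Ioi]
        simp
      conv_rhs => rw [← i3]
      rw [← integral_sub i1 i2]
      refine integral_congr_ae (Filter.Eventually.of_forall fun u => ?_)
      simp [mul_sub, fastFlow]
    rw [e1]
    exact h i j ε hε (hεε.trans (hε₀e i j)) p

end MatrixAverages

/-! ### Generalized eigenspaces and growth of the matrix exponential -/

section SpectralGrowth

variable {d : ℕ}

theorem matrix_map_exp (A : Matrix (Fin d) (Fin d) ℝ) :
    (NormedSpace.exp A).map Complex.ofReal = NormedSpace.exp (A.map Complex.ofReal) := by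
  let _ : NormedAlgebra ℚ (Matrix (Fin d) (Fin d) ℝ) := NormedAlgebra.restrictScalars ℚ ℝ _
  let _ : NormedAlgebra ℚ (Matrix (Fin d) (Fin d) ℂ) := NormedAlgebra.restrictScalars ℚ ℂ _
  exact NormedSpace.map_exp (Complex.ofRealHom.mapMatrix (m := Fin d))
    (Continuous.matrix_map continuous_id Complex.continuous_ofReal) A

theorem hasDerivAt_exp_smul_mulVec (M : Matrix (Fin d) (Fin d) ℂ) (v : Fin d → ℂ) (s : ℝ) :
    HasDerivAt (fun s : ℝ => NormedSpace.exp (s • M) *ᵥ v)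
      (NormedSpace.exp (s • M) *ᵥ (M *ᵥ v)) s := by
  have h := hasDerivAt_exp_smul_const M s
  let T : Matrix (Fin d) (Fin d) ℂ →ₗ[ℝ] (Fin d → ℂ) :=
    { toFun := fun N => N *ᵥ v
      map_add' := fun N N' => Matrix.add_mulVec N N' v
      map_smul' := fun c N => Matrix.smul_mulVec c N v }
  have := (LinearMap.toContinuousLinearMap T).hasFDerivAt.comp_hasDerivAt s h
  refine this.congr_deriv ?_
  exact (Matrix.mulVec_mulVec v (NormedSpace.exp (s • M)) M).symm

/-- Induction on k: the derivative of e^{-sz} exp(sM) v is e^{-sz} exp(sM) (M - z) v, and (M - z) v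
is killed by a lower power. Integrating a bound C e^{γ|s|} gives one of the same form, so polynomial
factors are absorbed by the arbitrarily small γ. -/
theorem exp_growth_of_pow_sub_eq_zero (M : Matrix (Fin d) (Fin d) ℂ) (z : ℂ) {γ : ℝ} (hγ : 0 < γ)
    (k : ℕ) : ∀ v : Fin d → ℂ, ((Matrix.toLin' M - z • 1) ^ k) v = 0 →
      ∃ C, ∀ s : ℝ, ‖NormedSpace.exp (s • M) *ᵥ v‖ ≤ C * Real.exp (s * z.re + γ * |s|) := by
  suffices H : ∀ v : Fin d → ℂ, ((Matrix.toLin' M - z • 1) ^ k) v = 0 →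
      ∃ C, ∀ s : ℝ, ‖Complex.exp (-(s : ℂ) * z) • (NormedSpace.exp (s • M) *ᵥ v)‖ ≤
        C * Real.exp (γ * |s|) by
    intro v hv
    obtain ⟨C, hC⟩ := H v hv
    refine ⟨C, fun s => ?_⟩
    have h := mul_le_mul_of_nonneg_left (hC s) (Real.exp_nonneg (s * z.re))
    rw [norm_smul, Complex.norm_exp, ← mul_assoc, ← Real.exp_add] at h
    have e : s * z.re + (-(s : ℂ) * z).re = 0 := by simp
    rw [e, Real.exp_zero, one_mul] at h
    refine h.trans (le_of_eq ?_)
    rw [Real.exp_add]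
    ring
  induction k with
  | zero =>
    intro v hv
    refine ⟨0, fun s => ?_⟩
    have : v = 0 := by simpa using hv
    simp [this]
  | succ k ih =>
    intro v hv
    obtain ⟨C, hC⟩ := ih ((Matrix.toLin' M - z • 1) v) (by rwa [pow_succ] at hv)
    set y : ℝ → Fin d → ℂ := fun s => Complex.exp (-(s : ℂ) * z) • (NormedSpace.exp (s • M) *ᵥ v)
    have hexp : ∀ s : ℝ, HasDerivAt (fun s : ℝ => Complex.exp (-(s : ℂ) * z))
        (Complex.exp (-(s : ℂ) * z) * (-z)) s := by
      intro s
      have h0 : HasDerivAt (fun s : ℝ => -(s : ℂ) * z) (-z) s := by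
        simpa using (HasDerivAt.ofReal_comp (hasDerivAt_id s)).neg.mul_const z
      exact h0.cexp
    have hy : ∀ s : ℝ, HasDerivAt y (Complex.exp (-(s : ℂ) * z) •
        (NormedSpace.exp (s • M) *ᵥ ((Matrix.toLin' M - z • 1) v))) s := by
      intro s
      refine ((hexp s).smul (hasDerivAt_exp_smul_mulVec M v s)).congr_deriv ?_
      have e : (Matrix.toLin' M - z • 1) v = M *ᵥ v - z • v := rfl
      rw [e, Matrix.mulVec_sub, Matrix.mulVec_smul, smul_sub, smul_smul, mul_neg, neg_smul,
        sub_eq_add_neg]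
    have h := norm_sub_le_of_deriv_le_exp hγ hy hC
    refine ⟨‖y 0‖ + C / γ, fun s => ?_⟩
    have h1 : ‖y s‖ ≤ ‖y 0‖ + ‖y s - y 0‖ := by
      have := norm_add_le (y 0) (y s - y 0)
      rwa [add_sub_cancel] at this
    have h2 : ‖y 0‖ ≤ ‖y 0‖ * Real.exp (γ * |s|) :=
      le_mul_of_one_le_right (norm_nonneg _) (Real.one_le_exp (by positivity))
    rw [add_mul]
    linarith [h s]

/-- The vectors whose trajectories under `exp (s M)`, `s ∈ T`, grow at most like `φ`. -/
def growthSubmodule (M : Matrix (Fin d) (Fin d) ℂ) (T : Set ℝ) (φ : ℝ → ℝ) :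
    Submodule ℂ (Fin d → ℂ) where
  carrier := {v | ∃ C, ∀ s ∈ T, ‖NormedSpace.exp (s • M) *ᵥ v‖ ≤ C * φ s}
  add_mem' := by
    rintro v w ⟨C, hC⟩ ⟨C', hC'⟩
    refine ⟨C + C', fun s hs => ?_⟩
    rw [Matrix.mulVec_add, add_mul]
    exact (norm_add_le _ _).trans (add_le_add (hC s hs) (hC' s hs))
  zero_mem' := ⟨0, fun s _ => by simp⟩
  smul_mem' := by
    rintro c v ⟨C, hC⟩
    refine ⟨‖c‖ * C, fun s hs => ?_⟩
    rw [Matrix.mulVec_smul, norm_smul, mul_assoc]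
    exact mul_le_mul_of_nonneg_left (hC s hs) (norm_nonneg _)

/-- The sum of the complex generalized eigenspaces of `A` with eigenvalues in `Z`. -/
def genEigenspaceSum (A : Matrix (Fin d) (Fin d) ℝ) (Z : Set ℂ) : Submodule ℂ (Fin d → ℂ) :=
  ⨆ z ∈ Z, Module.End.maxGenEigenspace (Matrix.toLin' (A.map Complex.ofReal)) z

/-- The real vectors in the sum of the complex generalized eigenspaces with eigenvalues in `Z`. -/
def realEigenspaceSum (A : Matrix (Fin d) (Fin d) ℝ) (Z : Set ℂ) : Submodule ℝ (Fin d → ℝ) :=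
  ((genEigenspaceSum A Z).restrictScalars ℝ).comap (Complex.ofRealCLM.toLinearMap.compLeft (Fin d))

theorem mem_realEigenspaceSum {A : Matrix (Fin d) (Fin d) ℝ} {Z : Set ℂ} {v : Fin d → ℝ} :
    v ∈ realEigenspaceSum A Z ↔ (fun i => (v i : ℂ)) ∈ genEigenspaceSum A Z := Iff.rfl

theorem ofReal_mulVec (A : Matrix (Fin d) (Fin d) ℝ) (v : Fin d → ℝ) :
    (fun i => ((A *ᵥ v) i : ℂ)) = A.map Complex.ofReal *ᵥ fun i => (v i : ℂ) := by
  funext i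
  simp [Matrix.mulVec, dotProduct]

/-- Vectors with a prescribed growth bound form a subspace, so it is enough to check each
generalized eigenspace; complexification does not change the sup norm of a real trajectory. -/
theorem exp_growth_of_mem_realEigenspaceSum {A : Matrix (Fin d) (Fin d) ℝ} {Z : Set ℂ} {γ : ℝ}
    (hγ : 0 < γ) {T : Set ℝ} {φ : ℝ → ℝ}
    (h : ∀ z ∈ Z, ∀ s ∈ T, Real.exp (s * z.re + γ * |s|) ≤ φ s) {v : Fin d → ℝ}
    (hv : v ∈ realEigenspaceSum A Z) :
    ∃ C, ∀ s ∈ T, ‖NormedSpace.exp (s • A) *ᵥ v‖ ≤ C * φ s := by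
  have hle : genEigenspaceSum A Z ≤ growthSubmodule (A.map Complex.ofReal) T φ := by
    refine iSup₂_le fun z hz w hw => ?_
    rw [Module.End.mem_maxGenEigenspace] at hw
    obtain ⟨k, hk⟩ := hw
    obtain ⟨C, hC⟩ := exp_growth_of_pow_sub_eq_zero _ z hγ k w hk
    refine ⟨|C|, fun s hs => (hC s).trans ?_⟩
    exact (mul_le_mul_of_nonneg_right (le_abs_self C) (Real.exp_nonneg _)).trans
      (mul_le_mul_of_nonneg_left (h z hz s hs) (abs_nonneg C))
  obtain ⟨C, hC⟩ := hle (mem_realEigenspaceSum.1 hv)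
  refine ⟨C, fun s hs => le_trans (le_of_eq ?_) (hC s hs)⟩
  have e : s • A.map Complex.ofReal = (s • A).map Complex.ofReal := by
    ext i j
    simp
  rw [e, ← matrix_map_exp, ← ofReal_mulVec]
  simp [Pi.norm_def]

theorem mulVec_mem_realEigenspaceSum {A : Matrix (Fin d) (Fin d) ℝ} {Z : Set ℂ} {v : Fin d → ℝ}
    (hv : v ∈ realEigenspaceSum A Z) : A *ᵥ v ∈ realEigenspaceSum A Z := by
  rw [mem_realEigenspaceSum, ofReal_mulVec]
  have hle : genEigenspaceSum A Z ≤
      (genEigenspaceSum A Z).comap (Matrix.toLin' (A.map Complex.ofReal)) := by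
    refine iSup₂_le fun z hz w hw => ?_
    exact (le_iSup₂_of_le z hz le_rfl : _ ≤ genEigenspaceSum A Z)
      (Module.End.mapsTo_maxGenEigenspace_of_comm (Commute.refl _) z hw)
  exact hle (mem_realEigenspaceSum.1 hv)

theorem star_mulVec_ofReal (A : Matrix (Fin d) (Fin d) ℝ) (v : Fin d → ℂ) :
    A.map Complex.ofReal *ᵥ star v = star (A.map Complex.ofReal *ᵥ v) := by
  funext i
  simp [Matrix.mulVec, dotProduct]

theorem pow_sub_apply_star (A : Matrix (Fin d) (Fin d) ℝ) (z : ℂ) (k : ℕ) (v : Fin d → ℂ) :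
    ((Matrix.toLin' (A.map Complex.ofReal) - star z • 1) ^ k) (star v) =
      star (((Matrix.toLin' (A.map Complex.ofReal) - z • 1) ^ k) v) := by
  induction k generalizing v with
  | zero => simp
  | succ k ih =>
    rw [pow_succ, pow_succ, Module.End.mul_apply, Module.End.mul_apply, ← ih]
    congr 1
    simp [star_mulVec_ofReal]

theorem star_mem_genEigenspaceSum {A : Matrix (Fin d) (Fin d) ℝ} {Z : Set ℂ}
    (hZ : ∀ z ∈ Z, star z ∈ Z) {v : Fin d → ℂ} (hv : v ∈ genEigenspaceSum A Z) :
    star v ∈ genEigenspaceSum A Z := by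
  let U : Submodule ℂ (Fin d → ℂ) :=
    { carrier := {v | star v ∈ genEigenspaceSum A Z}
      add_mem' := fun {a b} ha hb => by
        simpa using add_mem (show star a ∈ genEigenspaceSum A Z from ha)
          (show star b ∈ genEigenspaceSum A Z from hb)
      zero_mem' := by simp
      smul_mem' := fun c a ha => by
        simpa using Submodule.smul_mem _ (star c) (show star a ∈ genEigenspaceSum A Z from ha) }
  have hle : genEigenspaceSum A Z ≤ U := by
    refine iSup₂_le fun z hz w hw => ?_
    have hle' : _ ≤ genEigenspaceSum A Z := le_iSup₂_of_le (star z) (hZ z hz) le_rfl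
    refine hle' ?_
    rw [Module.End.mem_maxGenEigenspace] at hw ⊢
    obtain ⟨k, hk⟩ := hw
    exact ⟨k, by rw [pow_sub_apply_star, hk, star_zero]⟩
  exact hle hv

theorem star_mem_complexEigenvalues {A : Matrix (Fin d) (Fin d) ℝ} {z : ℂ}
    (hz : z ∈ complexEigenvalues A) : star z ∈ complexEigenvalues A := by
  obtain ⟨v, hv⟩ := Module.End.HasEigenvalue.exists_hasEigenvector hz
  refine Module.End.hasEigenvalue_of_hasEigenvector (x := star v) ⟨?_, by simpa using hv.2⟩
  rw [Module.End.mem_eigenspace_iff, Matrix.toLin'_apply, star_mulVec_ofReal, ← star_smul,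
    ← Matrix.toLin'_apply, hv.apply_eq_smul]

theorem maxGenEigenspace_eq_bot {A : Matrix (Fin d) (Fin d) ℝ} {z : ℂ}
    (hz : z ∉ complexEigenvalues A) :
    Module.End.maxGenEigenspace (Matrix.toLin' (A.map Complex.ofReal)) z = ⊥ := by
  have h : Module.End.eigenspace (Matrix.toLin' (A.map Complex.ofReal)) z = ⊥ := by
    by_contra hne
    exact hz hne
  rw [Module.End.eigenspace_def, LinearMap.ker_eq_bot] at h
  rw [eq_bot_iff]
  intro v hv
  rw [Module.End.mem_maxGenEigenspace] at hv
  obtain ⟨k, hk⟩ := hv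
  rw [Module.End.pow_apply] at hk
  have hi := h.iterate k
  refine (Submodule.mem_bot ℂ).2 (hi (hk.trans ?_))
  rw [← Module.End.pow_apply, map_zero]

/-- The complex generalized eigenspaces span and are independent. Since Z and Z' are stable under
conjugation, both complex sums are too, and the components of a real vector can be replaced by their
real parts. -/
theorem isCompl_realEigenspaceSum {A : Matrix (Fin d) (Fin d) ℝ} {Z Z' : Set ℂ}
    (hu : complexEigenvalues A = Z ∪ Z') (hd : Disjoint Z Z') (hZ : ∀ z ∈ Z, star z ∈ Z)
    (hZ' : ∀ z ∈ Z', star z ∈ Z') :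
    IsCompl (realEigenspaceSum A Z) (realEigenspaceSum A Z') := by
  have hdis : Disjoint (genEigenspaceSum A Z) (genEigenspaceSum A Z') :=
    (Module.End.independent_maxGenEigenspace _).disjoint_biSup_biSup hd
  have htop : genEigenspaceSum A Z ⊔ genEigenspaceSum A Z' = ⊤ := by
    rw [eq_top_iff, ← Module.End.iSup_maxGenEigenspace_eq_top
      (Matrix.toLin' (A.map Complex.ofReal))]
    refine iSup_le fun z => ?_
    by_cases hz : z ∈ complexEigenvalues A
    · rw [hu] at hz
      rcases hz with hz | hz
      · exact le_sup_of_le_left (le_iSup₂_of_le z hz le_rfl)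
      · exact le_sup_of_le_right (le_iSup₂_of_le z hz le_rfl)
    · rw [maxGenEigenspace_eq_bot hz]
      exact bot_le
  refine ⟨?_, ?_⟩
  · rw [Submodule.disjoint_def]
    intro v hv hv'
    have h0 := Submodule.disjoint_def.1 hdis _ (mem_realEigenspaceSum.1 hv)
      (mem_realEigenspaceSum.1 hv')
    funext i
    simpa using congrFun h0 i
  · rw [codisjoint_iff, eq_top_iff]
    intro v _
    have hv : (fun i => (v i : ℂ)) ∈ genEigenspaceSum A Z ⊔ genEigenspaceSum A Z' := by
      rw [htop]
      trivial
    obtain ⟨x, hx, y, hy, hxy⟩ := Submodule.mem_sup.1 hv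
    -- The real part is half the sum of x and its conjugate, and both lie in the complex subspace.
    have key : ∀ {W : Set ℂ}, (∀ z ∈ W, star z ∈ W) → ∀ {x : Fin d → ℂ},
        x ∈ genEigenspaceSum A W → (fun i => (x i).re) ∈ realEigenspaceSum A W := by
      intro W hW x hx
      rw [mem_realEigenspaceSum]
      have := Submodule.smul_mem _ (1 / 2 : ℂ) (add_mem hx (star_mem_genEigenspaceSum hW hx))
      convert this using 1
      funext i
      simp [Complex.add_conj]
    refine Submodule.mem_sup.2 ⟨_, key hZ hx, _, key hZ' hy, ?_⟩
    funext i
    have := congrArg Complex.re (congrFun hxy i)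
    simpa using this

end SpectralGrowth

/-! ### The center–stable splitting of a matrix -/

section MatrixSplitting

variable {d : ℕ}

/-- The constants depend on the vector, but only the finitely many columns of S₀ matter for the
operator norm. -/
theorem exists_exp_mul_bound {A S₀ : Matrix (Fin d) (Fin d) ℝ} {T : Set ℝ} {φ : ℝ → ℝ}
    (hφ : ∀ s, 0 ≤ φ s)
    (h : ∀ v : Fin d → ℝ, ∃ C, ∀ s ∈ T, ‖NormedSpace.exp (s • A) *ᵥ (S₀ *ᵥ v)‖ ≤ C * φ s) :
    ∃ K, ∀ s ∈ T, ‖NormedSpace.exp (s • A) * S₀‖ ≤ K * φ s := by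
  obtain ⟨c, hc, hcM⟩ := exists_norm_le_of_entries_le (m := Fin d) (n := Fin d)
  choose C hC using fun j : Fin d => h (Pi.single j 1)
  refine ⟨c * ∑ j, |C j|, fun s hs => ?_⟩
  rw [mul_assoc]
  refine hcM _ _ (fun i j => ?_) (mul_nonneg (Finset.sum_nonneg fun j _ => abs_nonneg _) (hφ s))
  have h1 := (norm_le_pi_norm _ i).trans (hC j s hs)
  rw [Matrix.mulVec_mulVec, Matrix.mulVec_single_one, Matrix.col_apply, Real.norm_eq_abs] at h1
  refine h1.trans (mul_le_mul_of_nonneg_right ((le_abs_self _).trans ?_) (hφ s))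
  exact Finset.single_le_sum (f := fun j => |C j|) (fun j _ => abs_nonneg _) (Finset.mem_univ j)

/-- The columns of N and N' are bases of the two subspaces, and L, L' are the coordinates in them; N
L and N' L' are the complementary projections. -/
theorem exists_matrix_isCompl {W W' : Submodule ℝ (Fin d → ℝ)} (h : IsCompl W W') {e e' : ℕ}
    (he : Module.finrank ℝ W = e) (he' : Module.finrank ℝ W' = e') :
    ∃ (N : Matrix (Fin d) (Fin e) ℝ) (L : Matrix (Fin e) (Fin d) ℝ)
      (N' : Matrix (Fin d) (Fin e') ℝ) (L' : Matrix (Fin e') (Fin d) ℝ),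
      L * N = 1 ∧ L' * N' = 1 ∧ L * N' = 0 ∧ L' * N = 0 ∧ N * L + N' * L' = 1 ∧
      (∀ v, N *ᵥ v ∈ W) ∧ (∀ v, N' *ᵥ v ∈ W') ∧ (∀ v ∈ W', L *ᵥ v = 0) ∧
      (∀ v ∈ W, L' *ᵥ v = 0) := by
  let bc := (Module.finBasisOfFinrankEq ℝ W he).equivFun
  let bs := (Module.finBasisOfFinrankEq ℝ W' he').equivFun
  let Φ := Submodule.prodEquivOfIsCompl W W' h
  let n : (Fin e → ℝ) →ₗ[ℝ] (Fin d → ℝ) := W.subtype ∘ₗ bc.symm.toLinearMap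
  let n' : (Fin e' → ℝ) →ₗ[ℝ] (Fin d → ℝ) := W'.subtype ∘ₗ bs.symm.toLinearMap
  let l : (Fin d → ℝ) →ₗ[ℝ] (Fin e → ℝ) :=
    bc.toLinearMap ∘ₗ LinearMap.fst ℝ W W' ∘ₗ Φ.symm.toLinearMap
  let l' : (Fin d → ℝ) →ₗ[ℝ] (Fin e' → ℝ) :=
    bs.toLinearMap ∘ₗ LinearMap.snd ℝ W W' ∘ₗ Φ.symm.toLinearMap
  have hΦ : ∀ w : W, Φ.symm (w : Fin d → ℝ) = (w, 0) :=
    Submodule.prodEquivOfIsCompl_symm_apply_left W W' h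
  have hΦ' : ∀ w : W', Φ.symm (w : Fin d → ℝ) = (0, w) :=
    Submodule.prodEquivOfIsCompl_symm_apply_right W W' h
  have h1 : l ∘ₗ n = LinearMap.id := LinearMap.ext fun v => by simp [l, n, hΦ]
  have h2 : l' ∘ₗ n' = LinearMap.id := LinearMap.ext fun v => by simp [l', n', hΦ']
  have h3 : l ∘ₗ n' = 0 := LinearMap.ext fun v => by simp [l, n', hΦ']
  have h4 : l' ∘ₗ n = 0 := LinearMap.ext fun v => by simp [l', n, hΦ]
  have h5 : n ∘ₗ l + n' ∘ₗ l' = LinearMap.id := LinearMap.ext fun v => by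
    have hv : ((Φ.symm v).1 : Fin d → ℝ) + (Φ.symm v).2 = v := Φ.apply_symm_apply v
    simpa [l', n', l, n] using hv
  refine ⟨LinearMap.toMatrix' n, LinearMap.toMatrix' l, LinearMap.toMatrix' n',
    LinearMap.toMatrix' l', ?_, ?_, ?_, ?_, ?_, fun v => ?_, fun v => ?_, fun v hv => ?_,
    fun v hv => ?_⟩
  · rw [← LinearMap.toMatrix'_comp, h1, LinearMap.toMatrix'_id]
  · rw [← LinearMap.toMatrix'_comp, h2, LinearMap.toMatrix'_id]
  · rw [← LinearMap.toMatrix'_comp, h3, map_zero]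
  · rw [← LinearMap.toMatrix'_comp, h4, map_zero]
  · rw [← LinearMap.toMatrix'_comp, ← LinearMap.toMatrix'_comp, ← map_add, h5,
      LinearMap.toMatrix'_id]
  · rw [LinearMap.toMatrix'_mulVec]
    exact (bc.symm v).2
  · rw [LinearMap.toMatrix'_mulVec]
    exact (bs.symm v).2
  · rw [LinearMap.toMatrix'_mulVec]
    simpa [l] using congrArg Prod.fst (hΦ' ⟨v, hv⟩)
  · rw [LinearMap.toMatrix'_mulVec]
    simpa [l'] using congrArg Prod.snd (hΦ ⟨v, hv⟩)

theorem exists_isExponentialSplitting {A : Matrix (Fin d) (Fin d) ℝ}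
    (hspec : complexEigenvalues A = centerEigenvalues A ∪ stableEigenvalues A) {α β : ℝ}
    (hα : 0 < α) (hαβ : α < β) (hβ : ∀ z ∈ stableEigenvalues A, z.re < -β) :
    ∃ (N : Matrix (Fin d) (Fin (centerDim A)) ℝ) (L : Matrix (Fin (centerDim A)) (Fin d) ℝ)
      (N' : Matrix (Fin d) (Fin (d - centerDim A)) ℝ)
      (L' : Matrix (Fin (d - centerDim A)) (Fin d) ℝ) (K a b : ℝ),
      L * N = 1 ∧ L' * N' = 1 ∧ L * N' = 0 ∧ L' * N = 0 ∧ N * L + N' * L' = 1 ∧ a < α ∧ β < b ∧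
      IsExponentialSplitting A (N * L) (fun s => NormedSpace.exp (s • A)) K a b := by
  have hdisj : Disjoint (centerEigenvalues A) (stableEigenvalues A) := by
    rw [Set.disjoint_left]
    rintro z ⟨-, h1⟩ ⟨-, h2⟩
    exact h2.ne h1
  have hcompl : IsCompl (centerSubspace A) (realEigenspaceSum A (stableEigenvalues A)) :=
    isCompl_realEigenspaceSum hspec hdisj
      (fun z hz => ⟨star_mem_complexEigenvalues hz.1, by simpa using hz.2⟩)
      (fun z hz => ⟨star_mem_complexEigenvalues hz.1, by simpa using hz.2⟩)
  set W := centerSubspace A with hW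
  set W' := realEigenspaceSum A (stableEigenvalues A) with hW'
  have hdim : Module.finrank ℝ W' = d - centerDim A := by
    have := Submodule.finrank_add_eq_of_isCompl hcompl
    rw [Module.finrank_fin_fun] at this
    have hc : centerDim A = Module.finrank ℝ W := rfl
    omega
  obtain ⟨N, L, N', L', h1, h2, h3, h4, h5, hN, hN', hL, hL'⟩ :=
    exists_matrix_isCompl (e := centerDim A) hcompl rfl hdim
  have hQ : 1 - N * L = N' * L' := by rw [← h5, add_sub_cancel_left]
  -- There are finitely many eigenvalues, so the strict inequality with β survives a small increase.
  -- Half of b - β goes into γ; the other half leaves the rate (β + b)/2 strictly above β. On the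
  -- center part the rate is α/2.
  obtain ⟨b, hb, hbz⟩ : ∃ b, β < b ∧ ∀ z ∈ stableEigenvalues A, z.re < -b := by
    have hfin : (stableEigenvalues A).Finite :=
      (Module.End.finite_hasEigenvalue (Matrix.toLin' (A.map Complex.ofReal))).subset
        fun z hz => hz.1
    have hev : ∀ᶠ b in 𝓝[>] β, ∀ z ∈ stableEigenvalues A, z.re < -b := by
      rw [Set.Finite.eventually_all hfin]
      intro z hz
      have : Filter.Tendsto (fun b : ℝ => -b) (𝓝[>] β) (𝓝 (-β)) :=
        (continuous_neg.tendsto β).mono_left nhdsWithin_le_nhds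
      exact this.eventually (lt_mem_nhds (hβ z hz))
    obtain ⟨b, hb1, hb2⟩ := (hev.and self_mem_nhdsWithin).exists
    exact ⟨b, hb2, hb1⟩
  obtain ⟨γ, hγ, hγz⟩ : ∃ γ > 0, ∀ z ∈ stableEigenvalues A, z.re + γ ≤ -((β + b) / 2) :=
    ⟨(b - β) / 2, by linarith, fun z hz => by linarith [hbz z hz]⟩
  -- Both subspaces are invariant under A, so the mixed blocks L A N' and L' A N vanish.
  have hcommA : N * L * A = A * (N * L) := by
    have hinv : ∀ v ∈ W, A *ᵥ v ∈ W := fun v hv => mulVec_mem_realEigenspaceSum hv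
    have hinv' : ∀ v ∈ W', A *ᵥ v ∈ W' := fun v hv => mulVec_mem_realEigenspaceSum hv
    have e1 : L * A * N' = 0 := by
      refine Matrix.mulVec_injective (funext fun v => ?_)
      simp only [← Matrix.mulVec_mulVec]
      rw [hL _ (hinv' _ (hN' v)), Matrix.zero_mulVec]
    have e2 : L' * A * N = 0 := by
      refine Matrix.mulVec_injective (funext fun v => ?_)
      simp only [← Matrix.mulVec_mulVec]
      rw [hL' _ (hinv _ (hN v)), Matrix.zero_mulVec]
    have e3 : N * L * A = N * L * A * (N * L) := by
      conv_lhs => rw [← mul_one (N * L * A), ← h5]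
      have : N * L * A * (N' * L') = N * (L * A * N') * L' := by simp only [Matrix.mul_assoc]
      rw [mul_add, this, e1]
      simp
    have e4 : A * (N * L) = N * L * A * (N * L) := by
      conv_lhs => rw [← one_mul (A * (N * L)), ← h5]
      have : N' * L' * (A * (N * L)) = N' * (L' * A * N) * L := by simp only [Matrix.mul_assoc]
      rw [add_mul, this, e2]
      simp [Matrix.mul_assoc]
    rw [e3, ← e4]
  have hcomm : ∀ s : ℝ, Commute (s • A) A := fun s => (Commute.refl A).smul_left s
  obtain ⟨K₁, hK₁⟩ := exists_exp_mul_bound (A := A) (S₀ := N * L) (T := univ)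
    (φ := fun s => Real.exp (α / 2 * |s|)) (fun s => Real.exp_nonneg _) (fun v => by
      rw [← Matrix.mulVec_mulVec]
      refine exp_growth_of_mem_realEigenspaceSum (Z := centerEigenvalues A) (γ := α / 2)
        (by positivity) (fun z hz s _ => ?_) (hN (L *ᵥ v))
      rw [hz.2]
      simp)
  obtain ⟨K₂, hK₂⟩ := exists_exp_mul_bound (A := A) (S₀ := N' * L') (T := Ici 0)
    (φ := fun s => Real.exp (-((β + b) / 2) * s)) (fun s => Real.exp_nonneg _) (fun v => by
      rw [← Matrix.mulVec_mulVec]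
      refine exp_growth_of_mem_realEigenspaceSum (Z := stableEigenvalues A) hγ
        (fun z hz s hs => ?_) (hN' (L' *ᵥ v))
      rw [abs_of_nonneg hs]
      have := mul_le_mul_of_nonneg_right (hγz z hz) hs
      exact Real.exp_le_exp.2 (by linarith))
  refine ⟨N, L, N', L', max K₁ K₂, α / 2, (β + b) / 2, h1, h2, h3, h4, h5, by linarith,
    by linarith, ?_⟩
  exact
    { deriv := fun s => hasDerivAt_exp_smul_const' A s
      comm := fun s => ((hcomm s).exp_left).eq
      comm_gen := hcommA
      zero := by simp
      add := fun s t => by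
        let _ : NormedAlgebra ℚ (Matrix (Fin d) (Fin d) ℝ) := NormedAlgebra.restrictScalars ℚ ℝ _
        rw [add_smul, NormedSpace.exp_add_of_commute (((hcomm s).smul_right t))]
      idem := by rw [Matrix.mul_assoc, ← Matrix.mul_assoc L, h1, Matrix.one_mul]
      comm_proj := fun s => by
        have : Commute (N * L) (s • A) := Commute.smul_right hcommA s
        exact this.exp_right.eq
      rate_lt := by linarith
      bound_center := fun s => (hK₁ s (mem_univ _)).trans
        (mul_le_mul_of_nonneg_right (le_max_left _ _) (Real.exp_nonneg _))
      bound_stable := fun s hs => by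
        rw [hQ]
        exact (hK₂ s hs).trans
          (mul_le_mul_of_nonneg_right (le_max_right _ _) (Real.exp_nonneg _)) }

end MatrixSplitting

/-! ### Calculus and operator norms of matrix functions -/

section InverseDerivative

theorem hasDerivAt_of_isInverse {R : Type*} [NormedRing R] [NormedAlgebra ℝ R] [CompleteSpace R]
    {σ ρ : ℝ → R} {σ' : R} {s : ℝ} (h1 : ∀ s, ρ s * σ s = 1) (h2 : ∀ s, σ s * ρ s = 1)
    (hσ : HasDerivAt σ σ' s) : HasDerivAt ρ (-(ρ s * σ' * ρ s)) s := by
  let x : Rˣ := ⟨σ s, ρ s, h2 s, h1 s⟩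
  have hρ : ρ = fun s => Ring.inverse (σ s) := by
    funext t
    let y : Rˣ := ⟨σ t, ρ t, h2 t, h1 t⟩
    exact (Ring.inverse_unit y).symm
  have h := (hasFDerivAt_ringInverse (𝕜 := ℝ) x).comp_hasDerivAt_of_eq s hσ rfl
  rw [hρ]
  refine h.congr_deriv ?_
  have e : Ring.inverse (σ s) = ρ s := (congrFun hρ s).symm
  simp only [e]
  rfl

end InverseDerivative

section MatrixCalculus

set_option linter.unusedSectionVars false

variable {k m n : Type*} [Fintype k] [Fintype m] [Fintype n] [DecidableEq k] [DecidableEq m]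
  [DecidableEq n]

/-- Matrix multiplication as a continuous bilinear map. -/
def matrixMulCLM (k m n : Type*) [Fintype k] [Fintype m] [Fintype n] [DecidableEq k]
    [DecidableEq m] [DecidableEq n] :
    Matrix k m ℝ →L[ℝ] Matrix m n ℝ →L[ℝ] Matrix k n ℝ :=
  LinearMap.mkContinuous₂
    (LinearMap.mk₂ ℝ (fun A B => A * B) Matrix.add_mul (fun c A B => Matrix.smul_mul c A B)
      Matrix.mul_add (fun c A B => Matrix.mul_smul A c B)) 1
    (fun A B => by
      rw [one_mul]
      exact Matrix.l2_opNorm_mul A B)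

theorem HasDerivAt.matrixMul {x : ℝ → Matrix k m ℝ} {y : ℝ → Matrix m n ℝ} {x' : Matrix k m ℝ}
    {y' : Matrix m n ℝ} {s : ℝ} (hx : HasDerivAt x x' s) (hy : HasDerivAt y y' s) :
    HasDerivAt (fun s => x s * y s) (x' * y s + x s * y') s :=
  ((matrixMulCLM k m n).hasDerivAt_of_bilinear (fun _ => hx) fun _ => hy).congr_deriv
    (add_comm _ _)

theorem HasDerivAt.matrixMul_const {x : ℝ → Matrix k m ℝ} {x' : Matrix k m ℝ} {s : ℝ}
    (hx : HasDerivAt x x' s) (B : Matrix m n ℝ) : HasDerivAt (fun s => x s * B) (x' * B) s :=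
  (hx.matrixMul (hasDerivAt_const s B)).congr_deriv (by simp)

theorem HasDerivAt.const_matrixMul {y : ℝ → Matrix m n ℝ} {y' : Matrix m n ℝ} {s : ℝ}
    (A : Matrix k m ℝ) (hy : HasDerivAt y y' s) : HasDerivAt (fun s => A * y s) (A * y') s :=
  ((hasDerivAt_const s A).matrixMul hy).congr_deriv (by simp)

theorem HasDerivAt.matrixTranspose {x : ℝ → Matrix k m ℝ} {x' : Matrix k m ℝ} {s : ℝ}
    (hx : HasDerivAt x x' s) : HasDerivAt (fun s => (x s)ᵀ) x'ᵀ s :=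
  (LinearMap.toContinuousLinearMap
    (Matrix.transposeLinearEquiv k m ℝ ℝ).toLinearMap).hasFDerivAt.comp_hasDerivAt s hx

theorem HasDerivAt.matrixMulVec {x : ℝ → Matrix k m ℝ} {y : ℝ → m → ℝ} {x' : Matrix k m ℝ}
    {y' : m → ℝ} {s : ℝ} (hx : HasDerivAt x x' s) (hy : HasDerivAt y y' s) :
    HasDerivAt (fun s => x s *ᵥ y s) (x' *ᵥ y s + x s *ᵥ y') s := by
  rw [hasDerivAt_pi]
  intro i
  have h : ∀ j, HasDerivAt (fun s => x s i j * y s j) (x' i j * y s j + x s i j * y' j) s :=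
    fun j => ((matrixEntryCLM i j).hasFDerivAt.comp_hasDerivAt s hx).mul (hasDerivAt_pi.1 hy j)
  refine (HasDerivAt.fun_sum fun j _ => h j).congr_deriv ?_
  simp [Matrix.mulVec, dotProduct, Finset.sum_add_distrib]

theorem l2_opNorm_transpose (A : Matrix m n ℝ) : ‖Aᵀ‖ = ‖A‖ := by
  rw [← Matrix.conjTranspose_eq_transpose_of_trivial, Matrix.l2_opNorm_conjTranspose]

theorem l2_opNorm_one_le : ‖(1 : Matrix n n ℝ)‖ ≤ 1 := by
  rw [← Matrix.diagonal_one, Matrix.l2_opNorm_diagonal]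
  exact (pi_norm_le_iff_of_nonneg zero_le_one).2 fun i => by simp

/-- By the C*-identity ‖U‖² = ‖Uᵀ U‖. Only an inequality holds in general, since the identity of
size 0 has norm 0. -/
theorem norm_le_one_of_transpose_mul_self {U : Matrix n m ℝ} (h : Uᵀ * U = 1) : ‖U‖ ≤ 1 := by
  have h1 := Matrix.l2_opNorm_conjTranspose_mul_self U
  rw [Matrix.conjTranspose_eq_transpose_of_trivial, h] at h1
  have h2 := l2_opNorm_one_le (n := m)
  nlinarith [norm_nonneg U]

end MatrixCalculus

/-! ### Invariant subbundles, orthogonal projections and orthonormal frames -/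

section InvariantFrame

set_option linter.unusedSectionVars false

variable {P : Type*} [TopologicalSpace P] {m n : Type*} [Fintype m] [Fintype n]
  [DecidableEq m] [DecidableEq n]

/-- `F` is a continuous frame, with left inverse `L`, of an invariant subbundle of
`x' = l(S_s p) x`; in this frame the system reads `z' = D(S_s p) z`. -/
structure IsInvariantFrame (S : Flow ℝ P) (l : P → Matrix n n ℝ) (F : P → Matrix n m ℝ)
    (L : P → Matrix m n ℝ) (D : P → Matrix m m ℝ) : Prop where
  continuous_frame : Continuous F
  left_inv : ∀ p, L p * F p = 1
  deriv : ∀ p s, HasDerivAt (fun s => F (S s p))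
    (l (S s p) * F (S s p) - F (S s p) * D (S s p)) s

theorem posDef_transpose_mul_self {F : Matrix n m ℝ} {L : Matrix m n ℝ} (h : L * F = 1) :
    (Fᵀ * F).PosDef := by
  rw [← Matrix.conjTranspose_eq_transpose_of_trivial]
  refine Matrix.PosDef.conjTranspose_mul_self F fun v w hvw => ?_
  have := congrArg (L *ᵥ ·) hvw
  simpa [h] using this

open scoped MatrixOrder in
theorem Matrix.PosDef.exists_isUnit_transpose_mul_self {M : Matrix m m ℝ} (h : M.PosDef) :
    ∃ B : Matrix m m ℝ, IsUnit B ∧ Bᵀ * B = M := by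
  obtain ⟨y, hy, rfl⟩ :=
    CStarAlgebra.isStrictlyPositive_iff_eq_star_mul_self.mp h.isStrictlyPositive
  exact ⟨y, hy, by rw [Matrix.star_eq_conjTranspose, Matrix.conjTranspose_eq_transpose_of_trivial]⟩

/-- The orthogonal projection onto the range of an injective matrix. -/
def rangeProjection (F : Matrix n m ℝ) : Matrix n n ℝ := F * ((Fᵀ * F)⁻¹ * Fᵀ)

theorem rangeProjection_transpose (F : Matrix n m ℝ) :
    (rangeProjection F)ᵀ = rangeProjection F := by
  simp [rangeProjection, Matrix.transpose_mul, Matrix.transpose_nonsing_inv, Matrix.mul_assoc]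

theorem rangeProjection_mul {F : Matrix n m ℝ} {L : Matrix m n ℝ} (h : L * F = 1) :
    rangeProjection F * F = F := by
  have hu := (Matrix.isUnit_iff_isUnit_det _).1 (posDef_transpose_mul_self h).isUnit
  rw [rangeProjection, Matrix.mul_assoc, Matrix.mul_assoc, Matrix.nonsing_inv_mul _ hu,
    Matrix.mul_one]

theorem rangeProjection_idem {F : Matrix n m ℝ} {L : Matrix m n ℝ} (h : L * F = 1) :
    rangeProjection F * rangeProjection F = rangeProjection F := by
  have e : rangeProjection F * (F * ((Fᵀ * F)⁻¹ * Fᵀ)) = F * ((Fᵀ * F)⁻¹ * Fᵀ) := by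
    rw [← Matrix.mul_assoc, rangeProjection_mul h]
  exact e

theorem mul_mul_rangeProjection {F : Matrix n m ℝ} {L : Matrix m n ℝ} (h : L * F = 1) :
    F * (L * rangeProjection F) = rangeProjection F := by
  rw [rangeProjection, ← Matrix.mul_assoc L, h, Matrix.one_mul]

/-- An orthonormal frame of the range of `F`. -/
def IsOrthonormalFrame (F U : Matrix n m ℝ) : Prop := Uᵀ * U = 1 ∧ rangeProjection F * U = U

/-- Any factorization Bᵀ B of the Gram matrix Fᵀ F makes F B⁻¹ orthonormal. No continuity in F is
claimed: this only shows that the frame bundle is nonempty. -/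
theorem exists_isOrthonormalFrame {F : Matrix n m ℝ} {L : Matrix m n ℝ} (h : L * F = 1) :
    ∃ U : Matrix n m ℝ, IsOrthonormalFrame F U := by
  obtain ⟨B, hB, hBM⟩ := (posDef_transpose_mul_self h).exists_isUnit_transpose_mul_self
  have hBd := (Matrix.isUnit_iff_isUnit_det _).1 hB
  refine ⟨F * B⁻¹, ?_, ?_⟩
  · have e : (F * B⁻¹)ᵀ * (F * B⁻¹) = B⁻¹ᵀ * (Fᵀ * F) * B⁻¹ := by
      rw [Matrix.transpose_mul]
      simp only [Matrix.mul_assoc]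
    have e2 : B⁻¹ᵀ * Bᵀ = 1 := by
      rw [← Matrix.transpose_mul, Matrix.mul_nonsing_inv _ hBd, Matrix.transpose_one]
    rw [e, ← hBM, ← Matrix.mul_assoc, e2, Matrix.one_mul, Matrix.mul_nonsing_inv _ hBd]
  · rw [← Matrix.mul_assoc, rangeProjection_mul h]

namespace IsOrthonormalFrame

variable {F U : Matrix n m ℝ} {L : Matrix m n ℝ} (hU : IsOrthonormalFrame F U) (h : L * F = 1)

include hU

theorem norm_le_one : ‖U‖ ≤ 1 := norm_le_one_of_transpose_mul_self hU.1

include h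

theorem mul_mul_self : F * (L * U) = U := by
  conv_lhs => rw [← hU.2]
  rw [← Matrix.mul_assoc L, ← Matrix.mul_assoc F, mul_mul_rangeProjection h, hU.2]

/-- Uᵀ F and L U are square of the same size, so a one-sided inverse is two-sided. Thus U spans the
whole range of F, not merely a part of it. -/
theorem self_mul_transpose_mul : U * (Uᵀ * F) = F := by
  have h1 : Uᵀ * F * (L * U) = 1 := by rw [Matrix.mul_assoc, hU.mul_mul_self h, hU.1]
  have h2 : L * U * (Uᵀ * F) = 1 := mul_eq_one_comm.1 h1
  calc U * (Uᵀ * F) = F * (L * U) * (Uᵀ * F) := by rw [hU.mul_mul_self h]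
    _ = F := by rw [Matrix.mul_assoc, h2, Matrix.mul_one]

theorem self_mul_transpose : U * Uᵀ = rangeProjection F := by
  have h1 : U * Uᵀ * rangeProjection F = rangeProjection F := by
    calc U * Uᵀ * rangeProjection F = U * Uᵀ * (F * (L * rangeProjection F)) := by
          rw [mul_mul_rangeProjection h]
      _ = U * (Uᵀ * F) * (L * rangeProjection F) := by simp only [Matrix.mul_assoc]
      _ = rangeProjection F := by
          rw [hU.self_mul_transpose_mul h, mul_mul_rangeProjection h]
  have h2 := congrArg Matrix.transpose h1
  rw [Matrix.transpose_mul, Matrix.transpose_mul, Matrix.transpose_transpose,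
    rangeProjection_transpose, ← Matrix.mul_assoc, hU.2] at h2
  exact h2

end IsOrthonormalFrame

theorem continuous_matrix_inv {X : Type*} [TopologicalSpace X] {M : X → Matrix m m ℝ}
    (hM : Continuous M) (hu : ∀ x, IsUnit (M x)) : Continuous fun x => (M x)⁻¹ := by
  refine continuous_iff_continuousAt.2 fun x => ?_
  obtain ⟨v, hv⟩ := hu x
  have h := NormedRing.inverse_continuousAt v
  rw [hv] at h
  simp only [Matrix.nonsing_inv_eq_ringInverse]
  exact h.comp hM.continuousAt

/-- The generator of the parallel transport along an invariant subbundle with orthogonal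
projection `Q`. -/
def transportGenerator (l Q : Matrix n n ℝ) : Matrix n n ℝ :=
  (1 - Q) * l * Q - Q * lᵀ * (1 - Q)

theorem transportGenerator_transpose {l Q : Matrix n n ℝ} (h : Qᵀ = Q) :
    (transportGenerator l Q)ᵀ = -transportGenerator l Q := by
  simp only [transportGenerator, Matrix.transpose_sub, Matrix.transpose_mul, h,
    Matrix.transpose_one, Matrix.transpose_transpose]
  noncomm_ring

/-- The generator K is Kato's commutator Q'Q - QQ', where Q' = (1 - Q) l Q + Q lᵀ (1 - Q) is the
derivative of the moving projection. The identity KQ - QK = Q' makes the transport carry ranges to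
ranges, and skew-symmetry makes it orthogonal. -/
theorem transportGenerator_commutator {l Q : Matrix n n ℝ} (h : Q * Q = Q) :
    transportGenerator l Q * Q - Q * transportGenerator l Q =
      (1 - Q) * l * Q + Q * lᵀ * (1 - Q) := by
  have h1 : (1 - Q) * Q = 0 := by rw [sub_mul, h, one_mul, sub_self]
  have h2 : Q * (1 - Q) = 0 := by rw [mul_sub, h, mul_one, sub_self]
  rw [transportGenerator]
  generalize 1 - Q = C at *
  calc _ = C * l * (Q * Q) - Q * lᵀ * (C * Q) - Q * C * l * Q + Q * Q * lᵀ * C := by noncomm_ring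
    _ = _ := by simp [h, h1, h2]

namespace IsInvariantFrame

variable {S : Flow ℝ P} {l : P → Matrix n n ℝ} {F : P → Matrix n m ℝ} {L : P → Matrix m n ℝ}
  {D : P → Matrix m m ℝ} (hF : IsInvariantFrame S l F L D)

include hF

theorem continuous_rangeProjection : Continuous fun p => rangeProjection (F p) := by
  have h1 := hF.continuous_frame
  have h2 := continuous_matrix_inv (M := fun p => (F p)ᵀ * F p) (by fun_prop)
    (fun p => (posDef_transpose_mul_self (hF.left_inv p)).isUnit)
  unfold rangeProjection
  fun_prop

/-- Differentiating Q F = F gives Q'Q = (1 - Q) l Q, where the frame coefficient D drops out.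
Symmetry of Q gives QQ' by transposition, and idempotence gives Q' = Q'Q + QQ'. -/
theorem hasDerivAt_rangeProjection (p : P) (s : ℝ) :
    HasDerivAt (fun s => rangeProjection (F (S s p)))
      ((1 - rangeProjection (F (S s p))) * l (S s p) * rangeProjection (F (S s p)) +
        rangeProjection (F (S s p)) * (l (S s p))ᵀ * (1 - rangeProjection (F (S s p)))) s := by
  have hd := hF.deriv p s
  obtain ⟨Q', hQ'⟩ : ∃ Q', HasDerivAt (fun s => rangeProjection (F (S s p))) Q' s := by
    have hu : ∀ s, IsUnit ((F (S s p))ᵀ * F (S s p)).det := fun s =>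
      (Matrix.isUnit_iff_isUnit_det _).1 (posDef_transpose_mul_self (hF.left_inv (S s p))).isUnit
    have hG := hasDerivAt_of_isInverse (ρ := fun s => ((F (S s p))ᵀ * F (S s p))⁻¹)
      (fun s => Matrix.nonsing_inv_mul _ (hu s)) (fun s => Matrix.mul_nonsing_inv _ (hu s))
      (hd.matrixTranspose.matrixMul hd)
    exact ⟨_, hd.matrixMul (hG.matrixMul hd.matrixTranspose)⟩
  set Q := rangeProjection (F (S s p)) with hQ
  have hF0 := fun s => hF.left_inv (S s p)
  have hQF : Q * F (S s p) = F (S s p) := rangeProjection_mul (hF0 s)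
  have e1 : Q' * F (S s p) = (1 - Q) * l (S s p) * F (S s p) := by
    have h1 := hQ'.matrixMul hd
    have h2 : (fun s => rangeProjection (F (S s p)) * F (S s p)) = fun s => F (S s p) :=
      funext fun s => rangeProjection_mul (hF0 s)
    rw [h2] at h1
    have h3 := h1.unique hd
    rw [← hQ, Matrix.mul_sub, ← Matrix.mul_assoc Q (F _), hQF] at h3
    rw [eq_sub_of_add_eq h3, Matrix.sub_mul, Matrix.sub_mul, Matrix.one_mul, Matrix.mul_assoc]
    abel
  have e2 : Q' * Q = (1 - Q) * l (S s p) * Q := by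
    have h1 : F (S s p) * (L (S s p) * Q) = Q := mul_mul_rangeProjection (hF0 s)
    calc Q' * Q = Q' * F (S s p) * (L (S s p) * Q) := by rw [Matrix.mul_assoc, h1]
      _ = _ := by rw [e1, Matrix.mul_assoc, h1]
  have e3 : Q'ᵀ = Q' := by
    have h1 := hQ'.matrixTranspose
    simp only [rangeProjection_transpose] at h1
    exact h1.unique hQ'
  have e4 : Q * Q' = Q * (l (S s p))ᵀ * (1 - Q) := by
    have h1 := congrArg Matrix.transpose e2
    simpa [Matrix.transpose_mul, e3, rangeProjection_transpose, hQ, Matrix.mul_assoc] using h1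
  have e5 : Q' = Q' * Q + Q * Q' := by
    have h1 := hQ'.matrixMul hQ'
    have h2 : (fun s => rangeProjection (F (S s p)) * rangeProjection (F (S s p))) =
        fun s => rangeProjection (F (S s p)) := funext fun s => rangeProjection_idem (hF0 s)
    rw [h2] at h1
    exact hQ'.unique h1
  rw [e2, e4] at e5
  rwa [e5] at hQ'

end IsInvariantFrame

end InvariantFrame

/-! ### Parallel transport of orthonormal frames -/

section ParallelTransport

set_option linter.unusedSectionVars false

variable {P : Type*} [TopologicalSpace P] [CompactSpace P] {m n : Type*} [Fintype m] [Fintype n]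
  [DecidableEq m] [DecidableEq n]

theorem exists_pos_norm_le {R : Type*} [NormedAddCommGroup R] {K : P → R} (hK : Continuous K) :
    ∃ c, 0 < c ∧ ∀ p, ‖K p‖ ≤ c := by
  obtain ⟨c, hc⟩ := isCompact_univ.exists_bound_of_continuousOn hK.continuousOn
  exact ⟨max c 1, by positivity, fun p => (hc p (mem_univ p)).trans (le_max_left _ _)⟩

/-- The transport is orthogonal and intertwines the projections, so it preserves orthonormal frames
of the subbundle. Since Q Y = Y for a transported frame Y, the generator acts as K Y = (1 - Q) l Y =
l Y - Y (Yᵀ l Y): the coefficient in the frame is exactly the compression of l. -/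
theorem IsInvariantFrame.exists_parallelTransport {S : Flow ℝ P} {l : P → Matrix n n ℝ}
    {F : P → Matrix n m ℝ} {L : P → Matrix m n ℝ} {D : P → Matrix m m ℝ}
    (hF : IsInvariantFrame S l F L D) (hl : Continuous l) :
    ∃ Ψ : P → ℝ → Matrix n n ℝ, Continuous (fun z : P × ℝ => Ψ z.1 z.2) ∧ (∀ p, Ψ p 0 = 1) ∧
      (∀ p s t, Ψ p (t + s) = Ψ (S s p) t * Ψ p s) ∧
      ∀ p U, IsOrthonormalFrame (F p) U → ∀ s,
        IsOrthonormalFrame (F (S s p)) (Ψ p s * U) ∧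
        HasDerivAt (fun s => Ψ p s * U) (l (S s p) * (Ψ p s * U) -
          Ψ p s * U * ((Ψ p s * U)ᵀ * l (S s p) * (Ψ p s * U))) s := by
  set K : P → Matrix n n ℝ := fun p => transportGenerator (l p) (rangeProjection (F p)) with hK
  have hKc : Continuous K := by
    have h1 := hF.continuous_rangeProjection
    simp only [hK, transportGenerator]
    fun_prop
  obtain ⟨c, hc, hKle⟩ := exists_pos_norm_le hKc
  have hKskew : ∀ p, (K p)ᵀ = -K p := fun p =>
    transportGenerator_transpose (rangeProjection_transpose _)
  have hd := hasDerivAt_fundamentalCocycle S hKc hc hKle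
  have h0 := fundamentalCocycle_zero S hKc hc hKle
  refine ⟨fundamentalCocycle S K, continuous_fundamentalCocycle S hKc hc hKle, h0,
    fundamentalCocycle_add S hKc hc hKle, fun p U hU => ?_⟩
  have horth : ∀ s, (fundamentalCocycle S K p s)ᵀ * fundamentalCocycle S K p s = 1 := by
    have h : ∀ s, HasDerivAt
        (fun s => (fundamentalCocycle S K p s)ᵀ * fundamentalCocycle S K p s) 0 s := fun s => by
      refine ((hd p s).matrixTranspose.matrixMul (hd p s)).congr_deriv ?_
      rw [Matrix.transpose_mul, hKskew]
      noncomm_ring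
    intro s
    have := is_const_of_deriv_eq_zero (fun s => (h s).differentiableAt) (fun s => (h s).deriv) s 0
    simpa [h0] using this
  -- Both sides solve the linear equation of the cocycle with the same initial value.
  have hcomm : ∀ s, rangeProjection (F (S s p)) * fundamentalCocycle S K p s =
      fundamentalCocycle S K p s * rangeProjection (F p) := fun s => by
    have h := fundamentalCocycle_unique S hKc hc hKle p
      (y := fun s => rangeProjection (F (S s p)) * fundamentalCocycle S K p s) (fun s => by
        refine ((hF.hasDerivAt_rangeProjection p s).matrixMul (hd p s)).congr_deriv ?_
        rw [← transportGenerator_commutator (rangeProjection_idem (hF.left_inv _))]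
        simp only [hK]
        noncomm_ring) s
    simpa [h0] using h
  have hframe : ∀ s, IsOrthonormalFrame (F (S s p)) (fundamentalCocycle S K p s * U) := fun s => by
    refine ⟨?_, ?_⟩
    · rw [Matrix.transpose_mul, Matrix.mul_assoc, ← Matrix.mul_assoc _ _ U, horth,
        Matrix.one_mul, hU.1]
    · rw [← Matrix.mul_assoc, hcomm, Matrix.mul_assoc, hU.2]
  refine fun s => ⟨hframe s, ((hd p s).matrixMul_const U).congr_deriv ?_⟩
  obtain ⟨h1, h2⟩ := hframe s
  have h3 := (hframe s).self_mul_transpose (hF.left_inv _)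
  rw [Matrix.mul_assoc]
  set Y := fundamentalCocycle S K p s * U
  simp only [hK]
  have h4 : (1 - rangeProjection (F (S s p))) * Y = 0 := by
    rw [Matrix.sub_mul, Matrix.one_mul, h2, sub_self]
  calc transportGenerator (l (S s p)) (rangeProjection (F (S s p))) * Y
      = (1 - rangeProjection (F (S s p))) * l (S s p) * (rangeProjection (F (S s p)) * Y) -
        rangeProjection (F (S s p)) * (l (S s p))ᵀ * ((1 - rangeProjection (F (S s p))) * Y) := by
        simp only [transportGenerator, Matrix.sub_mul, Matrix.mul_assoc]
    _ = l (S s p) * Y - Y * Yᵀ * l (S s p) * Y := by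
        rw [h2, h4, Matrix.mul_zero, sub_zero, h3]
        simp only [Matrix.sub_mul, Matrix.one_mul]
    _ = _ := by simp only [Matrix.mul_assoc]

end ParallelTransport

/-! ### Minimal subsets and minimal flows -/

section MinimalSubsets

/-- Zorn's lemma gives a minimal nonempty closed invariant subset. The orbit closure of each of its
points is again such a set, so every orbit is dense. -/
theorem Flow.exists_isMinimalFlow_restrict {X : Type*} [TopologicalSpace X] [T2Space X]
    (T : Flow ℝ X) {s : Set X} (hs : IsCompact s) (hne : s.Nonempty)
    (hinv : IsInvariant T s) :
    ∃ M ⊆ s, IsCompact M ∧ M.Nonempty ∧ ∃ h : IsInvariant T M, IsMinimalFlow (T.restrict h) := by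
  obtain ⟨M, hMs, hM⟩ := zorn_superset_nonempty
    {t : Set X | IsClosed t ∧ t ⊆ s ∧ t.Nonempty ∧ IsInvariant T t} (fun c hc hchain hcne => by
      refine ⟨⋂₀ c, ⟨isClosed_sInter fun t ht => (hc ht).1, ?_, ?_, ?_⟩,
        fun t ht => sInter_subset_of_mem ht⟩
      · obtain ⟨t, ht⟩ := hcne
        exact (sInter_subset_of_mem ht).trans (hc ht).2.1
      · have := hcne.to_subtype
        refine IsCompact.nonempty_sInter_of_directed_nonempty_isCompact_isClosed
          (fun x hx y hy => (hchain.total hx hy).elim (fun h => ⟨x, hx, subset_rfl, h⟩)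
            fun h => ⟨y, hy, h, subset_rfl⟩) ?_ ?_ ?_
        exacts [fun t ht => (hc ht).2.2.1, fun t ht => hs.of_isClosed_subset (hc ht).1 (hc ht).2.1,
          fun t ht => (hc ht).1]
      · exact fun u x hx t ht => (hc ht).2.2.2 u (hx t ht)) s
    ⟨hs.isClosed, subset_rfl, hne, hinv⟩
  have hMp := hM.prop
  refine ⟨M, hMs, hs.of_isClosed_subset hMp.1 hMp.2.1, hMp.2.2.1, hMp.2.2.2, fun x => ?_⟩
  set O := closure (range fun t : ℝ => T t (x : X)) with hO
  have hOM : O ⊆ M := closure_minimal (range_subset_iff.2 fun t => hMp.2.2.2 t x.2) hMp.1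
  have hOinv : IsInvariant T O := fun u => by
    refine MapsTo.closure ?_ (by fun_prop)
    rintro _ ⟨t, rfl⟩
    exact ⟨u + t, by simp [Flow.map_add]⟩
  have hMO : M ⊆ O := hM.le_of_le ⟨isClosed_closure, hOM.trans hMp.2.1,
    ⟨x, subset_closure ⟨0, by simp⟩⟩, hOinv⟩ hOM
  intro y
  rw [closure_subtype, ← range_comp]
  exact hMO y.2

/-- The image is compact and contains a dense orbit. -/
theorem IsMinimalFlow.surjective_of_semiconj {X Y : Type*} [TopologicalSpace X]
    [TopologicalSpace Y] [CompactSpace X] [T2Space Y] [Nonempty X] {T : Flow ℝ X} {S : Flow ℝ Y}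
    (hS : IsMinimalFlow S) {π : X → Y} (hπ : Continuous π) (h : ∀ t x, π (T t x) = S t (π x)) :
    Function.Surjective π := by
  obtain ⟨x⟩ := ‹Nonempty X›
  have h1 : Dense (range π) := (hS (π x)).mono (by
    rintro _ ⟨t, rfl⟩
    exact ⟨T t x, h t x⟩)
  rw [← range_eq_univ, ← (isCompact_range hπ).isClosed.closure_eq, h1.closure_eq]

theorem isMinimalFlow_fastFlow {X : Type*} [TopologicalSpace X] {τ : Flow ℝ X}
    (h : IsMinimalFlow τ) {ε : ℝ} (hε : ε ≠ 0) : IsMinimalFlow (fastFlow τ ε) := fun x => by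
  refine (h x).mono ?_
  rintro _ ⟨t, rfl⟩
  refine ⟨t * |ε|, ?_⟩
  change τ (t * |ε| / |ε|) x = τ t x
  rw [mul_div_cancel_right₀ _ (abs_ne_zero.2 hε)]

end MinimalSubsets

/-! ### Block-diagonal matrices through coordinate inclusions -/

section BlockInclusions

theorem exists_blockDiag_inclusions {d e : ℕ} (he : e ≤ d) :
    ∃ (J₁ : Matrix (Fin e) (Fin d) ℝ) (J₂ : Matrix (Fin (d - e)) (Fin d) ℝ),
      J₁ * J₁ᵀ = 1 ∧ J₂ * J₂ᵀ = 1 ∧ J₁ * J₂ᵀ = 0 ∧ J₂ * J₁ᵀ = 0 ∧ J₁ᵀ * J₁ + J₂ᵀ * J₂ = 1 ∧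
      ∀ a b, blockDiag he a b = J₁ᵀ * a * J₁ + J₂ᵀ * b * J₂ := by
  set v := finSumFinEquiv.trans (finCongr (Nat.add_sub_of_le he)) with hv
  have hadd : ∀ A B : Matrix (Fin e ⊕ Fin (d - e)) (Fin e ⊕ Fin (d - e)) ℝ,
      A.submatrix v.symm v.symm + B.submatrix v.symm v.symm = (A + B).submatrix v.symm v.symm :=
    fun _ _ => rfl
  have hsum : ∀ (a : Matrix (Fin e) (Fin e) ℝ) (b : Matrix (Fin (d - e)) (Fin (d - e)) ℝ),
      (a.fromRows 0).fromCols 0 + Matrix.fromCols 0 (Matrix.fromRows 0 b) =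
        Matrix.fromBlocks a 0 0 b := fun a b => by
    ext (i | i) (j | j) <;> simp
  refine ⟨(Matrix.fromCols 1 0).submatrix id v.symm, (Matrix.fromCols 0 1).submatrix id v.symm,
    ?_, ?_, ?_, ?_, ?_, fun a b => ?_⟩
  · simp [Matrix.transpose_fromCols, Matrix.fromCols_mul_fromRows]
  · simp [Matrix.transpose_fromCols, Matrix.fromCols_mul_fromRows]
  · simp [Matrix.transpose_fromCols, Matrix.fromCols_mul_fromRows]
  · simp [Matrix.transpose_fromCols, Matrix.fromCols_mul_fromRows]
  · rw [Matrix.transpose_submatrix, Matrix.transpose_submatrix,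
      ← Matrix.submatrix_mul _ _ _ _ _ Function.bijective_id,
      ← Matrix.submatrix_mul _ _ _ _ _ Function.bijective_id, hadd]
    simp [Matrix.transpose_fromCols, hsum]
  · rw [Matrix.transpose_submatrix, Matrix.transpose_submatrix,
      ← Matrix.submatrix_id_id a, ← Matrix.submatrix_id_id b,
      ← Matrix.submatrix_mul _ _ _ _ _ Function.bijective_id,
      ← Matrix.submatrix_mul _ _ _ _ _ Function.bijective_id,
      ← Matrix.submatrix_mul _ _ _ _ _ Function.bijective_id,
      ← Matrix.submatrix_mul _ _ _ _ _ Function.bijective_id, hadd]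
    simp [Matrix.transpose_fromCols, Matrix.fromRows_mul, hsum, blockDiag, hv]

end BlockInclusions

/-! ### The minimal extension inside the bundle of pairs of frames -/

section OrthonormalExtension

variable {P : Type u} [MetricSpace P] [CompactSpace P] [Nonempty P] {d e : ℕ}

/-- The skew product flow on pairs of frames that is defined by two cocycles. -/
def frameFlow {n m₁ m₂ : Type*} [Fintype n] [DecidableEq n] [Fintype m₁] [DecidableEq m₁]
    [Fintype m₂] [DecidableEq m₂] (S : Flow ℝ P) (Ψ₁ Ψ₂ : P → ℝ → Matrix n n ℝ)
    (hc₁ : Continuous fun z : P × ℝ => Ψ₁ z.1 z.2) (hc₂ : Continuous fun z : P × ℝ => Ψ₂ z.1 z.2)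
    (h0₁ : ∀ p, Ψ₁ p 0 = 1) (h0₂ : ∀ p, Ψ₂ p 0 = 1)
    (ha₁ : ∀ p s t, Ψ₁ p (t + s) = Ψ₁ (S s p) t * Ψ₁ p s)
    (ha₂ : ∀ p s t, Ψ₂ p (t + s) = Ψ₂ (S s p) t * Ψ₂ p s) :
    Flow ℝ (P × Matrix n m₁ ℝ × Matrix n m₂ ℝ) where
  toFun s x := (S s x.1, Ψ₁ x.1 s * x.2.1, Ψ₂ x.1 s * x.2.2)
  cont' := by
    have h₁ : Continuous fun z : ℝ × P × Matrix n m₁ ℝ × Matrix n m₂ ℝ => Ψ₁ z.2.1 z.1 :=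
      hc₁.comp (f := fun z : ℝ × P × Matrix n m₁ ℝ × Matrix n m₂ ℝ => (z.2.1, z.1)) (by fun_prop)
    have h₂ : Continuous fun z : ℝ × P × Matrix n m₁ ℝ × Matrix n m₂ ℝ => Ψ₂ z.2.1 z.1 :=
      hc₂.comp (f := fun z : ℝ × P × Matrix n m₁ ℝ × Matrix n m₂ ℝ => (z.2.1, z.1)) (by fun_prop)
    refine Continuous.prodMk (by fun_prop) (Continuous.prodMk ?_ ?_)
    · exact Continuous.matrix_mul h₁ (by fun_prop)
    · exact Continuous.matrix_mul h₂ (by fun_prop)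
  map_add' s t x := by
    simp only [Flow.map_add, ha₁, ha₂, Matrix.mul_assoc]
  map_zero' x := by
    simp only [Flow.map_zero_apply, h0₁, h0₂, Matrix.one_mul]

/-- Pairs of orthonormal frames form a closed bounded set, invariant under the skew product of the
two transports. On a minimal subset M the two frames are coordinate functions, hence continuous, and
M projects onto P because S is minimal. -/
theorem exists_orthonormal_extension {n m₁ m₂ : Type} [Fintype n] [DecidableEq n] [Fintype m₁]
    [DecidableEq m₁] [Fintype m₂] [DecidableEq m₂] {S : Flow ℝ P} (hS : IsMinimalFlow S)
    {l : P → Matrix n n ℝ} (hl : Continuous l) {F₁ : P → Matrix n m₁ ℝ} {L₁ : P → Matrix m₁ n ℝ}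
    {D₁ : P → Matrix m₁ m₁ ℝ} {F₂ : P → Matrix n m₂ ℝ} {L₂ : P → Matrix m₂ n ℝ}
    {D₂ : P → Matrix m₂ m₂ ℝ} (h₁ : IsInvariantFrame S l F₁ L₁ D₁)
    (h₂ : IsInvariantFrame S l F₂ L₂ D₂) :
    ∃ (Q : Type u) (_ : MetricSpace Q) (_ : CompactSpace Q) (T : Flow ℝ Q) (π : Q → P)
      (U : Q → Matrix n m₁ ℝ) (V : Q → Matrix n m₂ ℝ),
      IsMinimalFlow T ∧ Flow.IsSemiconjugacy π T S ∧ Continuous U ∧ Continuous V ∧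
      (∀ q, IsOrthonormalFrame (F₁ (π q)) (U q)) ∧ (∀ q, IsOrthonormalFrame (F₂ (π q)) (V q)) ∧
      (∀ q s, HasDerivAt (fun s => U (T s q)) (l (π (T s q)) * U (T s q) -
        U (T s q) * ((U (T s q))ᵀ * l (π (T s q)) * U (T s q))) s) ∧
      ∀ q s, HasDerivAt (fun s => V (T s q)) (l (π (T s q)) * V (T s q) -
        V (T s q) * ((V (T s q))ᵀ * l (π (T s q)) * V (T s q))) s := by
  obtain ⟨Ψ₁, hc₁, h0₁, ha₁, hd₁⟩ := h₁.exists_parallelTransport hl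
  obtain ⟨Ψ₂, hc₂, h0₂, ha₂, hd₂⟩ := h₂.exists_parallelTransport hl
  set T := frameFlow (m₁ := m₁) (m₂ := m₂) S Ψ₁ Ψ₂ hc₁ hc₂ h0₁ h0₂ ha₁ ha₂ with hT
  set E : Set (P × Matrix n m₁ ℝ × Matrix n m₂ ℝ) :=
    {x | IsOrthonormalFrame (F₁ x.1) x.2.1 ∧ IsOrthonormalFrame (F₂ x.1) x.2.2} with hE
  have hEinv : IsInvariant T E := fun s x hx => ⟨(hd₁ x.1 x.2.1 hx.1 s).1, (hd₂ x.1 x.2.2 hx.2 s).1⟩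
  have hEne : E.Nonempty := by
    obtain ⟨p⟩ := ‹Nonempty P›
    obtain ⟨U, hU⟩ := exists_isOrthonormalFrame (h₁.left_inv p)
    obtain ⟨V, hV⟩ := exists_isOrthonormalFrame (h₂.left_inv p)
    exact ⟨(p, U, V), hU, hV⟩
  have hEcl : IsClosed E := by
    have c₁ := h₁.continuous_rangeProjection
    have c₂ := h₂.continuous_rangeProjection
    simp only [hE, IsOrthonormalFrame, Set.ofPred_and]
    refine ((isClosed_eq ?_ ?_).inter (isClosed_eq ?_ ?_)).inter
      ((isClosed_eq ?_ ?_).inter (isClosed_eq ?_ ?_))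
    · fun_prop
    · fun_prop
    · exact Continuous.matrix_mul (c₁.comp continuous_fst) (by fun_prop)
    · fun_prop
    · fun_prop
    · fun_prop
    · exact Continuous.matrix_mul (c₂.comp continuous_fst) (by fun_prop)
    · fun_prop
  have hEc : IsCompact E := by
    refine (isCompact_univ.prod ((isCompact_closedBall 0 1).prod
      (isCompact_closedBall 0 1))).of_isClosed_subset hEcl fun x hx => ⟨mem_univ _, ?_, ?_⟩
    · exact mem_closedBall_zero_iff.2 hx.1.norm_le_one
    · exact mem_closedBall_zero_iff.2 hx.2.norm_le_one
  obtain ⟨M, hME, hMc, hMne, hMinv, hMmin⟩ := T.exists_isMinimalFlow_restrict hEc hEne hEinv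
  have := isCompact_iff_compactSpace.1 hMc
  have := hMne.to_subtype
  refine ⟨M, inferInstance, inferInstance, T.restrict hMinv, fun q => q.1.1, fun q => q.1.2.1,
    fun q => q.1.2.2, hMmin, ⟨by fun_prop, ?_, fun t q => rfl⟩, by fun_prop, by fun_prop,
    fun q => (hME q.2).1, fun q => (hME q.2).2, fun q s => ?_, fun q s => ?_⟩
  · exact hS.surjective_of_semiconj (T := T.restrict hMinv) (by fun_prop) fun t q => rfl
  · exact (hd₁ _ _ (hME q.2).1 s).2
  · exact (hd₂ _ _ (hME q.2).2 s).2

end OrthonormalExtension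

/-! ### Fundamental matrices in the orthonormal frame -/

section FundamentalMatrix

theorem l2_opNorm_mul_le {k m n : Type*} [Fintype k] [Fintype m] [Fintype n] [DecidableEq k]
    [DecidableEq m] [DecidableEq n] {A : Matrix k m ℝ} {B : Matrix m n ℝ} {a b : ℝ}
    (hA : ‖A‖ ≤ a) (hB : ‖B‖ ≤ b) : ‖A * B‖ ≤ a * b :=
  (Matrix.l2_opNorm_mul A B).trans
    (mul_le_mul hA hB (norm_nonneg _) ((norm_nonneg _).trans hA))

variable {P : Type*} [TopologicalSpace P] {m n : Type*} [Fintype m] [Fintype n] [DecidableEq m]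
  [DecidableEq n]

/-- Yᵀ F translates coordinates in the frame F into coordinates in Y, and L Y(0) goes back at time
0. Conjugating Z in this way costs only the bounds for F and L, since orthonormal frames have norm
at most 1. -/
theorem IsInvariantFrame.exists_isFundamentalMatrix {S : Flow ℝ P} {l : P → Matrix n n ℝ}
    {F : P → Matrix n m ℝ} {L : P → Matrix m n ℝ} {D : P → Matrix m m ℝ}
    (hF : IsInvariantFrame S l F L D) {p : P} {Y : ℝ → Matrix n m ℝ} {Z : ℝ → Matrix m m ℝ}
    (hY : ∀ s, IsOrthonormalFrame (F (S s p)) (Y s))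
    (hY' : ∀ s, HasDerivAt Y (l (S s p) * Y s - Y s * ((Y s)ᵀ * l (S s p) * Y s)) s)
    (hZ0 : Z 0 = 1) (hZ' : ∀ s, HasDerivAt Z (D (S s p) * Z s) s) {k : ℝ}
    (hFk : ∀ p, ‖F p‖ ≤ k) (hLk : ∀ p, ‖L p‖ ≤ k) :
    ∃ Φ, IsFundamentalMatrix (fun s => (Y s)ᵀ * l (S s p) * Y s) Φ ∧
      ∀ s, ‖Φ s‖ ≤ k * k * ‖Z s‖ := by
  refine ⟨fun s => (Y s)ᵀ * (F (S s p) * (Z s * (L p * Y 0))), ⟨?_, fun s => ?_⟩, fun s => ?_⟩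
  · have h0 := hY 0
    rw [Flow.map_zero_apply] at h0
    beta_reduce
    rw [hZ0, Flow.map_zero_apply, Matrix.one_mul, h0.mul_mul_self (hF.left_inv p), h0.1]
  · refine ((hY' s).matrixTranspose.matrixMul ((hF.deriv p s).matrixMul
      ((hZ' s).matrixMul_const _))).congr_deriv ?_
    have h1 := (hY s).self_mul_transpose_mul (hF.left_inv _)
    set W := L p * Y 0
    simp only [Matrix.transpose_sub, Matrix.transpose_mul, Matrix.transpose_transpose,
      Matrix.sub_mul, Matrix.mul_add, Matrix.mul_sub, Matrix.mul_assoc]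
    have h2 : Y s * ((Y s)ᵀ * (F (S s p) * (Z s * W))) = F (S s p) * (Z s * W) := by
      rw [← Matrix.mul_assoc _ (F _), ← Matrix.mul_assoc, h1]
    rw [h2]
    abel
  · have h1 : ‖(Y s)ᵀ‖ ≤ 1 := (l2_opNorm_transpose _).trans_le (hY s).norm_le_one
    refine (l2_opNorm_mul_le h1 (l2_opNorm_mul_le (hFk _)
      (l2_opNorm_mul_le (le_refl ‖Z s‖) (l2_opNorm_mul_le (hLk p) (hY 0).norm_le_one)))).trans
      (le_of_eq (by ring))

end FundamentalMatrix

/-! ### Assembling σ, a and b on the extension -/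

section BlockDiagonalization

theorem hasDerivAt_linearSolution_iff {n : Type*} [Fintype n] [DecidableEq n]
    {l σ ρ B : ℝ → Matrix n n ℝ} (h1 : ∀ s, ρ s * σ s = 1)
    (hσ : ∀ s, HasDerivAt σ (l s * σ s - σ s * B s) s) (y : ℝ → n → ℝ) :
    IsLinearSolution l (fun s => σ s *ᵥ y s) ↔ IsLinearSolution B y := by
  have h2 : ∀ s, σ s * ρ s = 1 := fun s => mul_eq_one_comm.1 (h1 s)
  refine ⟨fun h s => ?_, fun h s => ?_⟩
  · have hy : (fun s => ρ s *ᵥ (σ s *ᵥ y s)) = y := by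
      funext s
      rw [Matrix.mulVec_mulVec, h1, Matrix.one_mulVec]
    have h3 := (hasDerivAt_of_isInverse h1 h2 (hσ s)).matrixMulVec (h s)
    rw [hy] at h3
    refine h3.congr_deriv ?_
    simp only [Matrix.mulVec_mulVec, ← Matrix.add_mulVec]
    congr 1
    calc -(ρ s * (l s * σ s - σ s * B s) * ρ s) * σ s + ρ s * (l s * σ s)
        = -(ρ s * l s * σ s) * (ρ s * σ s) + ρ s * σ s * B s * (ρ s * σ s) + ρ s * l s * σ s := by
          noncomm_ring
      _ = B s := by rw [h1]; noncomm_ring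
  · refine ((hσ s).matrixMulVec (h s)).congr_deriv ?_
    simp only [Matrix.mulVec_mulVec, ← Matrix.add_mulVec]
    congr 1
    noncomm_ring

variable {P : Type u} [MetricSpace P] [CompactSpace P] [Nonempty P] {d e : ℕ}

theorem ciSup_norm_le_of_norm_le {X E F : Type*} [TopologicalSpace X] [CompactSpace X]
    [SeminormedAddCommGroup E] [SeminormedAddCommGroup F] {g : X → E} {h : X → F}
    (hh : Continuous h) (hgh : ∀ x, ‖g x‖ ≤ ‖h x‖) : (⨆ x, ‖g x‖) ≤ ⨆ x, ‖h x‖ := by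
  refine ciSup_mono ?_ hgh
  have := (isCompact_range hh.norm).bddAbove
  exact this

/-- The columns of σ are the two transported frames, and a, b are the compressions of l to them,
which gives the bounds by |l|₀. Each frame is orthonormal, but the two subbundles need not be
orthogonal; hence the inverse of σ needs the bound k. -/
theorem exists_minimal_blockDiagonalization (he : e ≤ d) {S : Flow ℝ P} (hS : IsMinimalFlow S)
    {l : P → Matrix (Fin d) (Fin d) ℝ} (hl : Continuous l)
    {F₁ : P → Matrix (Fin d) (Fin e) ℝ} {L₁ : P → Matrix (Fin e) (Fin d) ℝ}
    {D₁ : P → Matrix (Fin e) (Fin e) ℝ} {F₂ : P → Matrix (Fin d) (Fin (d - e)) ℝ}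
    {L₂ : P → Matrix (Fin (d - e)) (Fin d) ℝ} {D₂ : P → Matrix (Fin (d - e)) (Fin (d - e)) ℝ}
    (h₁ : IsInvariantFrame S l F₁ L₁ D₁) (h₂ : IsInvariantFrame S l F₂ L₂ D₂)
    (hL₁ : Continuous L₁) (hL₂ : Continuous L₂) (h12 : ∀ p, L₁ p * F₂ p = 0)
    (h21 : ∀ p, L₂ p * F₁ p = 0) {k : ℝ} (hF₁k : ∀ p, ‖F₁ p‖ ≤ k) (hL₁k : ∀ p, ‖L₁ p‖ ≤ k)
    (hF₂k : ∀ p, ‖F₂ p‖ ≤ k) (hL₂k : ∀ p, ‖L₂ p‖ ≤ k) :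
    ∃ (Q : Type u) (_ : MetricSpace Q) (_ : CompactSpace Q) (T : Flow ℝ Q) (π : Q → P)
      (σ : Q → Matrix (Fin d) (Fin d) ℝ) (a : Q → Matrix (Fin e) (Fin e) ℝ)
      (b : Q → Matrix (Fin (d - e)) (Fin (d - e)) ℝ),
      IsMinimalFlow T ∧ Flow.IsSemiconjugacy π T S ∧
      IsBlockDiagonalization he T (fun q => l (π q)) σ a b ∧
      (∀ q, ‖σ q‖ ≤ 2 ∧ ‖(σ q)⁻¹‖ ≤ 2 * (k * k)) ∧
      (∀ q (Z : ℝ → Matrix (Fin e) (Fin e) ℝ), Z 0 = 1 →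
        (∀ s, HasDerivAt Z (D₁ (S s (π q)) * Z s) s) →
        ∃ Φ, IsFundamentalMatrix (fun s => a (T s q)) Φ ∧ ∀ s, ‖Φ s‖ ≤ k * k * ‖Z s‖) ∧
      ∀ q (Z : ℝ → Matrix (Fin (d - e)) (Fin (d - e)) ℝ), Z 0 = 1 →
        (∀ s, HasDerivAt Z (D₂ (S s (π q)) * Z s) s) →
        ∃ Φ, IsFundamentalMatrix (fun s => b (T s q)) Φ ∧ ∀ s, ‖Φ s‖ ≤ k * k * ‖Z s‖ := by
  obtain ⟨Q, iM, iC, T, π, U, V, hT, hπ, hUc, hVc, hU, hV, hU', hV'⟩ :=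
    exists_orthonormal_extension hS hl h₁ h₂
  obtain ⟨J₁, J₂, hJ₁, hJ₂, hJ12, hJ21, hJ, hblock⟩ := exists_blockDiag_inclusions he
  have hπc := hπ.cont
  have hlπ : Continuous fun q => l (π q) := hl.comp hπc
  have hπT : ∀ s q, π (T s q) = S s (π q) := fun s q => hπ.semiconj s q
  set a : Q → Matrix (Fin e) (Fin e) ℝ := fun q => (U q)ᵀ * l (π q) * U q with ha
  set b : Q → Matrix (Fin (d - e)) (Fin (d - e)) ℝ := fun q => (V q)ᵀ * l (π q) * V q with hb
  set σ : Q → Matrix (Fin d) (Fin d) ℝ := fun q => U q * J₁ + V q * J₂ with hσ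
  -- F₁ L₁ and F₂ L₂ are the oblique projections onto one subbundle along the other; after them the
  -- transposed frame reads off the coordinates.
  set ρ : Q → Matrix (Fin d) (Fin d) ℝ := fun q =>
    J₁ᵀ * ((U q)ᵀ * (F₁ (π q) * L₁ (π q))) + J₂ᵀ * ((V q)ᵀ * (F₂ (π q) * L₂ (π q))) with hρ
  have hac : Continuous a := (hUc.matrix_transpose.matrix_mul hlπ).matrix_mul hUc
  have hbc : Continuous b := (hVc.matrix_transpose.matrix_mul hlπ).matrix_mul hVc
  have hσc : Continuous σ :=
    (hUc.matrix_mul continuous_const).add (hVc.matrix_mul continuous_const)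
  have hρc : Continuous ρ :=
    (continuous_const.matrix_mul (hUc.matrix_transpose.matrix_mul
      ((h₁.continuous_frame.comp hπc).matrix_mul (hL₁.comp hπc)))).add
    (continuous_const.matrix_mul (hVc.matrix_transpose.matrix_mul
      ((h₂.continuous_frame.comp hπc).matrix_mul (hL₂.comp hπc))))
  have hρσ : ∀ q, ρ q * σ q = 1 := fun q => by
    have e1 : F₁ (π q) * (L₁ (π q) * U q) = U q := (hU q).mul_mul_self (h₁.left_inv _)
    have e2 : F₂ (π q) * (L₂ (π q) * V q) = V q := (hV q).mul_mul_self (h₂.left_inv _)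
    have e3 : L₁ (π q) * V q = 0 := by rw [← e2, ← Matrix.mul_assoc, h12, Matrix.zero_mul]
    have e4 : L₂ (π q) * U q = 0 := by rw [← e1, ← Matrix.mul_assoc, h21, Matrix.zero_mul]
    have e5 : (U q)ᵀ * (F₁ (π q) * L₁ (π q)) * σ q = J₁ := by
      calc (U q)ᵀ * (F₁ (π q) * L₁ (π q)) * σ q =
          (U q)ᵀ * (F₁ (π q) * (L₁ (π q) * U q)) * J₁ +
            (U q)ᵀ * (F₁ (π q) * (L₁ (π q) * V q)) * J₂ := by
            simp only [hσ, Matrix.mul_add, Matrix.mul_assoc]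
        _ = J₁ := by rw [e1, e3, (hU q).1]; simp
    have e6 : (V q)ᵀ * (F₂ (π q) * L₂ (π q)) * σ q = J₂ := by
      calc (V q)ᵀ * (F₂ (π q) * L₂ (π q)) * σ q =
          (V q)ᵀ * (F₂ (π q) * (L₂ (π q) * U q)) * J₁ +
            (V q)ᵀ * (F₂ (π q) * (L₂ (π q) * V q)) * J₂ := by
            simp only [hσ, Matrix.mul_add, Matrix.mul_assoc]
        _ = J₂ := by rw [e2, e4, (hV q).1]; simp
    calc ρ q * σ q = J₁ᵀ * ((U q)ᵀ * (F₁ (π q) * L₁ (π q)) * σ q) +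
          J₂ᵀ * ((V q)ᵀ * (F₂ (π q) * L₂ (π q)) * σ q) := by
          simp only [hρ, Matrix.add_mul, Matrix.mul_assoc]
      _ = 1 := by rw [e5, e6, hJ]
  have hinv : ∀ q, (σ q)⁻¹ = ρ q := fun q => Matrix.inv_eq_left_inv (hρσ q)
  have hσ' : ∀ q s, HasDerivAt (fun s => σ (T s q))
      (l (π (T s q)) * σ (T s q) - σ (T s q) * blockDiag he (a (T s q)) (b (T s q))) s :=
    fun q s => by
      refine (((hU' q s).matrixMul_const J₁).add ((hV' q s).matrixMul_const J₂)).congr_deriv ?_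
      have e1 : σ (T s q) * blockDiag he (a (T s q)) (b (T s q)) =
          U (T s q) * (J₁ * J₁ᵀ) * a (T s q) * J₁ + U (T s q) * (J₁ * J₂ᵀ) * b (T s q) * J₂ +
          V (T s q) * (J₂ * J₁ᵀ) * a (T s q) * J₁ + V (T s q) * (J₂ * J₂ᵀ) * b (T s q) * J₂ := by
        rw [hblock]
        simp only [hσ, Matrix.add_mul, Matrix.mul_add, Matrix.mul_assoc]
        abel
      rw [e1, hJ₁, hJ₂, hJ12, hJ21]
      simp only [hσ, ha, hb, Matrix.mul_zero, Matrix.zero_mul, Matrix.mul_one, add_zero,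
        Matrix.sub_mul, Matrix.mul_add, Matrix.mul_assoc]
      abel
  have hU1 := fun q => (hU q).norm_le_one
  have hV1 := fun q => (hV q).norm_le_one
  have hUt : ∀ q, ‖(U q)ᵀ‖ ≤ 1 := fun q => (l2_opNorm_transpose _).trans_le (hU1 q)
  have hVt : ∀ q, ‖(V q)ᵀ‖ ≤ 1 := fun q => (l2_opNorm_transpose _).trans_le (hV1 q)
  have hJ₁t : ‖J₁ᵀ‖ ≤ 1 :=
    norm_le_one_of_transpose_mul_self (by rw [Matrix.transpose_transpose, hJ₁])
  have hJ₂t : ‖J₂ᵀ‖ ≤ 1 :=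
    norm_le_one_of_transpose_mul_self (by rw [Matrix.transpose_transpose, hJ₂])
  have hJ₁n : ‖J₁‖ ≤ 1 := (l2_opNorm_transpose _).symm.trans_le hJ₁t
  have hJ₂n : ‖J₂‖ ≤ 1 := (l2_opNorm_transpose _).symm.trans_le hJ₂t
  have hcompr : ∀ {m : Type} [Fintype m] [DecidableEq m] (W : Matrix (Fin d) m ℝ)
      (M : Matrix (Fin d) (Fin d) ℝ), ‖W‖ ≤ 1 → ‖Wᵀ * M * W‖ ≤ ‖M‖ := fun W M hW => by
    have hWt := (l2_opNorm_transpose W).trans_le hW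
    have h := l2_opNorm_mul_le (l2_opNorm_mul_le hWt le_rfl : ‖Wᵀ * M‖ ≤ _) hW
    simpa using h
  refine ⟨Q, iM, iC, T, π, σ, a, b, hT, hπ, ?_, fun q => ⟨?_, ?_⟩, fun q Z hZ0 hZ' => ?_,
    fun q Z hZ0 hZ' => ?_⟩
  · refine ⟨hσc, fun q => ?_, ?_, ⟨fun q => l (π q) * σ q - σ q * blockDiag he (a q) (b q), ?_,
      fun q => ?_⟩, hac, hbc, fun q y => ?_, ?_, ?_⟩
    · exact IsUnit.of_mul_eq_one_right _ (hρσ q)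
    · simpa only [hinv] using hρc
    · simp only [hblock]
      exact (hlπ.matrix_mul hσc).sub (hσc.matrix_mul
        (((continuous_const.matrix_mul hac).matrix_mul continuous_const).add
          ((continuous_const.matrix_mul hbc).matrix_mul continuous_const)))
    · simpa using hσ' q 0
    · exact hasDerivAt_linearSolution_iff (l := fun s => l (π (T s q)))
        (σ := fun s => σ (T s q)) (ρ := fun s => ρ (T s q)) (fun s => hρσ _) (hσ' q) y
    · refine ciSup_norm_le_of_norm_le hlπ fun q => ?_
      exact hcompr _ _ (hU1 q)
    · refine ciSup_norm_le_of_norm_le hlπ fun q => ?_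
      exact hcompr _ _ (hV1 q)
  · refine (norm_add_le_of_le (l2_opNorm_mul_le (hU1 q) hJ₁n)
      (l2_opNorm_mul_le (hV1 q) hJ₂n)).trans (by norm_num)
  · rw [hinv]
    refine (norm_add_le_of_le
      (l2_opNorm_mul_le hJ₁t (l2_opNorm_mul_le (hUt q) (l2_opNorm_mul_le (hF₁k _) (hL₁k _))))
      (l2_opNorm_mul_le hJ₂t (l2_opNorm_mul_le (hVt q)
        (l2_opNorm_mul_le (hF₂k _) (hL₂k _))))).trans (le_of_eq (by ring))
  · have h := h₁.exists_isFundamentalMatrix (p := π q) (Y := fun s => U (T s q))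
      (fun s => hπT s q ▸ hU (T s q)) (fun s => by simpa only [hπT] using hU' q s) hZ0 hZ' hF₁k hL₁k
    simpa only [← hπT] using h
  · have h := h₂.exists_isFundamentalMatrix (p := π q) (Y := fun s => V (T s q))
      (fun s => hπT s q ▸ hV (T s q)) (fun s => by simpa only [hπT] using hV' q s) hZ0 hZ' hF₂k hL₂k
    simpa only [← hπT] using h

end BlockDiagonalization

/-! ### Restricting a commuting system to the two blocks -/

section ReducedSystem

set_option linter.unusedSectionVars false

variable {P : Type*} [TopologicalSpace P] {m n : Type*} [Fintype m] [Fintype n] [DecidableEq m]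
  [DecidableEq n] {N : Matrix n m ℝ} {L : Matrix m n ℝ}

theorem mul_mul_mul_eq_of_commute (hLN : L * N = 1) {C : Matrix n n ℝ}
    (hC : C * (N * L) = N * L * C) : N * (L * C * N) = C * N := by
  calc N * (L * C * N) = N * L * C * N := by simp only [Matrix.mul_assoc]
    _ = C * N * (L * N) := by rw [← hC]; simp only [Matrix.mul_assoc]
    _ = C * N := by rw [hLN, Matrix.mul_one]

/-- C commutes with N L and so preserves the range of N, on which it acts as L C N; σ carries this
constant subspace to an invariant subbundle of the original system. -/
theorem isInvariantFrame_of_conjugacy {S : Flow ℝ P} {l σ ρ C : P → Matrix n n ℝ}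
    (hLN : L * N = 1) (hσ : Continuous σ) (hρσ : ∀ p, ρ p * σ p = 1)
    (hC : ∀ p, C p * (N * L) = N * L * C p)
    (hσ' : ∀ p s, HasDerivAt (fun s => σ (S s p))
      (l (S s p) * σ (S s p) - σ (S s p) * C (S s p)) s) :
    IsInvariantFrame S l (fun p => σ p * N) (fun p => L * ρ p) (fun p => L * C p * N) where
  continuous_frame := hσ.matrix_mul continuous_const
  left_inv p := by
    rw [Matrix.mul_assoc, ← Matrix.mul_assoc (ρ p), hρσ, Matrix.one_mul, hLN]
  deriv p s := by
    refine ((hσ' p s).matrixMul_const N).congr_deriv ?_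
    rw [Matrix.mul_assoc (σ (S s p)) N, mul_mul_mul_eq_of_commute hLN (hC (S s p))]
    simp only [Matrix.sub_mul, Matrix.mul_assoc]

theorem hasDerivAt_reducedSolution (hLN : L * N = 1) {C Ψ : ℝ → Matrix n n ℝ}
    (hC : ∀ s, C s * (N * L) = N * L * C s) (hΨ : ∀ s, HasDerivAt Ψ (C s * Ψ s) s) (s : ℝ) :
    HasDerivAt (fun s => L * Ψ s * N) (L * C s * N * (L * Ψ s * N)) s := by
  refine ((hΨ s).const_matrixMul L |>.matrixMul_const N).congr_deriv ?_
  calc L * (C s * Ψ s) * N = L * N * L * (C s * Ψ s) * N := by rw [hLN, Matrix.one_mul]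
    _ = L * (N * L * C s) * Ψ s * N := by simp only [Matrix.mul_assoc]
    _ = _ := by rw [← hC]; simp only [Matrix.mul_assoc]

theorem norm_reducedSolution_le (hLN : L * N = 1) {Ψ : Matrix n n ℝ} {t : ℝ}
    (ht : ‖N * L * Ψ‖ ≤ t) : ‖L * Ψ * N‖ ≤ ‖L‖ * t * ‖N‖ := by
  have h : L * Ψ * N = L * (N * L * Ψ) * N := by
    calc L * Ψ * N = L * N * L * Ψ * N := by rw [hLN, Matrix.one_mul]
      _ = _ := by simp only [Matrix.mul_assoc]
  rw [h]
  exact l2_opNorm_mul_le (l2_opNorm_mul_le le_rfl ht) le_rfl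

end ReducedSystem

/-! ### Linear parts and differentiation of the average -/

section LinearPart

set_option linter.unusedSectionVars false

/-- The matrix of a continuous linear endomorphism of `ℝᵈ`, as a continuous linear map. -/
def matrixOfCLM (d : ℕ) : (EuclideanSpace ℝ (Fin d) →L[ℝ] EuclideanSpace ℝ (Fin d)) →L[ℝ]
    Matrix (Fin d) (Fin d) ℝ :=
  LinearMap.toContinuousLinearMap
    (Matrix.toEuclideanCLM (n := Fin d) (𝕜 := ℝ)).symm.toAlgEquiv.toLinearMap

theorem linearPart_eq {d : ℕ} (g : EuclideanSpace ℝ (Fin d) → EuclideanSpace ℝ (Fin d)) :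
    linearPart g = matrixOfCLM d (fderiv ℝ g 0) := rfl

variable {P : Type u} [MetricSpace P] [CompactSpace P] {d : ℕ} {i₀ i₁ : ℝ} {r : ℕ}
  {f : P → EuclideanSpace ℝ (Fin d) → ℝ → EuclideanSpace ℝ (Fin d)}

theorem continuousOn_fderiv_of_iteratedFDeriv (hr : 1 ≤ r)
    (hf_cont : ∀ k : ℕ, k ≤ r →
      ContinuousOn
        (fun z : P × EuclideanSpace ℝ (Fin d) × ℝ =>
          iteratedFDeriv ℝ k (fun x => f z.1 x z.2.2) z.2.1)
        {z | z.2.2 ∈ Icc i₀ i₁}) :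
    ContinuousOn (fun z : P × EuclideanSpace ℝ (Fin d) × ℝ =>
      fderiv ℝ (fun x => f z.1 x z.2.2) z.2.1) {z | z.2.2 ∈ Icc i₀ i₁} := by
  refine ((continuousMultilinearCurryFin1 ℝ (EuclideanSpace ℝ (Fin d))
    (EuclideanSpace ℝ (Fin d))).continuous.comp_continuousOn (hf_cont 1 hr)).congr fun z _ => ?_
  ext1 x
  simp [iteratedFDeriv_one_apply]

theorem continuousOn_of_iteratedFDeriv
    (hf_cont : ∀ k : ℕ, k ≤ r →
      ContinuousOn
        (fun z : P × EuclideanSpace ℝ (Fin d) × ℝ =>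
          iteratedFDeriv ℝ k (fun x => f z.1 x z.2.2) z.2.1)
        {z | z.2.2 ∈ Icc i₀ i₁}) :
    ContinuousOn (fun z : P × EuclideanSpace ℝ (Fin d) × ℝ => f z.1 z.2.1 z.2.2)
      {z | z.2.2 ∈ Icc i₀ i₁} := by
  refine ((continuousMultilinearCurryFin0 ℝ (EuclideanSpace ℝ (Fin d))
    (EuclideanSpace ℝ (Fin d))).continuous.comp_continuousOn
      (hf_cont 0 (Nat.zero_le r))).congr fun z _ => ?_
  simp

theorem continuous_linearPart
    (hf : ContinuousOn (fun z : P × EuclideanSpace ℝ (Fin d) × ℝ =>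
      fderiv ℝ (fun x => f z.1 x z.2.2) z.2.1) {z | z.2.2 ∈ Icc i₀ i₁}) :
    Continuous fun z : P × Icc i₀ i₁ => linearPart fun x => f z.1 x z.2 := by
  simp only [linearPart_eq]
  exact (matrixOfCLM d).continuous.comp (hf.comp_continuous
    (f := fun z : P × Icc i₀ i₁ => (z.1, (0 : EuclideanSpace ℝ (Fin d)), (z.2 : ℝ)))
    (by fun_prop) fun z => z.2.2)

theorem exists_forall_norm_sub_le_of_continuous {X Y E : Type*} [PseudoMetricSpace X]
    [PseudoMetricSpace Y] [CompactSpace X] [CompactSpace Y] [SeminormedAddCommGroup E]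
    {g : X × Y → E} (hg : Continuous g) (y₀ : Y) {δ : ℝ} (hδ : 0 < δ) :
    ∃ η > 0, ∀ y, dist y y₀ < η → ∀ x, ‖g (x, y) - g (x, y₀)‖ ≤ δ := by
  obtain ⟨η, hη, h⟩ := Metric.uniformContinuous_iff.1
    (CompactSpace.uniformContinuous_of_continuous hg) δ hδ
  refine ⟨η, hη, fun y hy x => ?_⟩
  rw [← dist_eq_norm]
  exact (h (by simpa [Prod.dist_eq] using hy)).le

/-- Differentiation under the integral sign; on the compact set P × closed unit ball the derivative
is bounded, so a constant dominates. -/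
theorem linearPart_averagedField [MeasurableSpace P] [BorelSpace P] (μ : Measure P)
    [IsProbabilityMeasure μ] {ε : ℝ} (hε : ε ∈ Icc i₀ i₁)
    (hf_diff : ∀ p, Differentiable ℝ fun x => f p x ε)
    (hf₀ : ContinuousOn (fun z : P × EuclideanSpace ℝ (Fin d) × ℝ => f z.1 z.2.1 z.2.2)
      {z | z.2.2 ∈ Icc i₀ i₁})
    (hf₁ : ContinuousOn (fun z : P × EuclideanSpace ℝ (Fin d) × ℝ =>
      fderiv ℝ (fun x => f z.1 x z.2.2) z.2.1) {z | z.2.2 ∈ Icc i₀ i₁}) (i j : Fin d) :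
    linearPart (averagedField μ f ε) i j = ∫ p, linearPart (fun x => f p x ε) i j ∂μ := by
  have hc₀ : Continuous fun z : P × EuclideanSpace ℝ (Fin d) => f z.1 z.2 ε :=
    hf₀.comp_continuous (f := fun z : P × EuclideanSpace ℝ (Fin d) => (z.1, z.2, ε))
      (by fun_prop) fun _ => hε
  have hc₁ : Continuous fun z : P × EuclideanSpace ℝ (Fin d) =>
      fderiv ℝ (fun x => f z.1 x ε) z.2 :=
    hf₁.comp_continuous (f := fun z : P × EuclideanSpace ℝ (Fin d) => (z.1, z.2, ε))
      (by fun_prop) fun _ => hε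
  have hslice : ∀ x : EuclideanSpace ℝ (Fin d), Continuous fun p : P => (p, x) := fun x => by
    fun_prop
  obtain ⟨c, hc⟩ := (isCompact_univ.prod (isCompact_closedBall (0 : EuclideanSpace ℝ (Fin d))
    1)).exists_bound_of_continuousOn hc₁.continuousOn
  have hint : Integrable (fun p => fderiv ℝ (fun x => f p x ε) 0) μ :=
    (hc₁.comp (hslice 0)).integrable_of_hasCompactSupport (HasCompactSupport.of_compactSpace _)
  have hd : HasFDerivAt (averagedField μ f ε) (∫ p, fderiv ℝ (fun x => f p x ε) 0 ∂μ) 0 := by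
    refine hasFDerivAt_integral_of_dominated_of_fderiv_le (bound := fun _ => c)
      (F := fun x p => f p x ε) (F' := fun x p => fderiv ℝ (fun x => f p x ε) x)
      (Metric.closedBall_mem_nhds 0 one_pos) (.of_forall fun x => ?_) ?_ ?_
      (.of_forall fun p x hx => ?_) (integrable_const c) (.of_forall fun p x _ => ?_)
    · exact (hc₀.comp (hslice x)).aestronglyMeasurable
    · exact (hc₀.comp (hslice 0)).integrable_of_hasCompactSupport
        (HasCompactSupport.of_compactSpace _)
    · exact hint.aestronglyMeasurable
    · exact hc (p, x) ⟨mem_univ _, hx⟩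
    · exact (hf_diff p x).hasFDerivAt
  rw [linearPart_eq, hd.fderiv]
  simp only [linearPart_eq]
  exact (((matrixEntryCLM i j).comp (matrixOfCLM d)).integral_comp_comm hint).symm

end LinearPart

/-! ### Dependence of the Abel mean on the parameter -/

section PerturbedMean

/-- The weight e^{-u} has total mass 1, so replacing g by h costs at most their uniform distance.
This compares l_ε with l_0, since A is the mean of l_0 only. -/
theorem norm_expMean_le_add {P R : Type*} [TopologicalSpace P] [CompactSpace P]
    [NormedAddCommGroup R] [NormedSpace ℝ R] {S : Flow ℝ P} {g h : P → R}
    (hg : Continuous g) (hh : Continuous h) {A : R} {δ η : ℝ} {p : P}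
    (hgA : ‖∫ u in Ioi (0 : ℝ), Real.exp (-u) • (g (S u p) - A)‖ ≤ δ)
    (hhg : ∀ p, ‖h p - g p‖ ≤ η) :
    ‖∫ u in Ioi (0 : ℝ), Real.exp (-u) • (h (S u p) - A)‖ ≤ δ + η := by
  have hint : ∀ {w : P → R}, Continuous w →
      IntegrableOn (fun u => Real.exp (-u) • w (S u p)) (Ioi (0 : ℝ)) := fun {w} hw => by
    obtain ⟨c, -, hc⟩ := exists_pos_norm_le hw
    refine ((integrableOn_exp_neg_Ioi 0).mul_const c).mono' ?_ (.of_forall fun u => ?_)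
    · have : Continuous fun u => Real.exp (-u) • w (S u p) :=
        (by fun_prop : Continuous fun u : ℝ => Real.exp (-u)).smul (hw.comp (by fun_prop))
      exact this.aestronglyMeasurable
    · rw [norm_smul, Real.norm_of_nonneg (Real.exp_pos _).le]
      exact mul_le_mul_of_nonneg_left (hc _) (Real.exp_pos _).le
  have e : ∀ u, Real.exp (-u) • (h (S u p) - A) =
      Real.exp (-u) • (g (S u p) - A) + Real.exp (-u) • (h (S u p) - g (S u p)) := fun u => by
    rw [← smul_add]
    congr 1
    abel
  simp only [e]
  rw [integral_add (hint (w := fun p => g p - A) (by fun_prop))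
    (hint (w := fun p => h p - g p) (by fun_prop))]
  refine norm_add_le_of_le hgA ?_
  refine (norm_integral_le_of_norm_le ((integrableOn_exp_neg_Ioi 0).mul_const η)
    (.of_forall fun u => ?_)).trans (le_of_eq ?_)
  · rw [norm_smul, Real.norm_of_nonneg (Real.exp_pos _).le]
    exact mul_le_mul_of_nonneg_left (hhg _) (Real.exp_pos _).le
  · rw [integral_mul_const, integral_exp_neg_Ioi_zero, one_mul]

end PerturbedMean

end

/-! ### The main theorem -/

theorem mainTheorem6
    {P : Type u} [MetricSpace P] [CompactSpace P] [MeasurableSpace P] [BorelSpace P]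
    -- a strictly ergodic flow
    (τ : Flow ℝ P) (hmin : IsMinimalFlow τ)
    (μ : Measure P) (hμ : IsUniqueInvariantProbability τ μ)
    -- the compact parameter interval, with `0` in its interior
    (i₀ i₁ : ℝ) (hi₀ : i₀ < 0) (hi₁ : 0 < i₁)
    -- the right-hand side of the system
    {d : ℕ} (f : P → EuclideanSpace ℝ (Fin d) → ℝ → EuclideanSpace ℝ (Fin d))
    (r : ℕ) (hr : 1 ≤ r)
    (hf_smooth : ∀ p, ∀ ε ∈ Icc i₀ i₁, ContDiff ℝ r (fun x => f p x ε))
    (hf_cont : ∀ k : ℕ, k ≤ r →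
      ContinuousOn
        (fun z : P × EuclideanSpace ℝ (Fin d) × ℝ =>
          iteratedFDeriv ℝ k (fun x => f z.1 x z.2.2) z.2.1)
        {z | z.2.2 ∈ Icc i₀ i₁})
    (hf_zero : ∀ p, ∀ ε ∈ Icc i₀ i₁, f p 0 ε = 0)
    -- the spectral hypothesis on the averaged linear part at `ε = 0`
    (hspec : complexEigenvalues (linearPart (averagedField μ f 0)) =
      centerEigenvalues (linearPart (averagedField μ f 0)) ∪
        stableEigenvalues (linearPart (averagedField μ f 0)))
    (hcenter : (centerEigenvalues (linearPart (averagedField μ f 0))).Nonempty)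
    (hstable : (stableEigenvalues (linearPart (averagedField μ f 0))).Nonempty)
    (α β : ℝ) (hα : 0 < α) (hαβ : α < β)
    (hβ : ∀ z ∈ stableEigenvalues (linearPart (averagedField μ f 0)), z.re < -β) :
    ∃ ε₃ : ℝ, 0 < ε₃ ∧ ∃ θ : ℝ, 0 ≤ θ ∧ ∃ k₁ : ℝ, 0 < k₁ ∧
      ∀ ε ∈ Icc i₀ i₁, ε ≠ 0 → |ε| ≤ ε₃ →
        ∃ (Q : Type u) (_ : MetricSpace Q) (_ : CompactSpace Q) (T : Flow ℝ Q) (π : Q → P)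
          (σ : Q → Matrix (Fin d) (Fin d) ℝ)
          (a : Q → Matrix (Fin (centerDim (linearPart (averagedField μ f 0))))
            (Fin (centerDim (linearPart (averagedField μ f 0)))) ℝ)
          (b : Q → Matrix (Fin (d - centerDim (linearPart (averagedField μ f 0))))
            (Fin (d - centerDim (linearPart (averagedField μ f 0)))) ℝ),
          -- `(Q, T)` is a minimal extension of `P` with the fast flow
          IsMinimalFlow T ∧ Flow.IsSemiconjugacy π T (fastFlow τ ε) ∧
          IsBlockDiagonalization (centerDim_le (linearPart (averagedField μ f 0))) T
            (fun q => linearPart (fun x => f (π q) x ε)) σ a b ∧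
          -- (i)
          (∀ q, ‖σ q‖ ≤ θ ∧ ‖(σ q)⁻¹‖ ≤ θ) ∧
          -- (ii)
          (∀ q, ∃ Φa, IsFundamentalMatrix (fun s => a (T s q)) Φa ∧
            ∀ s : ℝ, ‖Φa s‖ ≤ k₁ * Real.exp (α * |s|)) ∧
          (∀ q, ∃ Φb, IsFundamentalMatrix (fun s => b (T s q)) Φb ∧
            ∀ s : ℝ, 0 ≤ s → ‖Φb s‖ ≤ k₁ * Real.exp (-β * s)) := by
  set A := linearPart (averagedField μ f 0) with hA
  have hμp : IsProbabilityMeasure μ := hμ.1.1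
  have hP : Nonempty P := μ.nonempty_of_neZero
  have h0 : (0 : ℝ) ∈ Icc i₀ i₁ := ⟨hi₀.le, hi₁.le⟩
  have hf₁ := continuousOn_fderiv_of_iteratedFDeriv hr hf_cont
  have hl := continuous_linearPart hf₁
  have hlε : ∀ ε ∈ Icc i₀ i₁, Continuous fun p => linearPart fun x => f p x ε := fun ε hε =>
    hl.comp (f := fun p : P => (p, (⟨ε, hε⟩ : Icc i₀ i₁))) (by fun_prop)
  -- One bound on the compact set P × I, so that nothing chosen below depends on ε.
  obtain ⟨m, hm, hlm⟩ := exists_pos_norm_le hl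
  obtain ⟨N, L, N', L', K, a₀, b₀, hLN, hLN', hLN0, hLN0', hsum, ha, hb, hE⟩ :=
    exists_isExponentialSplitting hspec hα hαβ hβ
  obtain ⟨ω, hω, k, hk, hblock⟩ := hE.exists_blockDiagonalization.{u} ha hb hm.le
  obtain ⟨ε₁, hε₁, hmean⟩ := hμ.matrix_expMean_close (hlε 0 h0)
    (linearPart_averagedField μ h0
      (fun p => (hf_smooth p 0 h0).differentiable (by exact_mod_cast (by omega : r ≠ 0)))
      (continuousOn_of_iteratedFDeriv hf_cont) hf₁) (half_pos hω)
  obtain ⟨ε₂, hε₂, hclose⟩ := exists_forall_norm_sub_le_of_continuous hl ⟨0, h0⟩ (half_pos hω)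
  -- A common bound for both frames σ N, σ N' and their left inverses L ρ, L' ρ.
  set k' := k * (‖N‖ + ‖L‖ + ‖N'‖ + ‖L'‖) with hk'
  have hkN : k * ‖N‖ ≤ k' := mul_le_mul_of_nonneg_left
    (by linarith [norm_nonneg L, norm_nonneg N', norm_nonneg L']) hk.le
  have hkL : ‖L‖ * k ≤ k' := (mul_comm _ _).trans_le <| mul_le_mul_of_nonneg_left
    (by linarith [norm_nonneg N, norm_nonneg N', norm_nonneg L']) hk.le
  have hkN' : k * ‖N'‖ ≤ k' := mul_le_mul_of_nonneg_left
    (by linarith [norm_nonneg L, norm_nonneg N, norm_nonneg L']) hk.le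
  have hkL' : ‖L'‖ * k ≤ k' := (mul_comm _ _).trans_le <| mul_le_mul_of_nonneg_left
    (by linarith [norm_nonneg N, norm_nonneg N', norm_nonneg L]) hk.le
  -- Up to ε₁ the Abel mean of l_0 - A is at most ω/2; below ε₂ the functions l_ε and l_0 differ by
  -- at most ω/2, and halving ε₂ makes that inequality strict. The summand 1 only keeps k₁ positive.
  refine ⟨min ε₁ (ε₂ / 2), by positivity, max 2 (2 * (k' * k')), by positivity,
    k' * k' * (‖L‖ * k * ‖N‖ + ‖L'‖ * k * ‖N'‖) + 1, by positivity, fun ε hε hε0 hεle => ?_⟩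
  set l : P → Matrix (Fin d) (Fin d) ℝ := fun p => linearPart fun x => f p x ε with hldef
  have hlc : Continuous l := hlε ε hε
  obtain ⟨σ, ρ, C, hσ, hρ, hC, hρσ, hσk, hρk, hCS, hσ', hΨ⟩ :=
    hblock (fastFlow τ ε) l hlc (fun p => hlm (p, ⟨ε, hε⟩)) fun p => by
      refine (norm_expMean_le_add (hlε 0 h0) hlc
        (hmean ε hε0 (hεle.trans (min_le_left _ _)) p) fun p => ?_).trans_eq (add_halves ω)
      refine hclose ⟨ε, hε⟩ ?_ p
      have : |ε| ≤ ε₂ / 2 := hεle.trans (min_le_right _ _)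
      rw [Subtype.dist_eq, Real.dist_eq, sub_zero]
      linarith
  have hN'L' : N' * L' = 1 - N * L := eq_sub_of_add_eq' hsum
  have hCS' : ∀ p, C p * (N' * L') = N' * L' * C p := fun p => by
    rw [hN'L', mul_sub, sub_mul, hCS, mul_one, one_mul]
  have hinv : ∀ {m₁ m₂ : Type} [Fintype m₁] [DecidableEq m₁] [Fintype m₂] [DecidableEq m₂]
      {X : Matrix m₁ (Fin d) ℝ} {Y : Matrix (Fin d) m₂ ℝ}, X * Y = 0 →
      ∀ p, X * ρ p * (σ p * Y) = 0 := fun {_ _} _ _ _ _ {X Y} h p => by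
    rw [Matrix.mul_assoc, ← Matrix.mul_assoc (ρ p), hρσ, Matrix.one_mul, h]
  obtain ⟨Q, iM, iC, T, π, s, a, b, hT, hπ, hblk, hs, hΦa, hΦb⟩ :=
    exists_minimal_blockDiagonalization (centerDim_le A) (isMinimalFlow_fastFlow hmin hε0) hlc
      (isInvariantFrame_of_conjugacy hLN hσ hρσ hCS hσ')
      (isInvariantFrame_of_conjugacy hLN' hσ hρσ hCS' hσ')
      (continuous_const.matrix_mul hρ) (continuous_const.matrix_mul hρ)
      (hinv hLN0) (hinv hLN0') (k := k')
      (fun p => (l2_opNorm_mul_le (hσk p) le_rfl).trans hkN)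
      (fun p => (l2_opNorm_mul_le le_rfl (hρk p)).trans hkL)
      (fun p => (l2_opNorm_mul_le (hσk p) le_rfl).trans hkN')
      (fun p => (l2_opNorm_mul_le le_rfl (hρk p)).trans hkL')
  refine ⟨Q, iM, iC, T, π, s, a, b, hT, hπ, hblk, fun q => ⟨(hs q).1.trans (le_max_left _ _),
    (hs q).2.trans (le_max_right _ _)⟩, fun q => ?_, fun q => ?_⟩
  · obtain ⟨Ψ, hΨ0, hΨ', hΨa, -⟩ := hΨ (π q)
    obtain ⟨Φ, hΦ, hΦle⟩ := hΦa q (fun s => L * Ψ s * N) (by simp [hΨ0, hLN])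
      (hasDerivAt_reducedSolution hLN (fun s => hCS _) hΨ')
    refine ⟨Φ, hΦ, fun s => (hΦle s).trans ?_⟩
    refine (mul_le_mul_of_nonneg_left (norm_reducedSolution_le hLN (hΨa s))
      (mul_self_nonneg k')).trans ?_
    have h1 : 0 ≤ k' * k' * (‖L'‖ * k * ‖N'‖) := by positivity
    calc _ = k' * k' * (‖L‖ * k * ‖N‖) * Real.exp (α * |s|) := by ring
      _ ≤ _ := by
        refine mul_le_mul_of_nonneg_right ?_ (Real.exp_pos _).le
        linarith
  · obtain ⟨Ψ, hΨ0, hΨ', -, hΨb⟩ := hΨ (π q)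
    obtain ⟨Φ, hΦ, hΦle⟩ := hΦb q (fun s => L' * Ψ s * N') (by simp [hΨ0, hLN'])
      (hasDerivAt_reducedSolution hLN' (fun s => hCS' _) hΨ')
    refine ⟨Φ, hΦ, fun s hs0 => (hΦle s).trans ?_⟩
    have h2 := hΨb s hs0
    rw [← hN'L'] at h2
    refine (mul_le_mul_of_nonneg_left (norm_reducedSolution_le hLN' h2)
      (mul_self_nonneg k')).trans ?_
    have h1 : 0 ≤ k' * k' * (‖L‖ * k * ‖N‖) := by positivity
    calc _ = k' * k' * (‖L'‖ * k * ‖N'‖) * Real.exp (-β * s) := by ring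
      _ ≤ _ := by
        refine mul_le_mul_of_nonneg_right ?_ (Real.exp_pos _).le
        linarith
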